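/- Let $T$ be a string of length $n$ over an integer alphabet $\{1,\dots,n^{d}\}$ ($d$ a constant) whose last character is the smallest character $\$=1$, which occurs nowhere else in $T$; let $r$ be the number of maximal runs of equal characters in the Burrows–Wheeler transform (BWT) of $T$, and let $\alpha\ge 16$ be an integer. *The algorithm r-comp.* It reads $T$ from right to left and, for $\delta=1,\dots,n$, maintains a divided BWT (DBWT) $D$ of the suffix $T_\delta$ of length $\delta$: a division of its BWT $L$ into repetitions of equal characters starting at positions $p_1<\dots<p_k$. The LF function $\mathsf{LF}(i)=|\{j: L[j]<L[i]\}|+|\{j\le i: L[j]=L[i]\}|$ maps the $i$-th repetition to an interval, its F-interval. A repetition (F-interval) is $\alpha$-heavy if, as an interval of positions, it contains at least $\alpha$ starting positions of F-intervals (of repetitions). Initially $D=(\$)$. For the next character $c$, let $\mathsf{rep}$ be the position of $\$$ in $L$ and $\mathsf{ins}=|\{j: L[j]<c\}|+|\{j\le\mathsf{rep}:L[j]=c\}|+1$. The update replaces the repetition $\$$ by $c$, splits at $\mathsf{ins}$ the repetition that contains $\mathsf{ins}$ but does not start there (if there is one), and inserts the repetition $\$$ at position $\mathsf{ins}$. If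 a repetition adjacent to the old $\$$ consists of $c$'s, then the new repetition $c$ is merged with neighbouring repetitions of $c$'s: if both neighbours are such, with both if the previous update split a repetition and with the left one only if it did not; otherwise with the one neighbour that is. Then, as long as there is an $\alpha$-heavy repetition or F-interval, an arbitrary one is chosen and split: if the $i$-th repetition is $\alpha$-heavy and $q_0<\dots<q_{t-1}$ are the starting positions of F-intervals that it contains, it is split at $q_{\lceil t/2\rceil}$; if it is not $\alpha$-heavy but its F-interval is, and $q_0<\dots<q_{t-1}$ are the starting positions of repetitions that the F-interval contains, the repetition is split at $p_i+q_{\lceil t/2\rceil}-\mathsf{LF}(p_i)$. After all characters have been read, $D$ is converted into the run-length encoding of the BWT of $T$. *Working space.* The algorithm runs on a word RAM with words of $w=\Theta(\log n)$ bits, $w\ge K\log_2 n$ for a constant $K$ depending only on $d$. It stores $D$ as its LF-interval graph: two doubly linked lists, one of the repetitions and one of the F-intervals in the order of their starting positions, where each node holds its label (character, length), a pointer to the corresponding node of the other list, a pointer to the node of the other list whose interval contains its starting position, and the offset in that interval; moreover, two arrays of the $\alpha$-heavy nodes, an order-maintenance structure (a tagged list of tagged groups) on the repetitions, a B-tree of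 constant order on F-intervals, a constant number of local variables, and at the end the list $D$ and the output. The read-only input is not counted. Then the following holds. 1. There is an absolute constant $C_0$ such that the final number $k$ of repetitions of $D$ is at most $C_0\, r$. 2. For $n\ge 2$, at every time during the execution all values stored fit into machine words and the number of bits in use is at most $C\, r\log_2 n$, where $C$ depends only on $d$, on the constant in $w=O(\log n)$, on the order of the B-tree and on the number of local variables, but not on $T$, $n$ or $\alpha$. That is, for $\alpha\ge 16$, r-comp uses $O(r\log n)$ bits of working space, and $k=O(r)$. -/

import Mathlib

/-! Strings are lists of natural numbers; positions are counted from `0`. -/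

namespace RComp

/-! ### Strings, BWT, runs -/

/-- The special character, the smallest character of the alphabet `{1, 2, ...}`. -/
def dollar : ℕ := 1

/-- `T` ends with the special character, which occurs nowhere else in `T`. -/
def IsText (T : List ℕ) : Prop :=
  ∃ S : List ℕ, T = S ++ [dollar] ∧ ∀ c ∈ S, dollar < c

/-- Starting positions of the suffixes of `T` in lexicographic order of the suffixes. -/
def suffixArray (T : List ℕ) : List ℕ :=
  (List.range T.length).mergeSort fun i j => decide (T.drop i ≤ T.drop j)

/-- The Burrows-Wheeler transform: the characters that precede the sorted suffixes, where the last
character of `T` precedes the suffix starting at position `0`. -/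
def bwt (T : List ℕ) : List ℕ :=
  (suffixArray T).map fun i => if i = 0 then T.getD (T.length - 1) 0 else T.getD (i - 1) 0

/-- The number `r` of maximal runs of equal characters in the BWT of `T`. -/
def numRuns (T : List ℕ) : ℕ := ((bwt T).splitBy (· == ·)).length

/-- Number of characters of `L` smaller than `c`. -/
def occLt (L : List ℕ) (c : ℕ) : ℕ := L.countP fun x => decide (x < c)

/-- Number of occurrences of `c` among the first `i` characters of `L`. -/
def rank (L : List ℕ) (c i : ℕ) : ℕ := (L.take i).count c

/-- The LF formula, for positions counted from `0`. -/
def lf (L : List ℕ) (i : ℕ) : ℕ := occLt L (L.getD i 0) + rank L (L.getD i 0) i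

/-! ### Divided BWTs -/

/-- A divided BWT is stored as the sequence of the labels (character, length) of its repetitions. -/
abbrev DBWT := List (ℕ × ℕ)

/-- The string represented by a sequence of repetitions. -/
def expand (D : DBWT) : List ℕ := D.flatMap fun x => List.replicate x.2 x.1

def char (D : DBWT) (i : ℕ) : ℕ := (D.getD i (0, 0)).1

def len (D : DBWT) (i : ℕ) : ℕ := (D.getD i (0, 0)).2

/-- Starting position of the `i`-th repetition. -/
def uStart (D : DBWT) (i : ℕ) : ℕ := ((D.take i).map Prod.snd).sum

/-- Starting position of the F-interval of the `i`-th repetition. The F-interval has the length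
of the repetition, since LF maps a repetition to consecutive positions. -/
def vStart (D : DBWT) (i : ℕ) : ℕ := lf (expand D) (uStart D i)

/-- The starting positions of F-intervals covered by the `i`-th repetition, in increasing order. -/
def coveredByU (D : DBWT) (i : ℕ) : List ℕ :=
  (((List.range D.length).map (vStart D)).filter fun x =>
    decide (uStart D i ≤ x ∧ x < uStart D i + len D i)).mergeSort

/-- The starting positions of repetitions covered by the `i`-th F-interval, in increasing order. -/
def coveredByV (D : DBWT) (i : ℕ) : List ℕ :=
  (((List.range D.length).map (uStart D)).filter fun x =>
    decide (vStart D i ≤ x ∧ x < vStart D i + len D i)).mergeSort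

/-- The `i`-th repetition is `α`-heavy. -/
def HeavyU (α : ℕ) (D : DBWT) (i : ℕ) : Prop := i < D.length ∧ α ≤ (coveredByU D i).length

/-- The `i`-th F-interval is `α`-heavy. -/
def HeavyV (α : ℕ) (D : DBWT) (i : ℕ) : Prop := i < D.length ∧ α ≤ (coveredByV D i).length

instance (α : ℕ) (D : DBWT) (i : ℕ) : Decidable (HeavyU α D i) :=
  inferInstanceAs (Decidable (_ ∧ _))

instance (α : ℕ) (D : DBWT) (i : ℕ) : Decidable (HeavyV α D i) :=
  inferInstanceAs (Decidable (_ ∧ _))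

def Balanced (α : ℕ) (D : DBWT) : Prop := ∀ i, ¬ HeavyU α D i ∧ ¬ HeavyV α D i

/-! ### Elementary operations on the sequence of nodes -/

/-- Splits the node that contains position `q` in its interior; does nothing if there is none. -/
def cutAt : DBWT → ℕ → DBWT
  | [], _ => []
  | (a, l) :: D, q =>
    if q = 0 then (a, l) :: D
    else if q < l then (a, q) :: (a, l - q) :: D
    else (a, l) :: cutAt D (q - l)

/-- Inserts the node `x` at position `q`, which is the start of a node or the end of the string. -/
def insertAt (x : ℕ × ℕ) : DBWT → ℕ → DBWT
  | [], _ => [x]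
  | (a, l) :: D, q => if q = 0 then x :: (a, l) :: D else (a, l) :: insertAt x D (q - l)

/-- Merges the node that ends right before position `q` with the node that starts at `q`. -/
def joinAt : DBWT → ℕ → DBWT
  | (a, l) :: (b, k) :: D, q =>
    if q = l then (a, l + k) :: D else (a, l) :: joinAt ((b, k) :: D) (q - l)
  | D, _ => D

/-- Character at the position before `q`, if there is one. -/
def charBefore (L : List ℕ) (q : ℕ) : Option ℕ := if q = 0 then none else L[q - 1]?

/-! ### Update of the LF-interval graph with the next character `c` -/

/-- Position of the special character in the string of `D`. -/
def repPos (D : DBWT) : ℕ := (expand D).idxOf dollar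

/-- Insertion position of the special character in the extended BWT. -/
def insPos (D : DBWT) (c : ℕ) : ℕ := occLt (expand D) c + rank (expand D) c (repPos D)

/-- Replace-node step: the node labelled `($, 1)` gets the label `(c, 1)`. -/
def replaceNode (D : DBWT) (c : ℕ) : DBWT := D.map fun x => if x = (dollar, 1) then (c, 1) else x

/-- Split-node step. -/
def splitNode (D : DBWT) (c : ℕ) : DBWT := cutAt (replaceNode D c) (insPos D c)

/-- Insert-node step. -/
def insertNode (D : DBWT) (c : ℕ) : DBWT := insertAt (dollar, 1) (splitNode D c) (insPos D c)

/-- Whether the split-node step splits a node, i.e. the insertion position lies strictly inside a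
repetition. -/
def splits (D : DBWT) (c : ℕ) : Bool :=
  (List.range D.length).any fun j =>
    decide (uStart D j < insPos D c ∧ insPos D c < uStart D j + len D j)

/-- Whether one of the two nodes next to the node of the special character is labelled with `c`; in
this case the fast update is applied. -/
def isFast (D : DBWT) (c : ℕ) : Bool :=
  charBefore (expand D) (repPos D) == some c || (expand D)[repPos D + 1]? == some c

/-- Position, after the insert-node step, of the node `(c, 1)` created by the replace-node step. -/
def newPos (D : DBWT) (c : ℕ) : ℕ := if insPos D c ≤ repPos D then repPos D + 1 else repPos D

/-- Merging of nodes in the fast update. The flag `prev` says whether the previous update split a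
node: the new node `(c, 1)` is merged with both of its neighbours labelled `c` only if it did. -/
def mergeNodes (D : DBWT) (c : ℕ) (prev : Bool) : DBWT :=
  let E := insertNode D c
  let q := newPos D c
  let left := charBefore (expand E) q == some c
  let right := (expand E)[q + 1]? == some c
  if left && right && prev then joinAt (joinAt E (q + 1)) q
  else if left then joinAt E q
  else if right then joinAt E (q + 1)
  else E

/-- The update of `D` with the next character `c`: the fast update if it applies, and otherwise
the update without merging. -/
def update (D : DBWT) (c : ℕ) (prev : Bool) : DBWT :=
  if isFast D c then mergeNodes D c prev else insertNode D c

/-! ### Balancing -/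

/-- The position at which the balancing operation splits an `α`-heavy repetition. -/
def cutU (D : DBWT) (i : ℕ) : ℕ :=
  (coveredByU D i).getD (((coveredByU D i).length + 1) / 2) 0

/-- The position at which the balancing operation splits the `i`-th repetition when its F-interval
is `α`-heavy: the offset in the F-interval is transferred to the repetition. -/
def cutV (D : DBWT) (i : ℕ) : ℕ :=
  uStart D i + ((coveredByV D i).getD (((coveredByV D i).length + 1) / 2) 0 - vStart D i)

/-- One iteration of the balancing operation, with an arbitrary choice of the heavy node. -/
inductive BalanceStep (α : ℕ) : DBWT → DBWT → Prop
  | caseU (D : DBWT) (i : ℕ) (h : HeavyU α D i) : BalanceStep α D (cutAt D (cutU D i))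
  | caseV (D : DBWT) (i : ℕ) (h' : ¬ HeavyU α D i) (h : HeavyV α D i) :
      BalanceStep α D (cutAt D (cutV D i))

/-! ### The r-comp algorithm -/

/-- The character read when `δ` characters, from the end of `T`, have been processed. -/
def nextChar (T : List ℕ) (δ : ℕ) : ℕ := T.getD (T.length - δ - 1) 0

/-- `Run α T δ D b`: after `δ` characters of `T` have been processed, r-comp can hold the
LF-interval graph of the balanced DBWT `D`; `b` says whether the last update split a node. -/
inductive Run (α : ℕ) (T : List ℕ) : ℕ → DBWT → Bool → Prop
  | init : Run α T 1 [(dollar, 1)] false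
  | step (δ : ℕ) (D D' : DBWT) (b : Bool) (h : Run α T δ D b) (hδ : δ < T.length)
      (hb : Relation.ReflTransGen (BalanceStep α) (update D (nextChar T δ) b) D')
      (hD' : Balanced α D') : Run α T (δ + 1) D' (splits D (nextChar T δ))

/-- The run-length encoding obtained from a DBWT by merging consecutive repetitions of the same
character. -/
def compress : DBWT → DBWT
  | (a, l) :: D =>
    match compress D with
    | (b, k) :: E => if a = b then (a, l + k) :: E else (a, l) :: (b, k) :: E
    | [] => [(a, l)]
  | [] => []

/-- `Visits α T D out`: at some time during a run of r-comp on `T` the LF-interval graph in memory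
is the one of `D`, while `out` is the content of the buffer used for the final conversion into
the RLBWT. -/
inductive Visits (α : ℕ) (T : List ℕ) : DBWT → DBWT → Prop
  | start (δ : ℕ) (D : DBWT) (b : Bool) (h : Run α T δ D b) : Visits α T D []
  | replaced (δ : ℕ) (D : DBWT) (b : Bool) (h : Run α T δ D b) (hδ : δ < T.length) :
      Visits α T (replaceNode D (nextChar T δ)) []
  | split (δ : ℕ) (D : DBWT) (b : Bool) (h : Run α T δ D b) (hδ : δ < T.length) :
      Visits α T (splitNode D (nextChar T δ)) []
  | inserted (δ : ℕ) (D : DBWT) (b : Bool) (h : Run α T δ D b) (hδ : δ < T.length) :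
      Visits α T (insertNode D (nextChar T δ)) []
  | balancing (δ : ℕ) (D D' : DBWT) (b : Bool) (h : Run α T δ D b) (hδ : δ < T.length)
      (hb : Relation.ReflTransGen (BalanceStep α) (update D (nextChar T δ) b) D') :
      Visits α T D' []
  | recovered (D : DBWT) (b : Bool) (h : Run α T T.length D b) : Visits α T D D
  | converted (D : DBWT) (b : Bool) (h : Run α T T.length D b) : Visits α T D (D ++ compress D)

/-! ### The LF-interval graph in memory

The nodes `u_i`, `v_i` of the graph of `D` are addressed by `i < k`, where `k = D.length`, and `k`
is the null pointer. Every field is one machine word. -/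

/-- Index of the F-interval that covers the start of the `i`-th repetition. -/
def edgeL (D : DBWT) (i : ℕ) : ℕ :=
  (List.range D.length).findIdx fun j =>
    decide (vStart D j ≤ uStart D i ∧ uStart D i < vStart D j + len D j)

/-- Index of the repetition that covers the start of the `j`-th F-interval. -/
def edgeF (D : DBWT) (j : ℕ) : ℕ :=
  (List.range D.length).findIdx fun i =>
    decide (uStart D i ≤ vStart D j ∧ vStart D j < uStart D i + len D i)

/-- The nodes of `V` in the order of the starting positions of their F-intervals. -/
def vOrder (D : DBWT) : List ℕ :=
  (List.range D.length).mergeSort fun i j => decide (vStart D i ≤ vStart D j)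

/-- The record of `u_i` in the doubly linked list of `U`: previous and next node, `E_LF`-pointer,
`E_L`-pointer and its label, character, length. -/
def uRecord (D : DBWT) (i : ℕ) : List ℕ :=
  [if i = 0 then D.length else i - 1, i + 1, i, edgeL D i, uStart D i - vStart D (edgeL D i),
    char D i, len D i]

/-- The record of `v_i` in the doubly linked list of `V`, with `E_F` in place of `E_L`. -/
def vRecord (D : DBWT) (i : ℕ) : List ℕ :=
  let p := (vOrder D).idxOf i
  [if p = 0 then D.length else (vOrder D).getD (p - 1) D.length, (vOrder D).getD (p + 1) D.length,
    i, edgeF D i, vStart D i - uStart D (edgeF D i), char D i, len D i]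

/-- The two doubly linked lists. -/
def graphWords (D : DBWT) : List ℕ :=
  (List.range D.length).flatMap (uRecord D) ++ (List.range D.length).flatMap (vRecord D)

/-- Order maintenance data structure: a list of groups, each with a tag and a list of elements
(pointer to a node of `U`, tag). -/
abbrev OrderList := List (ℕ × List (ℕ × ℕ))

/-- The structure holds the nodes `u_0, ..., u_{k-1}` in this order; tags are machine words of `w`
bits and increase along the groups and inside every group. -/
def OrderList.Valid (w k : ℕ) (o : OrderList) : Prop :=
  (o.flatMap fun g => g.2.map Prod.fst) = List.range k ∧
  (o.map Prod.fst).Pairwise (· < ·) ∧ (∀ g ∈ o, g.1 < 2 ^ w) ∧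
  ∀ g ∈ o, g.2 ≠ [] ∧ (g.2.map Prod.snd).Pairwise (· < ·) ∧ ∀ e ∈ g.2, e.2 < 2 ^ w

/-- A group stores its tag and two list pointers; an element stores its node, its tag, its group and
two list pointers. -/
def OrderList.words (k : ℕ) (o : OrderList) : List ℕ :=
  o.zipIdx.flatMap fun (g, j) =>
    [g.1, if j = 0 then o.length else j - 1, j + 1] ++
      g.2.flatMap fun e => [e.1, e.2, j, if e.1 = 0 then k else e.1 - 1, e.1 + 1]

/-- B-trees of height `h` whose keys are (indices of) nodes of `V`. -/
def BTree : ℕ → Type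
  | 0 => List ℕ
  | h + 1 => List ℕ × List (BTree h)

/-- The sequence `c₀, k₀, c₁, k₁, ...` of the keys of the children and the keys of a tree node. -/
def interleave : List (List ℕ) → List ℕ → List ℕ
  | [], ks => ks
  | c :: cs, [] => c ++ interleave cs []
  | c :: cs, k :: ks => c ++ k :: interleave cs ks

def BTree.inorder : (h : ℕ) → BTree h → List ℕ
  | 0, ks => ks
  | h + 1, (ks, cs) => interleave (cs.map (BTree.inorder h)) ks

/-- The shape conditions of a B-tree of order `m`: at most `m` children; at least `⌈m/2⌉` children
(resp. keys plus one) except at the root; an inner root has at least two children. -/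
def BTree.Valid (m : ℕ) : (root : Bool) → (h : ℕ) → BTree h → Prop
  | root, 0, ks =>
    List.length (α := ℕ) ks + 1 ≤ m ∧ (root = false → m ≤ 2 * (List.length (α := ℕ) ks + 1))
  | root, h + 1, (ks, cs) =>
    ks.length + 1 ≤ m ∧ (root = false → m ≤ 2 * (ks.length + 1)) ∧ 1 ≤ ks.length ∧
      cs.length = ks.length + 1 ∧ ∀ t ∈ cs, BTree.Valid m false h t

def BTree.numNodes : (h : ℕ) → BTree h → ℕ
  | 0, _ => 1
  | h + 1, (_, cs) => 1 + (cs.map (BTree.numNodes h)).sum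

/-- The addresses of consecutive subtrees that are stored from address `a` on. -/
def childAddrs (h : ℕ) : ℕ → List (BTree h) → List ℕ
  | _, [] => []
  | a, t :: ts => a :: childAddrs h (a + t.numNodes) ts

/-- The block of a tree node: number of keys, the keys (each with the pointer to `v_i`, the pointer
to `u_i` and the character of `u_i`), the addresses of the children; blocks have fixed size. -/
def btreeBlock (m : ℕ) (D : DBWT) (ks addrs : List ℕ) : List ℕ :=
  (ks.length :: (ks.flatMap fun i => [i, i, char D i]) ++ addrs).rightpad (4 * m) 0

def BTree.words (m : ℕ) (D : DBWT) : (h : ℕ) → ℕ → BTree h → List ℕ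
  | 0, _, ks => btreeBlock m D ks []
  | h + 1, a, (ks, cs) =>
    btreeBlock m D ks (childAddrs h (a + 1) cs) ++
      (cs.zip (childAddrs h (a + 1) cs)).flatMap fun (t, a') => BTree.words m D h a' t

/-- The parts of the memory that are not determined by the DBWT. -/
structure Memory where
  /-- array of the nodes of heavy repetitions -/
  heavyU : List ℕ
  /-- array of the nodes of heavy F-intervals -/
  heavyV : List ℕ
  order : OrderList
  height : ℕ
  btree : BTree height
  /-- local variables -/
  regs : List ℕ

/-- `M` is a possible content of the memory of r-comp while it holds the LF-interval graph of `D`: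
the heavy nodes are stored in any order, the B-tree of order `m` stores some of the nodes of `V`
in the order of `V`, and there are at most `ρ` local variables; words have `w` bits. -/
structure Memory.Represents (M : Memory) (w m ρ α : ℕ) (D : DBWT) : Prop where
  heavyU : M.heavyU.Perm ((List.range D.length).filter fun i => decide (HeavyU α D i))
  heavyV : M.heavyV.Perm ((List.range D.length).filter fun i => decide (HeavyV α D i))
  order : OrderList.Valid w D.length M.order
  btree : BTree.Valid m true M.height M.btree
  keys : (BTree.inorder M.height M.btree).Sublist (vOrder D)
  regs : M.regs.length ≤ ρ ∧ ∀ x ∈ M.regs, x < 2 ^ w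

/-- All machine words in use: the two linked lists, the two arrays (with their lengths), the order
maintenance structure, the B-tree, the local variables and the output buffer. -/
def Memory.words (M : Memory) (m : ℕ) (D out : DBWT) : List ℕ :=
  graphWords D ++ (M.heavyU.length :: M.heavyU) ++ (M.heavyV.length :: M.heavyV) ++
    OrderList.words D.length M.order ++ BTree.words m D M.height 0 M.btree ++ M.regs ++
    out.flatMap fun x => [x.1, x.2]

/-- Working space in bits, with machine words of `w` bits. -/
def Memory.bits (M : Memory) (w m : ℕ) (D out : DBWT) : ℕ := (M.words m D out).length * w

end RComp

/-!
Remove the special character from the BWT and let `S` be the set of boundaries of the repetitions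
that remain. The boundaries, and their images under LF, are two increasing families of positions;
count the members of each family in the gaps between consecutive members of the other, but at most
four in each gap. This potential is at most `2 * |S|`. Splitting a repetition or F-interval that
covers at least `16` members of the other family leaves four of them on both sides, so it raises the
count for the divided gap by four, while the new member divides at most one gap of the other family
and lowers the count there by at most one: each balancing step gains three. Inserting a character
keeps the relative order of the two families, hence it does not lower the potential, and merging
removes just the boundaries that the insertion makes superfluous. New boundaries that remain arise
only together with a new run of the string without the special character; at most two of them cost
eleven units each, eight of the potential and three for `3 * |S|`. Hence
`3 * |S| ≤ potential + 22 * runs + 3` throughout, so `|S|` is linear in the number of runs, which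
never decreases as the text grows. The memory holds `O(m)` words per node of the graph.
-/

namespace RComp

/-! ### The potential of two families of intervals -/

section Potential

variable {α ι κ : Type*} [LinearOrder α]

/-- Every point of the interval `x` is smaller than every point of the interval `y`. -/
abbrev Precedes (x y : NonemptyInterval α) : Prop := x.snd < y.fst

theorem Precedes.trans {x y z : NonemptyInterval α} (hxy : Precedes x y) (hyz : Precedes y z) :
    Precedes x z :=
  lt_trans hxy (y.fst_le_snd.trans_lt hyz)

theorem Precedes.asymm {x y : NonemptyInterval α} (hxy : Precedes x y) : ¬ Precedes y x :=
  fun hyx => (hxy.trans hyx).not_ge x.fst_le_snd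

/-- The members of the family `u` with index in `I` are pairwise disjoint intervals. -/
def Separated (u : ι → NonemptyInterval α) (I : Finset ι) : Prop :=
  (I : Set ι).Pairwise fun s s' => Precedes (u s) (u s') ∨ Precedes (u s') (u s)

/-- The members of the family `v` that lie between the `s`-th member of the family `u` and all later
members of `u`. -/
def between (u : ι → NonemptyInterval α) (v : κ → NonemptyInterval α) (I : Finset ι) (J : Finset κ)
    (s : ι) : Finset κ :=
  J.filter fun t => Precedes (u s) (v t) ∧ ∀ s' ∈ I, Precedes (u s) (u s') → Precedes (v t) (u s')

/-- The number of members of `v` in the gaps between consecutive members of `u`, where at most `m`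
of them count in each gap. -/
def potential (m : ℕ) (u : ι → NonemptyInterval α) (v : κ → NonemptyInterval α) (I : Finset ι)
    (J : Finset κ) : ℕ :=
  ∑ s ∈ I, min m (between u v I J s).card

variable {m : ℕ} {u : ι → NonemptyInterval α} {v : κ → NonemptyInterval α} {I : Finset ι}
  {J : Finset κ} {e s : ι}

theorem mem_between {t : κ} :
    t ∈ between u v I J s ↔ t ∈ J ∧ Precedes (u s) (v t) ∧
      ∀ s' ∈ I, Precedes (u s) (u s') → Precedes (v t) (u s') :=
  Finset.mem_filter

theorem Separated.pairwiseDisjoint_between (hI : Separated u I) :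
    (I : Set ι).PairwiseDisjoint (between u v I J) := by
  intro s hs s' hs' hne
  rw [Function.onFun, Finset.disjoint_left]
  intro t ht ht'
  rw [mem_between] at ht ht'
  rcases hI hs hs' hne with h | h
  · exact ht'.2.1.asymm (ht.2.2 s' hs' h)
  · exact ht.2.1.asymm (ht'.2.2 s hs h)

theorem potential_le_card (hI : Separated u I) : potential m u v I J ≤ J.card := by
  classical
  calc potential m u v I J ≤ ∑ s ∈ I, (between u v I J s).card :=
        Finset.sum_le_sum fun _ _ => min_le_right _ _
    _ = (I.biUnion (between u v I J)).card := (Finset.card_biUnion hI.pairwiseDisjoint_between).symm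
    _ ≤ J.card := Finset.card_le_card (Finset.biUnion_subset.2 fun _ _ => Finset.filter_subset _ _)

theorem potential_mono_right {J' : Finset κ} (h : J ⊆ J') :
    potential m u v I J ≤ potential m u v I J' :=
  Finset.sum_le_sum fun _ _ => min_le_min_left _
    (Finset.card_le_card (Finset.filter_subset_filter _ h))

theorem potential_le_image {ι' κ' : Type*} [DecidableEq ι'] [DecidableEq κ']
    {u₁ : ι' → NonemptyInterval α} {v₁ : κ' → NonemptyInterval α} {f : ι → ι'} {g : κ → κ'}
    (hf : Set.InjOn f I) (hg : Set.InjOn g J)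
    (huu : ∀ s ∈ I, ∀ s' ∈ I, Precedes (u₁ (f s)) (u₁ (f s')) → Precedes (u s) (u s'))
    (huv : ∀ s ∈ I, ∀ t ∈ J, Precedes (u s) (v t) → Precedes (u₁ (f s)) (v₁ (g t)))
    (hvu : ∀ s ∈ I, ∀ t ∈ J, Precedes (v t) (u s) → Precedes (v₁ (g t)) (u₁ (f s))) :
    potential m u v I J ≤ potential m u₁ v₁ (I.image f) (J.image g) := by
  rw [potential, potential, Finset.sum_image hf]
  refine Finset.sum_le_sum fun s hs => min_le_min_left _ (Finset.card_le_card_of_injOn g ?_ ?_)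
  · intro t ht
    obtain ⟨htJ, hst, ht⟩ := mem_between.1 ht
    refine mem_between.2 ⟨Finset.mem_image_of_mem g htJ, huv s hs t htJ hst, ?_⟩
    exact Finset.forall_mem_image.2 fun s' hs' hss' =>
      hvu s' hs' t htJ (ht s' hs' (huu s hs s' hs' hss'))
  · exact hg.mono fun t ht => (mem_between.1 ht).1

/-- The member of the family `u` before the interval `u e`. -/
def IsPredecessor (u : ι → NonemptyInterval α) (I : Finset ι) (s e : ι) : Prop :=
  s ∈ I ∧ Precedes (u s) (u e) ∧
    ∀ s' ∈ I, s' ≠ s → Precedes (u s') (u e) → Precedes (u s') (u s)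

theorem Separated.exists_isPredecessor (hI : Separated u I) {s₀ : ι} (hs₀ : s₀ ∈ I)
    (h : Precedes (u s₀) (u e)) : ∃ s, IsPredecessor u I s e := by
  obtain ⟨s, hs, hmax⟩ := Finset.exists_max_image (I.filter fun s => Precedes (u s) (u e))
    (fun s => (u s).fst) ⟨s₀, Finset.mem_filter.2 ⟨hs₀, h⟩⟩
  obtain ⟨hsI, hse⟩ := Finset.mem_filter.1 hs
  refine ⟨s, hsI, hse, fun s' hs' hne hs'e => (hI hs' hsI hne).resolve_right fun hss' => ?_⟩
  exact (hss'.trans_le (hmax s' (Finset.mem_filter.2 ⟨hs', hs'e⟩))).not_ge (u s).fst_le_snd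

section Insert

variable [DecidableEq ι]

theorem mem_between_insert {t : κ} :
    t ∈ between u v (insert e I) J s ↔
      t ∈ between u v I J s ∧ (Precedes (u s) (u e) → Precedes (v t) (u e)) := by
  simp only [mem_between, Finset.forall_mem_insert]
  tauto

theorem between_insert_of_not_precedes (h : ¬ Precedes (u s) (u e)) :
    between u v (insert e I) J s = between u v I J s := by
  ext t
  simp only [mem_between_insert, h, false_imp_iff, and_true]

theorem between_insert_of_precedes {s' : ι} (hs : s ∈ I) (hs' : Precedes (u s') (u s))
    (hse : Precedes (u s) (u e)) : between u v (insert e I) J s' = between u v I J s' := by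
  ext t
  rw [mem_between_insert, and_iff_left_iff_imp]
  exact fun ht _ => ((mem_between.1 ht).2.2 s hs hs').trans hse

theorem potential_insert_of_forall_not_precedes (he : e ∉ I)
    (h : ∀ s ∈ I, ¬ Precedes (u s) (u e)) :
    potential m u v (insert e I) J = potential m u v I J + min m (between u v I J e).card := by
  have hee : ¬ Precedes (u e) (u e) := (u e).fst_le_snd.not_gt
  rw [potential, Finset.sum_insert he, between_insert_of_not_precedes hee, add_comm]
  exact congrArg (· + _)
    (Finset.sum_congr rfl fun s hs => by rw [between_insert_of_not_precedes (h s hs)])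

theorem IsPredecessor.potential_insert (hs : IsPredecessor u I s e) (he : e ∉ I) :
    potential m u v (insert e I) J + min m (between u v I J s).card =
      potential m u v I J + min m (between u v I J e).card +
        min m (between u v (insert e I) J s).card := by
  obtain ⟨hsI, hse, hpred⟩ := hs
  have hee : ¬ Precedes (u e) (u e) := (u e).fst_le_snd.not_gt
  have hother : ∑ s' ∈ I.erase s, min m (between u v (insert e I) J s').card =
      ∑ s' ∈ I.erase s, min m (between u v I J s').card := by
    refine Finset.sum_congr rfl fun s' hs' => ?_
    obtain ⟨hne, hs'I⟩ := Finset.mem_erase.1 hs'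
    by_cases hs'e : Precedes (u s') (u e)
    · rw [between_insert_of_precedes hsI (hpred s' hs'I hne hs'e) hse]
    · rw [between_insert_of_not_precedes hs'e]
  rw [potential, potential, Finset.sum_insert he, between_insert_of_not_precedes hee,
    ← Finset.add_sum_erase _ _ hsI, ← Finset.add_sum_erase I
      (fun s' => min m (between u v I J s').card) hsI, hother]
  omega

theorem Separated.potential_insert_cases (hI : Separated u (insert e I)) (he : e ∉ I) :
    potential m u v (insert e I) J = potential m u v I J + min m (between u v I J e).card ∨
      ∃ s, IsPredecessor u I s e := by
  by_cases h : ∃ s ∈ I, Precedes (u s) (u e)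
  · obtain ⟨s, hs, hse⟩ := h
    refine Or.inr (Separated.exists_isPredecessor (hI.mono ?_) hs hse)
    exact Finset.coe_subset.2 (Finset.subset_insert e I)
  · push Not at h
    exact Or.inl (potential_insert_of_forall_not_precedes he fun s hs => (h s hs).not_gt)

theorem potential_le_insert_add (hI : Separated u (insert e I)) :
    potential m u v I J ≤ potential m u v (insert e I) J + m := by
  by_cases he : e ∈ I
  · rw [Finset.insert_eq_of_mem he]
    exact Nat.le_add_right _ _
  rcases hI.potential_insert_cases (m := m) (v := v) (J := J) he with h | ⟨s, hs⟩
  · omega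
  · have := hs.potential_insert (m := m) (v := v) (J := J) he
    omega

theorem IsPredecessor.card_between_le (hs : IsPredecessor u I s e)
    (hmeet : ∀ t ∈ J, ∀ t' ∈ J, ¬ Precedes (v t) (u e) → ¬ Precedes (u e) (v t) →
      ¬ Precedes (v t') (u e) → ¬ Precedes (u e) (v t') → t = t') :
    (between u v I J s).card ≤
      (between u v (insert e I) J s).card + (between u v I J e).card + 1 := by
  classical
  let M := J.filter fun t => ¬ Precedes (v t) (u e) ∧ ¬ Precedes (u e) (v t)
  have hM : M.card ≤ 1 := Finset.card_le_one.2 fun t ht t' ht' => by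
    obtain ⟨htJ, ht₁, ht₂⟩ := Finset.mem_filter.1 ht
    obtain ⟨ht'J, ht'₁, ht'₂⟩ := Finset.mem_filter.1 ht'
    exact hmeet t htJ t' ht'J ht₁ ht₂ ht'₁ ht'₂
  have hsub : between u v I J s ⊆ between u v (insert e I) J s ∪ between u v I J e ∪ M := by
    intro t ht
    obtain ⟨htJ, -, hlater⟩ := mem_between.1 ht
    simp only [Finset.mem_union]
    by_cases hte : Precedes (v t) (u e)
    · exact Or.inl (Or.inl (mem_between_insert.2 ⟨ht, fun _ => hte⟩))
    by_cases het : Precedes (u e) (v t)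
    · exact Or.inl (Or.inr (mem_between.2 ⟨htJ, het, fun s' hs' hes' =>
        hlater s' hs' (Precedes.trans hs.2.1 hes')⟩))
    · exact Or.inr (Finset.mem_filter.2 ⟨htJ, hte, het⟩)
  calc (between u v I J s).card ≤ _ := Finset.card_le_card hsub
    _ ≤ (between u v (insert e I) J s).card + (between u v I J e).card + M.card :=
      (Finset.card_union_le _ _).trans (Nat.add_le_add_right (Finset.card_union_le _ _) _)
    _ ≤ _ := Nat.add_le_add_left hM _

theorem potential_le_insert_add_one (he : e ∉ I) (hI : Separated u (insert e I))
    (hmeet : ∀ t ∈ J, ∀ t' ∈ J, ¬ Precedes (v t) (u e) → ¬ Precedes (u e) (v t) →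
      ¬ Precedes (v t') (u e) → ¬ Precedes (u e) (v t') → t = t') :
    potential m u v I J ≤ potential m u v (insert e I) J + 1 := by
  rcases hI.potential_insert_cases (m := m) (v := v) (J := J) he with h | ⟨s, hs⟩
  · omega
  · have := hs.potential_insert (m := m) (v := v) (J := J) he
    have := hs.card_between_le hmeet
    omega

/-- Here `A` and `B` lie on the two sides of `e` in the gap of `I` that `e` divides. -/
theorem potential_add_le_insert (he : e ∉ I) (hI : Separated u (insert e I)) {A B : Finset κ}
    (hAJ : A ⊆ J) (hBJ : B ⊆ J) (hA : m ≤ A.card) (hB : m ≤ B.card)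
    (hAe : ∀ t ∈ A, Precedes (v t) (u e) ∧ ∀ s ∈ I, Precedes (u s) (u e) → Precedes (u s) (v t))
    (heB : ∀ t ∈ B, Precedes (u e) (v t) ∧ ∀ s ∈ I, Precedes (u e) (u s) → Precedes (v t) (u s)) :
    potential m u v I J + m ≤ potential m u v (insert e I) J := by
  have hBe : m ≤ (between u v I J e).card :=
    hB.trans (Finset.card_le_card fun t ht => mem_between.2 ⟨hBJ ht, heB t ht⟩)
  rcases hI.potential_insert_cases (m := m) (v := v) (J := J) he with h | ⟨s, hs⟩
  · omega
  · have hAs : m ≤ (between u v (insert e I) J s).card := by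
      refine hA.trans (Finset.card_le_card fun t ht => mem_between.2 ⟨hAJ ht, ?_⟩)
      refine ⟨(hAe t ht).2 s hs.1 hs.2.1, Finset.forall_mem_insert _ _ _ |>.2 ?_⟩
      refine ⟨fun _ => (hAe t ht).1, fun s' hs' hss' => ?_⟩
      have hne : s' ≠ e := by rintro rfl; exact he hs'
      rcases hI (Finset.mem_insert_of_mem hs') (Finset.mem_insert_self e I) hne with h | h
      · exact absurd (hs.2.2 s' hs' (by rintro rfl; exact hss'.asymm hss') h) hss'.asymm
      · exact (hAe t ht).1.trans h
    have := hs.potential_insert (m := m) (v := v) (J := J) he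
    omega

end Insert

end Potential

/-! ### Boundaries of the repetitions -/

/-- Every repetition of the DBWT is non-empty. -/
def Proper (D : DBWT) : Prop := ∀ x ∈ D, 0 < x.2

/-- The starting positions of the repetitions together with the end of the string. -/
def boundaries : DBWT → Finset ℕ
  | [] => {0}
  | x :: D => insert 0 ((boundaries D).image (x.2 + ·))

section Boundaries

variable {D : DBWT} {x : ℕ × ℕ} {i j q : ℕ}

@[simp] theorem expand_nil : expand [] = [] := rfl

@[simp] theorem expand_cons (x : ℕ × ℕ) (D : DBWT) :
    expand (x :: D) = List.replicate x.2 x.1 ++ expand D :=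
  List.flatMap_cons

theorem length_expand_cons (x : ℕ × ℕ) (D : DBWT) :
    (expand (x :: D)).length = x.2 + (expand D).length := by
  rw [expand_cons, List.length_append, List.length_replicate]

@[simp] theorem proper_nil : Proper [] := List.forall_mem_nil _

@[simp] theorem proper_cons : Proper (x :: D) ↔ 0 < x.2 ∧ Proper D := List.forall_mem_cons

theorem mem_boundaries_cons :
    q ∈ boundaries (x :: D) ↔ q = 0 ∨ x.2 ≤ q ∧ q - x.2 ∈ boundaries D := by
  simp only [boundaries, Finset.mem_insert, Finset.mem_image]
  refine or_congr_right ⟨?_, fun ⟨hle, hq⟩ => ⟨_, hq, Nat.add_sub_cancel' hle⟩⟩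
  rintro ⟨r, hr, rfl⟩
  exact ⟨Nat.le_add_right _ _, by rwa [Nat.add_sub_cancel_left]⟩

theorem zero_mem_boundaries (D : DBWT) : 0 ∈ boundaries D := by
  cases D with
  | nil => exact Finset.mem_singleton_self 0
  | cons x D => exact Finset.mem_insert_self _ _

theorem length_expand_mem_boundaries (D : DBWT) : (expand D).length ∈ boundaries D := by
  induction D with
  | nil => exact Finset.mem_singleton_self 0
  | cons x D ih =>
    rw [mem_boundaries_cons, length_expand_cons]
    exact Or.inr ⟨Nat.le_add_right _ _, by rwa [Nat.add_sub_cancel_left]⟩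

theorem le_length_of_mem_boundaries (h : q ∈ boundaries D) : q ≤ (expand D).length := by
  induction D generalizing q with
  | nil => exact (Finset.mem_singleton.1 h).le
  | cons x D ih =>
    rw [mem_boundaries_cons] at h
    rw [length_expand_cons]
    rcases h with rfl | ⟨hle, h⟩
    · exact Nat.zero_le _
    · have := ih h
      omega

theorem Proper.card_boundaries (h : Proper D) : (boundaries D).card = D.length + 1 := by
  induction D with
  | nil => rfl
  | cons x D ih =>
    rw [proper_cons] at h
    have hzero : 0 ∉ (boundaries D).image (x.2 + ·) := by
      simp only [Finset.mem_image, not_exists, not_and]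
      omega
    rw [boundaries, Finset.card_insert_of_notMem hzero,
      Finset.card_image_of_injective _ (add_right_injective x.2), ih h.2, List.length_cons]

theorem Proper.length_le (h : Proper D) : D.length ≤ (expand D).length := by
  induction D with
  | nil => exact le_rfl
  | cons x D ih =>
    rw [proper_cons] at h
    have := ih h.2
    rw [length_expand_cons, List.length_cons]
    omega

theorem Proper.fst_mem_expand (h : Proper D) (hx : x ∈ D) : x.1 ∈ expand D :=
  List.mem_flatMap.2 ⟨x, hx, List.mem_replicate.2 ⟨(h x hx).ne', rfl⟩⟩

theorem snd_le_length_expand (hx : x ∈ D) : x.2 ≤ (expand D).length := by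
  induction D with
  | nil => cases hx
  | cons y D ih =>
    rw [length_expand_cons]
    rcases List.mem_cons.1 hx with rfl | hx
    · exact Nat.le_add_right _ _
    · exact (ih hx).trans (Nat.le_add_left _ _)

@[simp] theorem uStart_zero (D : DBWT) : uStart D 0 = 0 := rfl

theorem uStart_cons_succ (x : ℕ × ℕ) (D : DBWT) (i : ℕ) :
    uStart (x :: D) (i + 1) = x.2 + uStart D i := by
  simp only [uStart, List.take_succ_cons, List.map_cons, List.sum_cons]

theorem len_cons_zero (x : ℕ × ℕ) (D : DBWT) : len (x :: D) 0 = x.2 := rfl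

theorem len_cons_succ (x : ℕ × ℕ) (D : DBWT) (i : ℕ) : len (x :: D) (i + 1) = len D i := rfl

theorem char_cons_succ (x : ℕ × ℕ) (D : DBWT) (i : ℕ) : char (x :: D) (i + 1) = char D i := rfl

theorem uStart_mem_boundaries (D : DBWT) (i : ℕ) : uStart D i ∈ boundaries D := by
  induction D generalizing i with
  | nil => simp only [uStart, List.take_nil, List.map_nil, List.sum_nil, zero_mem_boundaries]
  | cons x D ih =>
    cases i with
    | zero => exact zero_mem_boundaries _
    | succ i =>
      rw [uStart_cons_succ, mem_boundaries_cons, Nat.add_sub_cancel_left]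
      exact Or.inr ⟨Nat.le_add_right _ _, ih i⟩

theorem uStart_succ (hi : i < D.length) : uStart D (i + 1) = uStart D i + len D i := by
  rw [uStart, List.take_succ_eq_append_getElem hi, List.map_append, List.sum_append, ← uStart]
  simp only [List.map_cons, List.map_nil, List.sum_singleton, len, List.getD_eq_getElem D _ hi]

theorem uStart_le_length (D : DBWT) (i : ℕ) : uStart D i ≤ (expand D).length :=
  le_length_of_mem_boundaries (uStart_mem_boundaries D i)

theorem uStart_add_len_le_length (hi : i < D.length) :
    uStart D i + len D i ≤ (expand D).length :=
  uStart_succ hi ▸ uStart_le_length D (i + 1)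

theorem Proper.len_pos (h : Proper D) (hi : i < D.length) : 0 < len D i := by
  rw [len, List.getD_eq_getElem D _ hi]
  exact h _ (List.getElem_mem hi)

theorem Proper.uStart_lt_length (h : Proper D) (hi : i < D.length) :
    uStart D i < (expand D).length :=
  (Nat.lt_add_of_pos_right (h.len_pos hi)).trans_le (uStart_add_len_le_length hi)

theorem uStart_add_len_le_of_lt (hij : i < j) (hi : i < D.length) :
    uStart D i + len D i ≤ uStart D j := by
  have htake : D.take (i + 1) <+: D.take j := List.take_prefix_take_left (Nat.succ_le_of_lt hij)
  rw [← uStart_succ hi]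
  exact (htake.sublist.map _).sum_le_sum fun _ _ => Nat.zero_le _

theorem Proper.uStart_inj (h : Proper D) (hi : i < D.length) (hj : j < D.length)
    (heq : uStart D i = uStart D j) : i = j := by
  rcases lt_trichotomy i j with hij | rfl | hij
  · have := uStart_add_len_le_of_lt hij hi
    have := h.len_pos hi
    omega
  · rfl
  · have := uStart_add_len_le_of_lt hij hj
    have := h.len_pos hj
    omega

theorem le_uStart_or_le_of_mem_boundaries (hi : i < D.length) (hq : q ∈ boundaries D) :
    q ≤ uStart D i ∨ uStart D i + len D i ≤ q := by
  induction D generalizing i q with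
  | nil => cases hi
  | cons x D ih =>
    rw [mem_boundaries_cons] at hq
    rcases hq with rfl | ⟨hle, hq⟩
    · exact Or.inl (Nat.zero_le _)
    cases i with
    | zero => exact Or.inr (by rwa [uStart_zero, zero_add, len_cons_zero])
    | succ i =>
      have := ih (Nat.lt_of_succ_lt_succ hi) hq
      rw [uStart_cons_succ, len_cons_succ]
      omega

theorem getElem?_expand (hi : i < D.length) (hij : uStart D i ≤ j)
    (hji : j < uStart D i + len D i) : (expand D)[j]? = some (char D i) := by
  induction D generalizing i j with
  | nil => cases hi
  | cons x D ih =>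
    cases i with
    | zero =>
      rw [uStart_zero, zero_add, len_cons_zero] at hji
      rw [expand_cons, List.getElem?_append_left (by rwa [List.length_replicate]),
        List.getElem?_replicate_of_lt hji]
      rfl
    | succ i =>
      rw [uStart_cons_succ, len_cons_succ] at hji
      rw [uStart_cons_succ] at hij
      rw [expand_cons, List.getElem?_append_right (by rw [List.length_replicate]; omega),
        List.length_replicate, char_cons_succ]
      exact ih (Nat.lt_of_succ_lt_succ hi) (by omega) (by omega)

theorem exists_uStart_le_lt (hq : q < (expand D).length) :
    ∃ i < D.length, uStart D i ≤ q ∧ q < uStart D i + len D i := by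
  induction D generalizing q with
  | nil => cases hq
  | cons x D ih =>
    rw [length_expand_cons] at hq
    by_cases hqx : q < x.2
    · exact ⟨0, Nat.succ_pos _, Nat.zero_le _, by rwa [uStart_zero, zero_add, len_cons_zero]⟩
    · obtain ⟨i, hi, hiq, hqi⟩ := ih (q := q - x.2) (by omega)
      refine ⟨i + 1, Nat.succ_lt_succ hi, ?_⟩
      rw [uStart_cons_succ, len_cons_succ]
      omega

theorem exists_uStart_lt_lt (hq : q < (expand D).length) (hqD : q ∉ boundaries D) :
    ∃ i < D.length, uStart D i < q ∧ q < uStart D i + len D i := by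
  obtain ⟨i, hi, hiq, hqi⟩ := exists_uStart_le_lt hq
  exact ⟨i, hi, hiq.lt_of_ne fun h => hqD (h ▸ uStart_mem_boundaries D i), hqi⟩

theorem splits_iff {c : ℕ} (h : insPos D c ≤ (expand D).length) :
    splits D c = true ↔ insPos D c ∉ boundaries D := by
  simp only [splits, List.any_eq_true, List.mem_range, decide_eq_true_eq]
  constructor
  · rintro ⟨j, hj, hlt, hgt⟩ hmem
    have := le_uStart_or_le_of_mem_boundaries hj hmem
    omega
  · intro hnot
    refine exists_uStart_lt_lt (h.lt_of_ne fun heq => hnot ?_) hnot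
    exact heq ▸ length_expand_mem_boundaries D

theorem getElem?_expand_pred (hq : q < (expand D).length) (hqD : q ∉ boundaries D) :
    (expand D)[q - 1]? = (expand D)[q]? := by
  obtain ⟨i, hi, hiq, hqi⟩ := exists_uStart_lt_lt hq hqD
  rw [getElem?_expand hi hiq.le hqi, getElem?_expand hi (by omega) (by omega)]

theorem pos_of_notMem_boundaries (hqD : q ∉ boundaries D) : 0 < q :=
  Nat.pos_of_ne_zero fun h => hqD (h ▸ zero_mem_boundaries D)

end Boundaries

/-! ### Elementary operations on the sequence of repetitions -/

section Operations

variable {D : DBWT} {x : ℕ × ℕ} {q r : ℕ}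

theorem expand_cutAt (D : DBWT) (q : ℕ) : expand (cutAt D q) = expand D := by
  induction D generalizing q with
  | nil => rfl
  | cons x D ih =>
    obtain ⟨a, l⟩ := x
    rw [cutAt]
    split_ifs with hzero hlt
    · rfl
    · simp only [expand_cons, ← List.append_assoc, ← List.replicate_add,
        Nat.add_sub_cancel' hlt.le]
    · rw [expand_cons, ih, expand_cons]

theorem Proper.cutAt (h : Proper D) (q : ℕ) : Proper (cutAt D q) := by
  induction D generalizing q with
  | nil => exact h
  | cons x D ih =>
    obtain ⟨a, l⟩ := x
    rw [RComp.cutAt]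
    rw [proper_cons] at h
    split_ifs with hzero hlt
    · exact proper_cons.2 h
    · exact proper_cons.2 ⟨Nat.pos_of_ne_zero hzero, proper_cons.2 ⟨Nat.sub_pos_of_lt hlt, h.2⟩⟩
    · exact proper_cons.2 ⟨h.1, ih h.2 _⟩

theorem boundaries_cutAt (hq : q ≤ (expand D).length) :
    boundaries (cutAt D q) = insert q (boundaries D) := by
  induction D generalizing q with
  | nil => rw [Nat.le_zero.1 hq]; rfl
  | cons x D ih =>
    obtain ⟨a, l⟩ := x
    rw [length_expand_cons] at hq
    ext r
    rw [cutAt]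
    split_ifs with hzero hlt
    · grind [mem_boundaries_cons]
    · have hsub : r - q - (l - q) = r - l := by omega
      simp only [Finset.mem_insert, mem_boundaries_cons, hsub]
      grind [zero_mem_boundaries]
    · simp only [Finset.mem_insert, mem_boundaries_cons, ih (q := q - l) (by omega)]
      grind [zero_mem_boundaries]

theorem length_cutAt_le (D : DBWT) (q : ℕ) : (cutAt D q).length ≤ D.length + 1 := by
  induction D generalizing q with
  | nil => exact Nat.zero_le _
  | cons x D ih =>
    rw [cutAt]
    split_ifs
    · exact Nat.le_succ _
    · exact le_rfl
    · exact Nat.succ_le_succ (ih _)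

theorem length_insertAt (x : ℕ × ℕ) (D : DBWT) (q : ℕ) :
    (insertAt x D q).length = D.length + 1 := by
  induction D generalizing q with
  | nil => rfl
  | cons y D ih =>
    rw [insertAt]
    split_ifs
    · rfl
    · rw [List.length_cons, ih, List.length_cons]

theorem Proper.insertAt (hx : 0 < x.2) (h : Proper D) (q : ℕ) : Proper (insertAt x D q) := by
  induction D generalizing q with
  | nil => exact proper_cons.2 ⟨hx, proper_nil⟩
  | cons y D ih =>
    rw [RComp.insertAt]
    split_ifs
    · exact proper_cons.2 ⟨hx, h⟩
    · rw [proper_cons] at h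
      exact proper_cons.2 ⟨h.1, ih h.2 _⟩

theorem expand_insertAt (hq : q ∈ boundaries D) :
    expand (insertAt x D q) =
      (expand D).take q ++ (List.replicate x.2 x.1 ++ (expand D).drop q) := by
  induction D generalizing q with
  | nil => rw [insertAt, expand_cons, expand_nil, List.take_nil, List.drop_nil, List.nil_append]
  | cons y D ih =>
    obtain ⟨a, l⟩ := y
    rw [insertAt]
    rw [mem_boundaries_cons] at hq
    split_ifs with hzero
    · rw [hzero, expand_cons, List.take_zero, List.drop_zero, List.nil_append]
    · obtain ⟨hlq : l ≤ q, hq⟩ := hq.resolve_left hzero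
      have hlen : (List.replicate l a).length ≤ q := by rwa [List.length_replicate]
      simp only [expand_cons, ih hq, List.take_append, List.drop_append,
        List.take_of_length_le hlen, List.drop_of_length_le hlen, List.length_replicate,
        List.nil_append, List.append_assoc]

theorem mem_boundaries_insertAt (h : Proper D) (hq : q ∈ boundaries D) :
    r ∈ boundaries (insertAt x D q) ↔
      (r ≤ q ∧ r ∈ boundaries D) ∨ (q + x.2 ≤ r ∧ r - x.2 ∈ boundaries D) := by
  induction D generalizing q r with
  | nil =>
    rw [Finset.mem_singleton.1 hq, insertAt, mem_boundaries_cons]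
    simp only [boundaries, Finset.mem_singleton]
    omega
  | cons y D ih =>
    obtain ⟨a, l⟩ := y
    rw [insertAt]
    rw [proper_cons] at h
    split_ifs with hzero
    · rw [mem_boundaries_cons]
      grind [zero_mem_boundaries]
    · rw [mem_boundaries_cons] at hq
      obtain ⟨hlq, hq⟩ := hq.resolve_left hzero
      have hsub : r - x.2 - l = r - l - x.2 := Nat.sub_right_comm r x.2 l
      simp only [mem_boundaries_cons, ih h.2 hq, hsub]
      by_cases hr : r - l ∈ boundaries D <;> by_cases hr' : r - l - x.2 ∈ boundaries D <;>
        simp only [hr, hr', and_true, and_false, or_false, false_or] <;> omega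

theorem Proper.joinAt (h : Proper D) (q : ℕ) : Proper (joinAt D q) := by
  induction D generalizing q with
  | nil => exact h
  | cons y D ih =>
    cases D with
    | nil => exact h
    | cons z D =>
      rw [RComp.joinAt]
      rw [proper_cons] at h
      split_ifs
      · exact proper_cons.2 ⟨Nat.add_pos_left h.1 _, (proper_cons.1 h.2).2⟩
      · exact proper_cons.2 ⟨h.1, ih h.2 _⟩

theorem expand_joinAt (h : Proper D) (hq : q ∈ boundaries D) (hpos : 0 < q)
    (heq : (expand D)[q - 1]? = (expand D)[q]?) : expand (joinAt D q) = expand D := by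
  induction D generalizing q with
  | nil => rfl
  | cons y D ih =>
    cases D with
    | nil => rfl
    | cons z D =>
      obtain ⟨a, l⟩ := y
      obtain ⟨b, k⟩ := z
      rw [joinAt]
      rw [proper_cons] at h
      split_ifs with hql
      · subst hql
        have hab : a = b := by
          have hk : 0 < k := (proper_cons.1 h.2).1
          rw [expand_cons, List.getElem?_append_left (by simp; omega),
            List.getElem?_append_right (by simp), List.getElem?_replicate_of_lt (by simp; omega)]
            at heq
          simpa [hk] using heq
        rw [hab, expand_cons, expand_cons, expand_cons, List.replicate_add, List.append_assoc]
      · rw [mem_boundaries_cons] at hq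
        obtain ⟨hlq : l ≤ q, hq : q - l ∈ _⟩ := hq.resolve_left hpos.ne'
        rw [expand_cons, List.getElem?_append_right (by simp; omega),
          List.getElem?_append_right (by simp; omega), List.length_replicate,
          Nat.sub_right_comm] at heq
        rw [expand_cons, ih h.2 hq (by omega) heq, ← expand_cons]

theorem boundaries_joinAt (h : Proper D) (hq : q ∈ boundaries D) (hpos : 0 < q)
    (hlt : q < (expand D).length) : boundaries (joinAt D q) = (boundaries D).erase q := by
  induction D generalizing q with
  | nil => cases hlt
  | cons y D ih =>
    obtain ⟨a, l⟩ := y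
    rw [proper_cons] at h
    rw [length_expand_cons] at hlt
    rw [mem_boundaries_cons] at hq
    obtain ⟨hlq : l ≤ q, hq : q - l ∈ _⟩ := hq.resolve_left hpos.ne'
    cases D with
    | nil => exact absurd hlt (Nat.not_lt.2 hlq)
    | cons z D =>
      obtain ⟨b, k⟩ := z
      have hk : 0 < k := (proper_cons.1 h.2).1
      have : 0 < l := h.1
      ext r
      rw [joinAt]
      split_ifs with hql
      · simp only [Finset.mem_erase, mem_boundaries_cons, Nat.sub_sub]
        grind
      · rw [mem_boundaries_cons, ih h.2 hq (by omega) (by omega), Finset.mem_erase,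
          Finset.mem_erase, mem_boundaries_cons (D := (b, k) :: D)]
        grind

theorem length_replaceNode (D : DBWT) (c : ℕ) : (replaceNode D c).length = D.length :=
  List.length_map _

theorem replaceNode_cons (x : ℕ × ℕ) (D : DBWT) (c : ℕ) :
    replaceNode (x :: D) c = (if x = (dollar, 1) then (c, 1) else x) :: replaceNode D c :=
  List.map_cons

theorem snd_ite_eq_dollar (x : ℕ × ℕ) (c : ℕ) :
    (if x = (dollar, 1) then (c, 1) else x).2 = x.2 := by
  split_ifs with hx
  · rw [hx]
  · rfl

theorem Proper.replaceNode (h : Proper D) (c : ℕ) : Proper (replaceNode D c) :=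
  List.forall_mem_map.2 fun x hx => (snd_ite_eq_dollar x c).symm ▸ h x hx

theorem boundaries_replaceNode (D : DBWT) (c : ℕ) :
    boundaries (replaceNode D c) = boundaries D := by
  induction D with
  | nil => rfl
  | cons x D ih => rw [replaceNode_cons, boundaries, boundaries, ih, snd_ite_eq_dollar]

/-- If the special character occurred twice, a longer repetition of it would keep its label. -/
theorem expand_replaceNode (h : Proper D) (hcount : (expand D).count dollar ≤ 1) (c : ℕ) :
    expand (replaceNode D c) = (expand D).map fun x => if x = dollar then c else x := by
  induction D with
  | nil => rfl
  | cons x D ih =>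
    obtain ⟨a, l⟩ := x
    rw [proper_cons] at h
    rw [expand_cons, List.count_append, List.count_replicate] at hcount
    rw [replaceNode_cons, expand_cons, expand_cons, List.map_append, List.map_replicate,
      ih h.2 (by omega)]
    congr 1
    by_cases ha : a = dollar
    · have hl : l = 1 := by
        have hl_pos : 0 < l := h.1
        rw [ha, beq_self_eq_true, if_pos rfl] at hcount
        omega
      rw [ha, hl, if_pos rfl, if_pos rfl]
    · rw [if_neg fun hx => ha (congrArg Prod.fst hx), if_neg ha]

end Operations

/-! ### Runs -/

/-- The number of maximal runs of equal characters. The recursive form is convenient for inductions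
on the string. -/
def runs : List ℕ → ℕ
  | [] => 0
  | [_] => 1
  | a :: b :: l => (if a = b then 0 else 1) + runs (b :: l)

theorem length_splitBy_loop (l : List ℕ) (a : ℕ) (g : List ℕ) (gs : List (List ℕ)) :
    (List.splitBy.loop (· == ·) l a g gs).length = runs (a :: l) + gs.length := by
  induction l generalizing a g gs with
  | nil => simp [List.splitBy.loop, runs, add_comm]
  | cons b l ih =>
    rw [List.splitBy.loop, runs]
    by_cases h : a = b
    · simp [h, ih]
    · simp only [beq_false_of_ne h, ih, if_neg h, List.length_cons]
      omega

theorem length_splitBy_eq_runs (l : List ℕ) : (l.splitBy (· == ·)).length = runs l := by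
  cases l with
  | nil => rfl
  | cons a l => simp [List.splitBy, length_splitBy_loop]

theorem numRuns_eq_runs (T : List ℕ) : numRuns T = runs (bwt T) := length_splitBy_eq_runs _

theorem runs_append_le_insert (A B : List ℕ) (c : ℕ) : runs (A ++ B) ≤ runs (A ++ c :: B) := by
  induction A with
  | nil => cases B <;> simp [runs]
  | cons a A ih =>
    rcases A with - | ⟨a', A⟩
    · rcases B with - | ⟨b, B⟩ <;> simp only [List.cons_append, List.nil_append, runs] <;> grind
    · simp only [List.cons_append, runs] at ih ⊢
      omega

theorem runs_append_add_one_le_insert {A B : List ℕ} {c : ℕ} (hA : A.getLast? ≠ some c)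
    (hB : B.head? ≠ some c) : runs (A ++ B) + 1 ≤ runs (A ++ c :: B) := by
  induction A with
  | nil => rcases B with - | ⟨b, B⟩ <;> grind [runs]
  | cons a A ih =>
    rcases A with - | ⟨a', A⟩
    · rcases B with - | ⟨b, B⟩ <;> grind [runs]
    · have := ih (by rwa [List.getLast?_cons_cons] at hA)
      simp only [List.cons_append, runs] at this ⊢
      omega

theorem runs_pos {L : List ℕ} (h : L ≠ []) : 0 < runs L := by
  induction L with
  | nil => exact absurd rfl h
  | cons a L ih =>
    rcases L with - | ⟨b, L⟩
    · exact Nat.one_pos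
    · exact Nat.add_pos_right _ (ih (List.cons_ne_nil b L))

/-! ### The LF formula -/

section LF

theorem occLt_insert (A B : List ℕ) (c a : ℕ) :
    occLt (A ++ c :: B) a = occLt (A ++ B) a + if c < a then 1 else 0 := by
  simp only [occLt, List.countP_append, List.countP_cons, decide_eq_true_eq]
  omega

theorem rank_insert_of_le (A B : List ℕ) (c a : ℕ) {u : ℕ} (h : u ≤ A.length) :
    rank (A ++ c :: B) a u = rank (A ++ B) a u := by
  rw [rank, rank, List.take_append_of_le_length h, List.take_append_of_le_length h]

theorem rank_insert_succ (A B : List ℕ) (c a : ℕ) {u : ℕ} (h : A.length ≤ u) :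
    rank (A ++ c :: B) a (u + 1) = rank (A ++ B) a u + if c = a then 1 else 0 := by
  obtain ⟨k, rfl⟩ := Nat.exists_eq_add_of_le h
  rw [rank, rank, add_assoc, List.take_length_add_append, List.take_length_add_append]
  simp only [List.take_succ_cons, List.count_append, List.count_cons, beq_iff_eq]
  omega

theorem getD_insert_of_lt (A B : List ℕ) (c : ℕ) {u : ℕ} (h : u < A.length) :
    (A ++ c :: B).getD u 0 = (A ++ B).getD u 0 := by
  rw [List.getD_append _ _ _ _ h, List.getD_append _ _ _ _ h]

theorem getD_insert_self (A B : List ℕ) (c : ℕ) : (A ++ c :: B).getD A.length 0 = c := by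
  rw [List.getD_append_right _ _ _ _ le_rfl, Nat.sub_self, List.getD_cons_zero]

theorem getD_insert_succ (A B : List ℕ) (c : ℕ) {u : ℕ} (h : A.length ≤ u) :
    (A ++ c :: B).getD (u + 1) 0 = (A ++ B).getD u 0 := by
  rw [List.getD_append_right _ _ _ _ (h.trans (Nat.le_succ u)), List.getD_append_right _ _ _ _ h,
    Nat.succ_sub h, List.getD_cons_succ]

theorem getD_mem {X : List ℕ} {s : ℕ} (hs : s < X.length) : X.getD s 0 ∈ X := by
  rw [List.getD_eq_getElem _ _ hs]
  exact List.getElem_mem hs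

variable (L : List ℕ)

theorem rank_succ (a : ℕ) {i : ℕ} (hi : i < L.length) :
    rank L a (i + 1) = rank L a i + if L.getD i 0 = a then 1 else 0 := by
  rw [rank, rank, List.take_add_one, List.count_append, List.getD_eq_getElem _ _ hi,
    List.getElem?_eq_getElem hi, Option.toList_some, List.count_singleton]
  simp only [beq_iff_eq]

theorem rank_mono (a : ℕ) {i j : ℕ} (h : i ≤ j) : rank L a i ≤ rank L a j :=
  (List.take_sublist_take_left h).count_le a

theorem rank_le_count (a i : ℕ) : rank L a i ≤ L.count a :=
  (List.take_sublist _ _).count_le a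

theorem rank_lt_rank {a i j : ℕ} (hi : i < L.length) (ha : L.getD i 0 = a) (h : i < j) :
    rank L a i < rank L a j := by
  refine Nat.lt_of_succ_le (le_trans ?_ (rank_mono L a (Nat.succ_le_of_lt h)))
  rw [Nat.succ_eq_add_one, rank_succ L a hi, if_pos ha]

theorem occLt_add_count_le {a b : ℕ} (h : a < b) : occLt L a + L.count a ≤ occLt L b := by
  induction L with
  | nil => exact le_rfl
  | cons x L ih =>
    simp only [occLt, List.countP_cons, List.count_cons, decide_eq_true_eq, beq_iff_eq] at ih ⊢
    split_ifs <;> omega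

theorem occLt_add_count_le_length (a : ℕ) : occLt L a + L.count a ≤ L.length :=
  (occLt_add_count_le L (Nat.lt_succ_self a)).trans List.countP_le_length

theorem lf_lt_occLt {i b : ℕ} (hi : i < L.length) (h : L.getD i 0 < b) : lf L i < occLt L b :=
  calc lf L i < occLt L (L.getD i 0) + rank L (L.getD i 0) L.length :=
        Nat.add_lt_add_left (rank_lt_rank L hi rfl hi) _
    _ ≤ occLt L (L.getD i 0) + L.count (L.getD i 0) := Nat.add_le_add_left (rank_le_count L _ _) _
    _ ≤ occLt L b := occLt_add_count_le L h

theorem lf_lt_length {i : ℕ} (hi : i < L.length) : lf L i < L.length :=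
  (lf_lt_occLt L hi (Nat.lt_succ_self _)).trans_le List.countP_le_length

theorem lf_le_length (i : ℕ) : lf L i ≤ L.length :=
  (Nat.add_le_add_left (rank_le_count L _ i) _).trans (occLt_add_count_le_length L _)

theorem occLt_add_rank_le_lf {a i : ℕ} (j : ℕ) (h : a < L.getD i 0) :
    occLt L a + rank L a j ≤ lf L i :=
  calc occLt L a + rank L a j ≤ occLt L a + L.count a :=
        Nat.add_le_add_left (rank_le_count L a j) _
    _ ≤ occLt L (L.getD i 0) := occLt_add_count_le L h
    _ ≤ lf L i := Nat.le_add_right _ _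

theorem lf_injOn : Set.InjOn (lf L) {i | i < L.length} := by
  intro i (hi : i < L.length) j (hj : j < L.length) h
  wlog hij : i ≤ j generalizing i j
  · exact (this hj hi h.symm (le_of_not_ge hij)).symm
  refine hij.eq_of_not_lt fun hij => absurd h ?_
  rcases lt_trichotomy (L.getD i 0) (L.getD j 0) with hchar | hchar | hchar
  · exact ((lf_lt_occLt L hi hchar).trans_le (Nat.le_add_right _ _)).ne
  · rw [lf, lf, hchar]
    exact (Nat.add_lt_add_left (rank_lt_rank L hi hchar hij) _).ne
  · exact ((lf_lt_occLt L hj hchar).trans_le (Nat.le_add_right _ _)).ne'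

theorem lf_add {i k : ℕ} (hk : i + k < L.length)
    (h : ∀ j ≤ k, L.getD (i + j) 0 = L.getD i 0) : lf L (i + k) = lf L i + k := by
  induction k with
  | zero => rfl
  | succ k ih =>
    have hlf := ih (by omega) fun j hj => h j (by omega)
    have hrank := rank_succ L (L.getD i 0) (i := i + k) (by omega)
    rw [if_pos (h k (by omega))] at hrank
    rw [lf, h k (by omega)] at hlf
    rw [lf, h (k + 1) le_rfl, ← add_assoc, hrank]
    omega

end LF

section Rows

/-- The row of the BWT matrix to which LF maps position `s` of `X`, when an additional row of the
special character precedes the rows of `X`. The end of the string is mapped to the end of the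
rows. -/
def vRow (X : List ℕ) (s : ℕ) : ℕ := if s < X.length then lf X s + 1 else s + 1

theorem vRow_of_lt {X : List ℕ} {s : ℕ} (h : s < X.length) : vRow X s = lf X s + 1 := if_pos h

theorem vRow_length (X : List ℕ) : vRow X X.length = X.length + 1 := if_neg (lt_irrefl _)

theorem vRow_injOn (X : List ℕ) : Set.InjOn (vRow X) {s | s ≤ X.length} := by
  intro s (hs : s ≤ X.length) t (ht : t ≤ X.length) h
  rcases hs.lt_or_eq with hs | rfl <;> rcases ht.lt_or_eq with ht | rfl
  · exact lf_injOn X hs ht (by rwa [vRow_of_lt hs, vRow_of_lt ht, Nat.add_right_cancel_iff] at h)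
  · have := lf_lt_length X hs
    rw [vRow_of_lt hs, vRow_length] at h
    omega
  · have := lf_lt_length X ht
    rw [vRow_of_lt ht, vRow_length] at h
    omega
  · rfl

variable {A B : List ℕ}

theorem lf_insert_dollar_self (h : ∀ a ∈ A ++ B, dollar < a) :
    lf (A ++ dollar :: B) A.length = 0 := by
  have hocc : occLt (A ++ B) dollar = 0 :=
    List.countP_eq_zero.2 fun a ha => by simpa using (h a ha).le
  have hrank : rank (A ++ B) dollar A.length = 0 :=
    Nat.eq_zero_of_le_zero ((rank_le_count _ _ _).trans_eq
      (List.count_eq_zero.2 fun hmem => lt_irrefl _ (h _ hmem)))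
  rw [lf, getD_insert_self, occLt_insert, rank_insert_of_le _ _ _ _ le_rfl, hocc, hrank,
    if_neg (lt_irrefl _)]

theorem lf_insert_dollar_of_lt (h : ∀ a ∈ A ++ B, dollar < a) {u : ℕ} (hu : u < A.length) :
    lf (A ++ dollar :: B) u = vRow (A ++ B) u := by
  have hlt : u < (A ++ B).length := by
    rw [List.length_append]
    omega
  rw [vRow_of_lt hlt, lf, lf, getD_insert_of_lt _ _ _ hu, occLt_insert,
    if_pos (h _ (getD_mem hlt)), rank_insert_of_le _ _ _ _ hu.le]
  omega

theorem lf_insert_dollar_succ (h : ∀ a ∈ A ++ B, dollar < a) {u : ℕ} (hu : A.length ≤ u)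
    (hlt : u < (A ++ B).length) : lf (A ++ dollar :: B) (u + 1) = vRow (A ++ B) u := by
  have hchar := h _ (getD_mem hlt)
  rw [vRow_of_lt hlt, lf, lf, getD_insert_succ _ _ _ hu, occLt_insert, if_pos hchar,
    rank_insert_succ _ _ _ _ hu, if_neg hchar.ne]
  omega

end Rows

/-! ### The potential of a set of boundaries -/

section Skip

/-- The increasing enumeration of the natural numbers other than `p`: where a position goes when a
character is inserted at position `p`. -/
def skip (p s : ℕ) : ℕ := if s < p then s else s + 1

theorem skip_of_lt {p s : ℕ} (h : s < p) : skip p s = s := if_pos h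

theorem skip_of_le {p s : ℕ} (h : p ≤ s) : skip p s = s + 1 := if_neg (Nat.not_lt.2 h)

theorem skip_strictMono (p : ℕ) : StrictMono (skip p) := by
  intro s t hst
  grind [skip]

/-- The places of the boundary `s` after the insertion of a character at position `p`: if `s = p`,
these are the two ends of the new character. -/
def shiftInterval (p s : ℕ) : NonemptyInterval ℕ :=
  ⟨(skip (p + 1) s, skip p s), by grind [skip]⟩

theorem fst_shiftInterval (p s : ℕ) : (shiftInterval p s).fst = skip (p + 1) s := rfl

theorem snd_shiftInterval (p s : ℕ) : (shiftInterval p s).snd = skip p s := rfl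

theorem skip_mem_shiftInterval {p q : ℕ} (hq : q = p ∨ q = p + 1) (s : ℕ) :
    skip q s ∈ shiftInterval p s := by
  rcases hq with rfl | rfl
  · exact ⟨(shiftInterval q s).fst_le_snd, le_rfl⟩
  · exact ⟨le_rfl, (shiftInterval p s).fst_le_snd⟩

theorem precedes_shiftInterval {p s t : ℕ} :
    Precedes (shiftInterval p s) (shiftInterval p t) ↔ s < t := by
  rw [Precedes, snd_shiftInterval, fst_shiftInterval]
  grind [skip]

theorem lt_of_mem_shiftInterval {p s t x y : ℕ} (hx : x ∈ shiftInterval p s)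
    (hy : y ∈ shiftInterval p t) (h : s < t) : x < y :=
  hx.2.trans_lt ((precedes_shiftInterval.2 h).trans_le hy.1)

end Skip

section VRowInsert

variable {A B : List ℕ} {c s : ℕ}

theorem lf_insert_skip (hs : s < (A ++ B).length) :
    lf (A ++ c :: B) (skip A.length s) =
      skip (occLt (A ++ B) c + rank (A ++ B) c A.length) (lf (A ++ B) s) := by
  have hlf : lf (A ++ c :: B) (skip A.length s) = lf (A ++ B) s +
      if c < (A ++ B).getD s 0 ∨ c = (A ++ B).getD s 0 ∧ A.length ≤ s then 1 else 0 := by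
    rcases lt_or_ge s A.length with hsA | hsA
    · rw [skip_of_lt hsA, lf, lf, getD_insert_of_lt _ _ _ hsA, occLt_insert,
        rank_insert_of_le _ _ _ _ hsA.le]
      grind
    · rw [skip_of_le hsA, lf, lf, getD_insert_succ _ _ _ hsA, occLt_insert,
        rank_insert_succ _ _ _ _ hsA]
      grind
  rw [hlf, skip]
  rcases lt_trichotomy ((A ++ B).getD s 0) c with hchar | hchar | hchar
  · have := lf_lt_occLt (A ++ B) hs hchar
    grind
  · rw [lf, hchar]
    rcases lt_or_ge s A.length with hsA | hsA
    · have := rank_lt_rank (A ++ B) hs hchar hsA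
      grind
    · have := rank_mono (A ++ B) c hsA
      grind
  · have := occLt_add_rank_le_lf (A ++ B) A.length hchar
    grind

theorem vRow_insert_skip (hs : s ≤ (A ++ B).length) :
    vRow (A ++ c :: B) (skip A.length s) =
      skip (occLt (A ++ B) c + rank (A ++ B) c A.length + 1) (vRow (A ++ B) s) := by
  have hlen : (A ++ c :: B).length = (A ++ B).length + 1 := by
    simp only [List.length_append, List.length_cons, add_assoc]
  rcases hs.lt_or_eq with hs | rfl
  · have hskip : skip A.length s < (A ++ c :: B).length := by grind [skip]
    rw [vRow_of_lt hs, vRow_of_lt hskip, lf_insert_skip hs]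
    grind [skip]
  · have hA : A.length ≤ (A ++ B).length := List.length_append ▸ Nat.le_add_right _ _
    have hk : occLt (A ++ B) c + rank (A ++ B) c A.length ≤ (A ++ B).length :=
      (Nat.add_le_add_left (rank_le_count _ _ _) _).trans (occLt_add_count_le_length _ _)
    rw [skip_of_le hA, ← hlen, vRow_length, vRow_length, skip_of_le (by omega), hlen]

theorem vRow_insert_length :
    vRow (A ++ c :: B) A.length = occLt (A ++ B) c + rank (A ++ B) c A.length + 1 := by
  have hA : A.length < (A ++ c :: B).length := by
    rw [List.length_append, List.length_cons]
    omega
  rw [vRow_of_lt hA, lf, getD_insert_self, occLt_insert, if_neg (lt_irrefl c),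
    rank_insert_of_le _ _ _ _ le_rfl, add_zero]

theorem vRow_length_of_head (hB : B.head? = some c) :
    vRow (A ++ B) A.length = occLt (A ++ B) c + rank (A ++ B) c A.length + 1 := by
  obtain ⟨B, rfl⟩ : ∃ B', B = c :: B' := List.head?_eq_some_iff.1 hB
  have hA : A.length < (A ++ c :: B).length := by
    rw [List.length_append, List.length_cons]
    omega
  rw [vRow_of_lt hA, lf, getD_insert_self]

theorem vRow_insert_mem_shiftInterval {q : ℕ} (hs : s ≤ (A ++ B).length)
    (hq : q = A.length ∨ q = A.length + 1 ∧ B.head? = some c) :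
    vRow (A ++ c :: B) (skip q s) ∈
      shiftInterval (occLt (A ++ B) c + rank (A ++ B) c A.length + 1) (vRow (A ++ B) s) := by
  by_cases hsq : skip q s = skip A.length s
  · rw [hsq, vRow_insert_skip hs]
    exact skip_mem_shiftInterval (Or.inl rfl) _
  · have hsA : s = A.length ∧ skip q s = A.length := by grind [skip]
    have hB : B.head? = some c := by grind
    rw [hsA.2, vRow_insert_length, hsA.1, vRow_length_of_head hB,
      ← skip_of_lt (Nat.lt_succ_self (occLt (A ++ B) c + rank (A ++ B) c A.length + 1))]
    grind [skip_mem_shiftInterval, skip]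

end VRowInsert

section TotalPotential

/-- The starts of F-intervals as intervals of length one, for comparison with the `shiftInterval`s.
-/
def rowInterval (X : List ℕ) (s : ℕ) : NonemptyInterval ℕ := NonemptyInterval.pure (vRow X s)

/-- The potential of the set `S` of boundaries of the string `X`, into which the special character
is to be inserted at position `p`: both the starts of repetitions are counted between consecutive
starts of F-intervals and vice versa, up to four in each gap. -/
def totalPotential (X : List ℕ) (p : ℕ) (S : Finset ℕ) : ℕ :=
  potential 4 (shiftInterval p) (rowInterval X) S S +
    potential 4 (rowInterval X) (shiftInterval p) S S

theorem separated_shiftInterval (p : ℕ) (I : Finset ℕ) : Separated (shiftInterval p) I :=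
  fun _ _ _ _ hne => hne.lt_or_gt.imp precedes_shiftInterval.2 precedes_shiftInterval.2

variable {X : List ℕ} {p e : ℕ} {S I J : Finset ℕ}

theorem separated_rowInterval (hI : ∀ s ∈ I, s ≤ X.length) : Separated (rowInterval X) I :=
  fun s hs s' hs' hne => lt_or_gt_of_ne fun h => hne (vRow_injOn X (hI s hs) (hI s' hs') h)

theorem totalPotential_le (hS : ∀ s ∈ S, s ≤ X.length) : totalPotential X p S ≤ 2 * S.card := by
  have hu := potential_le_card (m := 4) (v := rowInterval X) (J := S) (separated_shiftInterval p S)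
  have hv := potential_le_card (m := 4) (v := shiftInterval p) (J := S) (separated_rowInterval hS)
  rw [totalPotential]
  omega

theorem totalPotential_le_insert (hS : ∀ s ∈ S, s ≤ X.length) (he : e ≤ X.length) :
    totalPotential X p S ≤ totalPotential X p (insert e S) + 8 := by
  have hS' : ∀ s ∈ insert e S, s ≤ X.length := Finset.forall_mem_insert _ _ _ |>.2 ⟨he, hS⟩
  have hu := potential_le_insert_add (m := 4) (v := rowInterval X) (J := S)
    (separated_shiftInterval p (insert e S))
  have hv := potential_le_insert_add (m := 4) (v := shiftInterval p) (J := S)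
    (separated_rowInterval hS')
  have hu' := potential_mono_right (m := 4) (u := shiftInterval p) (v := rowInterval X)
    (I := insert e S) (Finset.subset_insert e S)
  have hv' := potential_mono_right (m := 4) (u := rowInterval X) (v := shiftInterval p)
    (I := insert e S) (Finset.subset_insert e S)
  rw [totalPotential, totalPotential]
  omega

theorem potential_shiftInterval_le_insert_add_one (he : e ∉ I) (hep : e ≠ p)
    (hJ : ∀ t ∈ J, t ≤ X.length) :
    potential 4 (shiftInterval p) (rowInterval X) I J ≤
      potential 4 (shiftInterval p) (rowInterval X) (insert e I) J + 1 := by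
  refine potential_le_insert_add_one he (separated_shiftInterval p _) ?_
  have hpoint : (shiftInterval p e).fst = (shiftInterval p e).snd := by
    rw [fst_shiftInterval, snd_shiftInterval]
    grind [skip]
  have hmeet : ∀ t, ¬ Precedes (rowInterval X t) (shiftInterval p e) →
      ¬ Precedes (shiftInterval p e) (rowInterval X t) → vRow X t = (shiftInterval p e).snd :=
    fun t ht ht' => le_antisymm (not_lt.1 ht') (hpoint ▸ not_lt.1 ht)
  exact fun t ht t' ht' h₁ h₂ h₁' h₂' =>
    vRow_injOn X (hJ t ht) (hJ t' ht') ((hmeet t h₁ h₂).trans (hmeet t' h₁' h₂').symm)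

theorem potential_rowInterval_le_insert_add_one (he : e ∉ I)
    (hI : ∀ s ∈ insert e I, s ≤ X.length) :
    potential 4 (rowInterval X) (shiftInterval p) I J ≤
      potential 4 (rowInterval X) (shiftInterval p) (insert e I) J + 1 := by
  refine potential_le_insert_add_one he (separated_rowInterval hI) ?_
  intro t ht t' ht' h₁ h₂ h₁' h₂'
  by_contra hne
  rcases separated_shiftInterval p J ht ht' hne with h | h
  · exact h₁ (h.trans_le (not_lt.1 h₂'))
  · exact h₁' (h.trans_le (not_lt.1 h₂))

/-- Here `e` splits a repetition in which the starts `A` and `B` of F-intervals lie. -/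
theorem totalPotential_add_le_insert_of_shiftInterval (hS : ∀ s ∈ insert e S, s ≤ X.length)
    (he : e ∉ S) {A B : Finset ℕ} (hA : A ⊆ S) (hB : B ⊆ S) (hA4 : 4 ≤ A.card) (hB4 : 4 ≤ B.card)
    (hAe : ∀ t ∈ A, Precedes (rowInterval X t) (shiftInterval p e) ∧
      ∀ s ∈ S, s < e → Precedes (shiftInterval p s) (rowInterval X t))
    (heB : ∀ t ∈ B, Precedes (shiftInterval p e) (rowInterval X t) ∧
      ∀ s ∈ S, e < s → Precedes (rowInterval X t) (shiftInterval p s)) :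
    totalPotential X p S + 3 ≤ totalPotential X p (insert e S) := by
  have hgain := potential_add_le_insert he (separated_shiftInterval p (insert e S)) hA hB hA4 hB4
    (fun t ht => ⟨(hAe t ht).1, fun s hs h => (hAe t ht).2 s hs (precedes_shiftInterval.1 h)⟩)
    (fun t ht => ⟨(heB t ht).1, fun s hs h => (heB t ht).2 s hs (precedes_shiftInterval.1 h)⟩)
  have hmono := potential_mono_right (m := 4) (u := shiftInterval p) (v := rowInterval X)
    (I := insert e S) (Finset.subset_insert e S)
  have hmono' := potential_mono_right (m := 4) (u := rowInterval X) (v := shiftInterval p)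
    (I := S) (Finset.subset_insert e S)
  have hloss := potential_rowInterval_le_insert_add_one (p := p) (J := insert e S) he hS
  rw [totalPotential, totalPotential]
  omega

/-- Here `e` splits an F-interval in which the starts `A` and `B` of repetitions lie. -/
theorem totalPotential_add_le_insert_of_rowInterval (hS : ∀ s ∈ insert e S, s ≤ X.length)
    (he : e ∉ S) (hep : e ≠ p) {A B : Finset ℕ} (hA : A ⊆ S) (hB : B ⊆ S) (hA4 : 4 ≤ A.card)
    (hB4 : 4 ≤ B.card)
    (hAe : ∀ t ∈ A, Precedes (shiftInterval p t) (rowInterval X e) ∧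
      ∀ s ∈ S, vRow X s < vRow X e → Precedes (rowInterval X s) (shiftInterval p t))
    (heB : ∀ t ∈ B, Precedes (rowInterval X e) (shiftInterval p t) ∧
      ∀ s ∈ S, vRow X e < vRow X s → Precedes (shiftInterval p t) (rowInterval X s)) :
    totalPotential X p S + 3 ≤ totalPotential X p (insert e S) := by
  have hgain := potential_add_le_insert he (separated_rowInterval hS) hA hB hA4 hB4 hAe heB
  have hmono := potential_mono_right (m := 4) (u := rowInterval X) (v := shiftInterval p)
    (I := insert e S) (Finset.subset_insert e S)
  have hmono' := potential_mono_right (m := 4) (u := shiftInterval p) (v := rowInterval X)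
    (I := S) (Finset.subset_insert e S)
  have hloss := potential_shiftInterval_le_insert_add_one (J := insert e S) he hep hS
  rw [totalPotential, totalPotential]
  omega

/-- The insertion of a character moves the boundaries of the repetitions as well as those of the
F-intervals within their `shiftInterval`s, and hence preserves their relative order. -/
theorem totalPotential_le_image_skip {A B : List ℕ} {c q : ℕ} (hS : ∀ s ∈ S, s ≤ (A ++ B).length)
    (hq : q = A.length ∨ q = A.length + 1 ∧ B.head? = some c) :
    totalPotential (A ++ B) A.length S ≤
      totalPotential (A ++ c :: B) (occLt (A ++ B) c + rank (A ++ B) c A.length + 1)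
        (S.image (skip q)) := by
  have hinj : Set.InjOn (skip q) S := (skip_strictMono q).injective.injOn
  have hskip : ∀ s, skip q s ∈ shiftInterval A.length s :=
    skip_mem_shiftInterval (hq.imp_right And.left)
  have hrow := fun s hs => vRow_insert_mem_shiftInterval (c := c) (hS s hs) hq
  have huv : ∀ s ∈ S, ∀ t ∈ S, Precedes (shiftInterval A.length s) (rowInterval (A ++ B) t) →
      Precedes (shiftInterval _ (skip q s)) (rowInterval (A ++ c :: B) (skip q t)) :=
    fun s _ t ht h => (precedes_shiftInterval.2 ((hskip s).2.trans_lt h)).trans_le (hrow t ht).1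
  have hvu : ∀ s ∈ S, ∀ t ∈ S, Precedes (rowInterval (A ++ B) t) (shiftInterval A.length s) →
      Precedes (rowInterval (A ++ c :: B) (skip q t)) (shiftInterval _ (skip q s)) :=
    fun s _ t ht h => (hrow t ht).2.trans_lt (precedes_shiftInterval.2 (h.trans_le (hskip s).1))
  refine Nat.add_le_add (potential_le_image hinj hinj ?_ huv hvu)
    (potential_le_image hinj hinj ?_ (fun s hs t ht => hvu t ht s hs)
      fun s hs t ht => huv t ht s hs)
  · exact fun s _ s' _ h => precedes_shiftInterval.2
      ((skip_strictMono q).lt_iff_lt.1 (precedes_shiftInterval.1 h))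
  · intro s hs s' hs' h
    refine lt_of_not_ge fun hle => ?_
    rcases hle.lt_or_eq with hlt | heq
    · exact (lt_of_mem_shiftInterval (hrow s' hs') (hrow s hs) hlt).asymm h
    · rw [vRow_injOn _ (hS s' hs') (hS s hs) heq] at h
      exact h.asymm h

end TotalPotential

/-! ### Extension of the BWT by a character -/

section ListLemmas

variable {α : Type*} {l : List α}

theorem take_countP_eq_filter {P : α → Bool} (h : l.Pairwise fun a b => P b = true → P a = true) :
    l.take (l.countP P) = l.filter P := by
  induction l with
  | nil => rfl
  | cons a l ih =>
    rw [List.pairwise_cons] at h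
    by_cases ha : P a = true
    · rw [List.countP_cons_of_pos ha, List.take_succ_cons, ih h.2, List.filter_cons_of_pos ha]
    · have hl : ∀ b ∈ l, ¬ P b = true := fun b hb hP => ha (h.1 b hb hP)
      rw [List.countP_cons_of_neg ha, List.countP_eq_zero.2 hl, List.take_zero,
        List.filter_cons_of_neg ha, List.filter_eq_nil_iff.2 hl]

theorem drop_countP_eq_filter {P : α → Bool} (h : l.Pairwise fun a b => P b = true → P a = true) :
    l.drop (l.countP P) = l.filter fun a => !P a := by
  induction l with
  | nil => rfl
  | cons a l ih =>
    rw [List.pairwise_cons] at h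
    by_cases ha : P a = true
    · rw [List.countP_cons_of_pos ha, List.drop_succ_cons, ih h.2,
        List.filter_cons_of_neg (by rw [ha]; exact Bool.false_ne_true)]
    · have hl : ∀ b ∈ l, ¬ P b = true := fun b hb hP => ha (h.1 b hb hP)
      rw [List.countP_cons_of_neg ha, List.countP_eq_zero.2 hl, List.drop_zero, eq_comm,
        List.filter_eq_self]
      exact List.forall_mem_cons.2 ⟨by simpa using ha, fun b hb => by simpa using hl b hb⟩

theorem countP_or {P Q : α → Prop} [DecidablePred P] [DecidablePred Q]
    (h : ∀ a ∈ l, P a → ¬ Q a) :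
    l.countP (fun a => decide (P a ∨ Q a)) =
      l.countP (fun a => decide (P a)) + l.countP fun a => decide (Q a) := by
  induction l with
  | nil => rfl
  | cons a l ih =>
    rw [List.forall_mem_cons] at h
    simp only [List.countP_cons, ih h.2, decide_eq_true_eq]
    grind

end ListLemmas

section PrevChar

/-- The character of the BWT that belongs to the suffix starting at position `i`. -/
def prevChar (S : List ℕ) (i : ℕ) : ℕ :=
  if i = 0 then S.getD (S.length - 1) 0 else S.getD (i - 1) 0

theorem bwt_eq_map (S : List ℕ) : bwt S = (suffixArray S).map (prevChar S) := rfl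

theorem prevChar_succ (S : List ℕ) (i : ℕ) : prevChar S (i + 1) = S.getD i 0 := rfl

variable {S : List ℕ} {i : ℕ}

theorem IsText.prevChar_zero (hS : IsText S) : prevChar S 0 = dollar := by
  obtain ⟨S, rfl, -⟩ := hS
  simp [prevChar]

theorem IsText.dollar_lt_prevChar (hS : IsText S) (hi : i + 1 < S.length) :
    dollar < prevChar S (i + 1) := by
  obtain ⟨S, rfl, h⟩ := hS
  rw [List.length_append, List.length_singleton, Nat.add_lt_add_iff_right] at hi
  rw [prevChar_succ, List.getD_append _ _ _ _ hi]
  exact h _ (getD_mem hi)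

theorem IsText.prevChar_eq_dollar_iff (hS : IsText S) (hi : i < S.length) :
    prevChar S i = dollar ↔ i = 0 := by
  rcases i with - | i
  · exact iff_of_true hS.prevChar_zero rfl
  · exact iff_of_false (hS.dollar_lt_prevChar hi).ne' (Nat.succ_ne_zero i)

theorem drop_eq_prevChar_cons (hi : i < S.length) :
    S.drop i = prevChar S (i + 1) :: S.drop (i + 1) := by
  rw [prevChar_succ, List.getD_eq_getElem _ _ hi, List.drop_eq_getElem_cons hi]

theorem IsText.drop_length_pred (hS : IsText S) {m : ℕ} (hm : S.length = m + 1) :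
    S.drop m = [dollar] := by
  obtain ⟨S, rfl, -⟩ := hS
  rw [List.length_append, List.length_singleton, Nat.add_right_cancel_iff] at hm
  rw [← hm, List.drop_left]

theorem IsText.exists_length_eq_succ (hS : IsText S) : ∃ m, S.length = m + 1 := by
  obtain ⟨S, rfl, -⟩ := hS
  exact ⟨S.length, List.length_append⟩

end PrevChar

section SuffixArray

variable (S : List ℕ)

theorem suffixArray_perm : (suffixArray S).Perm (List.range S.length) :=
  List.mergeSort_perm _ _

variable {S} in
theorem mem_suffixArray {i : ℕ} : i ∈ suffixArray S ↔ i < S.length := by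
  rw [(suffixArray_perm S).mem_iff, List.mem_range]

theorem length_suffixArray : (suffixArray S).length = S.length := by
  rw [(suffixArray_perm S).length_eq, List.length_range]

theorem length_bwt : (bwt S).length = S.length := by
  rw [bwt_eq_map, List.length_map, length_suffixArray]

theorem suffixArray_pairwise_le : (suffixArray S).Pairwise fun i j => S.drop i ≤ S.drop j := by
  have h := List.pairwise_mergeSort (le := fun i j => decide (S.drop i ≤ S.drop j))
    (by simp only [decide_eq_true_eq]; exact fun a b c => le_trans)
    (by simp only [Bool.or_eq_true, decide_eq_true_eq]; exact fun a b => le_total _ _)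
    (List.range S.length)
  simpa only [suffixArray, decide_eq_true_eq] using h

theorem drop_injOn : Set.InjOn S.drop {i | i < S.length} := by
  intro i (hi : i < S.length) j (hj : j < S.length) h
  have hlen := congrArg List.length h
  simp only [List.length_drop] at hlen
  omega

theorem suffixArray_pairwise_lt : (suffixArray S).Pairwise fun i j => S.drop i < S.drop j := by
  have hnodup : (suffixArray S).Nodup := (suffixArray_perm S).nodup_iff.2 List.nodup_range
  refine ((suffixArray_pairwise_le S).and hnodup).imp_of_mem fun hi hj h => ?_
  exact lt_of_le_of_ne h.1 fun heq =>
    h.2 (drop_injOn S (mem_suffixArray.1 hi) (mem_suffixArray.1 hj) heq)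

/-- The number of suffixes of `S` that are smaller than `Z`, i.e. the row of `Z` among them. -/
def numSmaller (Z : List ℕ) : ℕ := (List.range S.length).countP fun i => decide (S.drop i < Z)

theorem numSmaller_eq_suffixArray (Z : List ℕ) :
    numSmaller S Z = (suffixArray S).countP fun i => decide (S.drop i < Z) :=
  ((suffixArray_perm S).countP_eq _).symm

theorem suffixArray_pairwise_smaller (Z : List ℕ) : (suffixArray S).Pairwise fun i j =>
    decide (S.drop j < Z) = true → decide (S.drop i < Z) = true := by
  simp only [decide_eq_true_eq]
  exact (suffixArray_pairwise_lt S).imp fun hij hj => hij.trans hj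

variable {S}

theorem numSmaller_getElem {i : ℕ} (hi : i < (suffixArray S).length) :
    numSmaller S (S.drop (suffixArray S)[i]) = i := by
  have hsplit : suffixArray S =
      (suffixArray S).take i ++ (suffixArray S)[i] :: (suffixArray S).drop (i + 1) := by
    rw [← List.drop_eq_getElem_cons hi, List.take_append_drop]
  have hlt := suffixArray_pairwise_lt S
  rw [hsplit, List.pairwise_append, List.pairwise_cons] at hlt
  obtain ⟨-, ⟨hafter, -⟩, hbefore⟩ := hlt
  generalize (suffixArray S)[i] = z at *
  rw [numSmaller_eq_suffixArray, hsplit, List.countP_append, List.countP_eq_length.2,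
    List.countP_eq_zero.2, List.length_take_of_le hi.le, add_zero]
  · refine List.forall_mem_cons.2 ⟨by simp, fun y hy => ?_⟩
    simpa using (hafter y hy).le
  · exact fun y hy => decide_eq_true (hbefore y hy z List.mem_cons_self)

theorem numSmaller_drop_injOn :
    Set.InjOn (fun i => numSmaller S (S.drop i)) {i | i < S.length} := by
  intro i hi j hj (h : numSmaller S (S.drop i) = numSmaller S (S.drop j))
  obtain ⟨k, hk, rfl⟩ := List.getElem_of_mem (mem_suffixArray.2 hi)
  obtain ⟨k', hk', rfl⟩ := List.getElem_of_mem (mem_suffixArray.2 hj)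
  rw [numSmaller_getElem hk, numSmaller_getElem hk'] at h
  simp only [h]

end SuffixArray

section LFMapping

variable {S : List ℕ} {c : ℕ}

/-- Prepending a character rotates the text cyclically: the suffix from `i` on is compared through
its first character, which precedes the suffix from `i + 1` on. -/
theorem IsText.numSmaller_cons_eq_countP (hS : IsText S) (hc : dollar < c) (Z : List ℕ) :
    numSmaller S (c :: Z) = (List.range S.length).countP fun i =>
      decide (prevChar S i < c ∨ prevChar S i = c ∧ S.drop i < Z) := by
  obtain ⟨m, hm⟩ := hS.exists_length_eq_succ
  have hlast : S.drop m < c :: Z := by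
    rw [hS.drop_length_pred hm, List.cons_lt_cons_iff]
    exact Or.inl hc
  have hfirst : prevChar S 0 < c := hS.prevChar_zero.trans_lt hc
  have hstep : ∀ i ∈ List.range m, decide (S.drop i < c :: Z) = true ↔
      ((fun i => decide (prevChar S i < c ∨ prevChar S i = c ∧ S.drop i < Z)) ∘ Nat.succ) i =
        true := by
    intro i hi
    have hi : i < S.length := by
      rw [hm]
      exact (List.mem_range.1 hi).trans (Nat.lt_succ_self m)
    rw [decide_eq_true_eq, drop_eq_prevChar_cons hi, List.cons_lt_cons_iff, Function.comp_apply,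
      decide_eq_true_eq]
  rw [numSmaller, hm]
  conv_lhs => rw [List.range_succ, List.countP_append, List.countP_singleton,
    if_pos (decide_eq_true hlast), List.countP_congr hstep]
  conv_rhs => rw [List.range_succ_eq_map, List.countP_cons,
    if_pos (decide_eq_true (Or.inl hfirst)), List.countP_map]

theorem occLt_bwt (S : List ℕ) (c : ℕ) :
    occLt (bwt S) c = (List.range S.length).countP fun i => decide (prevChar S i < c) := by
  rw [occLt, bwt_eq_map, List.countP_map, (suffixArray_perm S).countP_eq]
  rfl

theorem rank_bwt_numSmaller (S Z : List ℕ) (c : ℕ) : rank (bwt S) c (numSmaller S Z) =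
    (List.range S.length).countP fun i => decide (prevChar S i = c ∧ S.drop i < Z) := by
  rw [rank, bwt_eq_map, ← List.map_take, numSmaller_eq_suffixArray,
    take_countP_eq_filter (suffixArray_pairwise_smaller S Z), List.count, List.countP_map,
    List.countP_filter, (suffixArray_perm S).countP_eq]
  simp only [Bool.decide_and]
  rfl

theorem IsText.numSmaller_cons (hS : IsText S) (hc : dollar < c) (Z : List ℕ) :
    numSmaller S (c :: Z) = occLt (bwt S) c + rank (bwt S) c (numSmaller S Z) := by
  rw [hS.numSmaller_cons_eq_countP hc, occLt_bwt, rank_bwt_numSmaller]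
  exact countP_or fun i _ hlt heq => hlt.ne heq.1

theorem IsText.exists_lf_bwt (hS : IsText S) {i : ℕ} (hi : i < (bwt S).length)
    (hc : dollar < (bwt S).getD i 0) :
    ∃ j, j + 1 < S.length ∧ i = numSmaller S (S.drop (j + 1)) ∧
      lf (bwt S) i = numSmaller S (S.drop j) := by
  have hi' : i < (suffixArray S).length := by rwa [length_bwt, ← length_suffixArray] at hi
  have hz : (suffixArray S)[i] < S.length := mem_suffixArray.1 (List.getElem_mem hi')
  have hchar : (bwt S).getD i 0 = prevChar S (suffixArray S)[i] := by
    rw [List.getD_eq_getElem _ _ hi]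
    exact List.getElem_map _
  have hrow := numSmaller_getElem hi'
  obtain ⟨j, hj⟩ : ∃ j, (suffixArray S)[i] = j + 1 :=
    Nat.exists_eq_succ_of_ne_zero fun hzero =>
      hc.ne' (hchar.trans ((hS.prevChar_eq_dollar_iff hz).2 hzero))
  rw [hj] at hz hchar hrow
  refine ⟨j, hz, hrow.symm, ?_⟩
  rw [drop_eq_prevChar_cons (Nat.lt_of_succ_lt hz), hS.numSmaller_cons (hchar ▸ hc), hrow, lf,
    hchar]

theorem IsText.lf_bwt_ne (hS : IsText S) {i : ℕ} (hi : i < (bwt S).length)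
    (hc : dollar < (bwt S).getD i 0) : lf (bwt S) i ≠ i := by
  obtain ⟨j, hj, hrow, hlf⟩ := hS.exists_lf_bwt hi hc
  rw [hlf]
  exact fun h => (Nat.lt_succ_self j).ne
    (numSmaller_drop_injOn (Nat.lt_of_succ_lt hj) hj (h.trans hrow))

end LFMapping

section Cons

variable {S A B : List ℕ} {c : ℕ}

theorem suffixArray_cons (S : List ℕ) (c : ℕ) :
    suffixArray (c :: S) =
      ((suffixArray S).take (numSmaller S (c :: S))).map Nat.succ ++
        0 :: ((suffixArray S).drop (numSmaller S (c :: S))).map Nat.succ := by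
  have hperm : (suffixArray (c :: S)).Perm
      (((suffixArray S).take (numSmaller S (c :: S))).map Nat.succ ++
        0 :: ((suffixArray S).drop (numSmaller S (c :: S))).map Nat.succ) := by
    refine (suffixArray_perm _).trans (List.Perm.trans ?_ List.perm_middle.symm)
    rw [← List.map_append, List.take_append_drop, List.length_cons, List.range_succ_eq_map]
    exact ((suffixArray_perm S).map _).symm.cons _
  refine hperm.eq_of_pairwise (le := fun i j => (c :: S).drop i ≤ (c :: S).drop j)
    (fun i j hi hj hij hji => ?_) (suffixArray_pairwise_le _) ?_
  · exact drop_injOn _ (mem_suffixArray.1 hi) (mem_suffixArray.1 (hperm.mem_iff.2 hj))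
      (le_antisymm hij hji)
  have hsorted := suffixArray_pairwise_le S
  have hpred := suffixArray_pairwise_smaller S (c :: S)
  rw [← List.take_append_drop (numSmaller S (c :: S)) (suffixArray S), List.pairwise_append]
    at hsorted
  obtain ⟨htake, hdrop, htd⟩ := hsorted
  have htake_lt : ∀ i ∈ (suffixArray S).take (numSmaller S (c :: S)), S.drop i ≤ c :: S := by
    rw [numSmaller_eq_suffixArray, take_countP_eq_filter hpred]
    exact fun i hi => (of_decide_eq_true (List.mem_filter.1 hi).2).le
  have hdrop_ge : ∀ i ∈ (suffixArray S).drop (numSmaller S (c :: S)), c :: S ≤ S.drop i := by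
    rw [numSmaller_eq_suffixArray, drop_countP_eq_filter hpred]
    exact fun i hi => by simpa using (List.mem_filter.1 hi).2
  simp only [List.pairwise_append, List.pairwise_cons, List.pairwise_map, List.forall_mem_cons,
    List.forall_mem_map]
  exact ⟨htake, ⟨hdrop_ge, hdrop⟩, fun i hi => ⟨htake_lt i hi, htd i hi⟩⟩

theorem IsText.prevChar_cons_succ (hS : IsText S) {i : ℕ} (hi : i < S.length) :
    prevChar (c :: S) (i + 1) = if prevChar S i = dollar then c else prevChar S i := by
  rcases i with - | i
  · rw [prevChar_succ, List.getD_cons_zero, if_pos hS.prevChar_zero]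
  · rw [prevChar_succ, List.getD_cons_succ, if_neg (hS.dollar_lt_prevChar hi).ne', prevChar_succ]

theorem IsText.prevChar_cons_zero (hS : IsText S) : prevChar (c :: S) 0 = dollar := by
  obtain ⟨S, rfl, -⟩ := hS
  simp [prevChar]

theorem map_ite_eq_dollar (hAB : ∀ a ∈ A ++ B, dollar < a) (c : ℕ) :
    ((A ++ dollar :: B).map fun x => if x = dollar then c else x) = A ++ c :: B := by
  have hid : ∀ l : List ℕ, (∀ a ∈ l, dollar < a) →
      (l.map fun x => if x = dollar then c else x) = l :=
    fun l hl => (List.map_congr_left fun a ha => if_neg (hl a ha).ne').trans (List.map_id' l)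
  rw [List.forall_mem_append] at hAB
  rw [List.map_append, List.map_cons, hid A hAB.1, hid B hAB.2, if_pos rfl]

theorem IsText.numSmaller_self (hS : IsText S) (hL : bwt S = A ++ dollar :: B) :
    numSmaller S S = A.length := by
  have hlen : A.length < (suffixArray S).length := by
    rw [length_suffixArray, ← length_bwt S, hL, List.length_append, List.length_cons]
    omega
  have hchar : prevChar S (suffixArray S)[A.length] = dollar := by
    have hget : (bwt S)[A.length]? = some dollar := by
      rw [hL, List.getElem?_append_right le_rfl, Nat.sub_self, List.getElem?_cons_zero]
    rwa [bwt_eq_map, List.getElem?_map, List.getElem?_eq_getElem hlen, Option.map_some,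
      Option.some.injEq] at hget
  have hzero : (suffixArray S)[A.length] = 0 :=
    (hS.prevChar_eq_dollar_iff (mem_suffixArray.1 (List.getElem_mem hlen))).1 hchar
  have hrow := numSmaller_getElem hlen
  rwa [hzero, List.drop_zero] at hrow

theorem IsText.bwt_cons (hS : IsText S) (hc : dollar < c) (hL : bwt S = A ++ dollar :: B)
    (hAB : ∀ a ∈ A ++ B, dollar < a) :
    bwt (c :: S) =
      (A ++ c :: B).take (occLt (bwt S) c + rank (bwt S) c A.length) ++
        dollar :: (A ++ c :: B).drop (occLt (bwt S) c + rank (bwt S) c A.length) := by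
  have hmap : (suffixArray S).map (prevChar (c :: S) ∘ Nat.succ) = A ++ c :: B := by
    rw [← map_ite_eq_dollar hAB c, ← hL, bwt_eq_map S, List.map_map]
    exact List.map_congr_left fun i hi => hS.prevChar_cons_succ (mem_suffixArray.1 hi)
  rw [bwt_eq_map, suffixArray_cons, List.map_append, List.map_cons, List.map_map, List.map_map,
    List.map_take, List.map_drop, hmap, hS.numSmaller_cons hc, hS.numSmaller_self hL,
    hS.prevChar_cons_zero]

theorem bwt_dollar : bwt [dollar] = [dollar] := by
  simp [bwt, suffixArray]

end Cons

/-! ### The invariant -/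

section Unshift

/-- The position in a string without its character at position `p` that corresponds to the position
`q` in the string. -/
def unshift (p q : ℕ) : ℕ := if q < p then q else q - 1

theorem unshift_skip (p s : ℕ) : unshift p (skip p s) = s := by
  grind [skip, unshift]

theorem skip_unshift {p q : ℕ} (hq : q ≠ p) : skip p (unshift p q) = q := by
  grind [skip, unshift]

theorem shiftInterval_of_ne {p s : ℕ} (hs : s ≠ p) :
    shiftInterval p s = NonemptyInterval.pure (skip p s) := by
  ext
  · change skip (p + 1) s = skip p s
    grind [skip]
  · rfl

theorem shiftInterval_unshift {p q : ℕ} (hp : q ≠ p) (hp' : q ≠ p + 1) :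
    shiftInterval p (unshift p q) = NonemptyInterval.pure q := by
  rw [shiftInterval_of_ne (by grind [unshift]), skip_unshift hp]

end Unshift

/-- The string of `D` is `A ++ dollar :: B`, and `S` is the set of boundaries in `A ++ B` that
remain when the special character is removed and a repetition split by its insertion is restored;
`b` tells whether there was such a repetition. -/
structure Reduces (D : DBWT) (b : Bool) (A B : List ℕ) (S : Finset ℕ) : Prop where
  proper : Proper D
  expand_eq : expand D = A ++ dollar :: B
  dollar_lt : ∀ a ∈ A ++ B, dollar < a
  le_length : ∀ s ∈ S, s ≤ (A ++ B).length
  flag_iff : b = true ↔ A.length ∉ S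
  run_of_notMem : ∀ s ≤ (A ++ B).length, s ∉ S → 0 < s ∧ (A ++ B)[s - 1]? = (A ++ B)[s]?
  mem_boundaries_iff : ∀ q,
    q ∈ boundaries D ↔ q = A.length ∨ q = A.length + 1 ∨ unshift A.length q ∈ S

/-- The amortized bound on the number of boundaries: up to a constant, three units are available for
every boundary, from the potential and from the runs of the BWT without the special character. -/
def IsPaid (A B : List ℕ) (S : Finset ℕ) : Prop :=
  3 * S.card ≤ totalPotential (A ++ B) A.length S + 22 * runs (A ++ B) + 3

theorem IsPaid.card_le {A B : List ℕ} {S : Finset ℕ} (h : IsPaid A B S)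
    (hS : ∀ s ∈ S, s ≤ (A ++ B).length) : S.card ≤ 22 * runs (A ++ B) + 3 := by
  have hpot := totalPotential_le (p := A.length) hS
  rw [IsPaid] at h
  omega

namespace Reduces

variable {D : DBWT} {b : Bool} {A B : List ℕ} {S : Finset ℕ} {q s : ℕ}

theorem length_expand (h : Reduces D b A B S) : (expand D).length = (A ++ B).length + 1 := by
  rw [h.expand_eq, List.length_append, List.length_append, List.length_cons, add_assoc]

theorem skip_mem_boundaries (h : Reduces D b A B S) (hs : s ∈ S) :
    skip A.length s ∈ boundaries D :=
  (h.mem_boundaries_iff _).2 (Or.inr (Or.inr ((unshift_skip _ s).symm ▸ hs)))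

theorem skip_succ_mem_boundaries (h : Reduces D b A B S) (hs : s ∈ S) :
    skip (A.length + 1) s ∈ boundaries D := by
  by_cases hsA : s = A.length
  · rw [hsA, skip_of_lt (Nat.lt_succ_self _)]
    exact (h.mem_boundaries_iff _).2 (Or.inl rfl)
  · have hskip : skip (A.length + 1) s = skip A.length s := by grind [skip]
    exact hskip ▸ h.skip_mem_boundaries hs

theorem length_le_card_add_one (h : Reduces D b A B S) : D.length ≤ S.card + 1 := by
  have hsub : boundaries D ⊆ insert A.length (insert (A.length + 1) (S.image (skip A.length))) := by
    intro q hq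
    rw [Finset.mem_insert, Finset.mem_insert, Finset.mem_image]
    by_cases hqA : q = A.length
    · exact Or.inl hqA
    · exact Or.inr (((h.mem_boundaries_iff q).1 hq).resolve_left hqA |>.imp_right fun hqS =>
        ⟨_, hqS, skip_unshift hqA⟩)
  have hcard := Finset.card_le_card hsub
  have hinsert := Finset.card_insert_le A.length
    (insert (A.length + 1) (S.image (skip A.length)))
  have hinsert' := Finset.card_insert_le (A.length + 1) (S.image (skip A.length))
  have himage := Finset.card_image_le (s := S) (f := skip A.length)
  rw [h.proper.card_boundaries] at hcard
  omega

theorem length_le (h : Reduces D b A B S) (hpaid : IsPaid A B S) :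
    D.length ≤ 22 * runs (A ++ B) + 4 :=
  h.length_le_card_add_one.trans (Nat.add_le_add_right (hpaid.card_le h.le_length) 1)

theorem ne_of_notMem (h : Reduces D b A B S) (hq : q ∉ boundaries D) :
    q ≠ A.length ∧ q ≠ A.length + 1 ∧ unshift A.length q ∉ S := by
  rwa [h.mem_boundaries_iff, not_or, not_or] at hq

theorem unshift_le_length (h : Reduces D b A B S) (hq : q < (expand D).length) :
    unshift A.length q ≤ (A ++ B).length := by
  rw [h.length_expand] at hq
  grind [unshift]

theorem cutAt (h : Reduces D b A B S) (hq : q < (expand D).length) (hqD : q ∉ boundaries D) :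
    Reduces (RComp.cutAt D q) b A B (insert (unshift A.length q) S) where
  proper := h.proper.cutAt q
  expand_eq := by rw [expand_cutAt, h.expand_eq]
  dollar_lt := h.dollar_lt
  le_length := Finset.forall_mem_insert _ _ _ |>.2 ⟨h.unshift_le_length hq, h.le_length⟩
  flag_iff := by
    have hne : A.length ≠ unshift A.length q := by grind [unshift, h.ne_of_notMem hqD]
    rw [h.flag_iff, Finset.mem_insert, not_or, and_iff_right hne]
  run_of_notMem := fun s hs hsS => h.run_of_notMem s hs fun hm => hsS (Finset.mem_insert_of_mem hm)
  mem_boundaries_iff := by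
    intro r
    have hinj : unshift A.length r = unshift A.length q → r ≠ A.length → r = q := by
      intro heq hr
      rw [← skip_unshift hr, heq, skip_unshift (h.ne_of_notMem hqD).1]
    rw [boundaries_cutAt hq.le, Finset.mem_insert, Finset.mem_insert, h.mem_boundaries_iff]
    grind

end Reduces

/-! ### Balancing -/

section Halves

theorem exists_halves {Q : List ℕ} {a b : ℕ} (hQ : Q.Pairwise (· < ·)) (h16 : 16 ≤ Q.length)
    (hab : ∀ x ∈ Q, a ≤ x ∧ x < b) :
    ∃ l r : Finset ℕ, 7 ≤ l.card ∧ 7 ≤ r.card ∧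
      (∀ x ∈ l, x ∈ Q ∧ a < x ∧ x < Q.getD ((Q.length + 1) / 2) 0) ∧
      ∀ x ∈ r, x ∈ Q ∧ Q.getD ((Q.length + 1) / 2) 0 < x ∧ x < b := by
  have hnodup : Q.Nodup := hQ.imp fun h => h.ne
  have hmid : (Q.length + 1) / 2 < Q.length := by omega
  have hget : ∀ i j, (hi : i < Q.length) → (hj : j < Q.length) → i < j → Q[i] < Q[j] :=
    fun i j hi hj hij => List.pairwise_iff_getElem.1 hQ i j hi hj hij
  rw [List.getD_eq_getElem _ _ hmid]
  refine ⟨((Q.take ((Q.length + 1) / 2)).drop 1).toFinset,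
    (Q.drop ((Q.length + 1) / 2 + 1)).toFinset, ?_, ?_, ?_, ?_⟩
  · rw [List.toFinset_card_of_nodup
      (hnodup.sublist ((List.drop_sublist _ _).trans (List.take_sublist _ _))),
      List.length_drop, List.length_take]
    omega
  · rw [List.toFinset_card_of_nodup (hnodup.sublist (List.drop_sublist _ _)), List.length_drop]
    omega
  · intro x hx
    obtain ⟨i, hi, rfl⟩ := List.getElem_of_mem (List.mem_toFinset.1 hx)
    rw [List.length_drop, List.length_take] at hi
    rw [List.getElem_drop, List.getElem_take]
    exact ⟨List.getElem_mem _,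
      (hab Q[0] (List.getElem_mem _)).1.trans_lt (hget _ _ _ _ (by omega)),
      hget _ _ _ _ (by omega)⟩
  · intro x hx
    obtain ⟨i, hi, rfl⟩ := List.getElem_of_mem (List.mem_toFinset.1 hx)
    rw [List.getElem_drop]
    exact ⟨List.getElem_mem _, hget _ _ _ _ (by omega), (hab _ (List.getElem_mem _)).2⟩

theorem pairwise_lt_mergeSort {l : List ℕ} (h : l.Nodup) : l.mergeSort.Pairwise (· < ·) := by
  have hle : l.mergeSort.Pairwise (· ≤ ·) := List.pairwise_mergeSort' _ l
  exact (hle.and ((List.mergeSort_perm l _).nodup_iff.2 h)).imp fun h => lt_of_le_of_ne h.1 h.2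

theorem card_le_card_filter_add_two {l S : Finset ℕ} {f : ℕ → ℕ} (x y : ℕ)
    (h : ∀ z ∈ l, z ≠ x → z ≠ y → ∃ t ∈ S, f t = z) :
    l.card ≤ (S.filter fun t => f t ∈ l).card + 2 := by
  have hsub : l ⊆ insert x (insert y ((S.filter fun t => f t ∈ l).image f)) := by
    intro z hz
    rw [Finset.mem_insert, Finset.mem_insert, Finset.mem_image, or_iff_not_imp_left,
      or_iff_not_imp_left]
    intro hx hy
    obtain ⟨t, ht, rfl⟩ := h z hz hx hy
    exact ⟨t, Finset.mem_filter.2 ⟨ht, hz⟩, rfl⟩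
  have hcard := Finset.card_le_card hsub
  have hx := Finset.card_insert_le x (insert y ((S.filter fun t => f t ∈ l).image f))
  have hy := Finset.card_insert_le y ((S.filter fun t => f t ∈ l).image f)
  have himage := Finset.card_image_le (s := S.filter fun t => f t ∈ l) (f := f)
  omega

end Halves

section Covered

variable {D : DBWT} {i j : ℕ}

theorem Proper.vStart_inj (h : Proper D) (hi : i < D.length) (hj : j < D.length)
    (heq : vStart D i = vStart D j) : i = j :=
  h.uStart_inj hi hj (lf_injOn _ (h.uStart_lt_length hi) (h.uStart_lt_length hj) heq)

theorem Proper.pairwise_coveredByU (h : Proper D) (i : ℕ) :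
    (coveredByU D i).Pairwise (· < ·) :=
  pairwise_lt_mergeSort <| List.Nodup.filter _ <| List.nodup_range.map_on fun _ ha _ hb hab =>
    h.vStart_inj (List.mem_range.1 ha) (List.mem_range.1 hb) hab

theorem Proper.pairwise_coveredByV (h : Proper D) (i : ℕ) :
    (coveredByV D i).Pairwise (· < ·) :=
  pairwise_lt_mergeSort <| List.Nodup.filter _ <| List.nodup_range.map_on fun _ ha _ hb hab =>
    h.uStart_inj (List.mem_range.1 ha) (List.mem_range.1 hb) hab

theorem mem_coveredByU {x : ℕ} : x ∈ coveredByU D i ↔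
    (∃ j < D.length, vStart D j = x) ∧ uStart D i ≤ x ∧ x < uStart D i + len D i := by
  simp [coveredByU]

theorem mem_coveredByV {x : ℕ} : x ∈ coveredByV D i ↔
    (∃ j < D.length, uStart D j = x) ∧ vStart D i ≤ x ∧ x < vStart D i + len D i := by
  simp [coveredByV]

theorem lf_uStart_add (hi : i < D.length) {k : ℕ} (hk : k < len D i) :
    lf (expand D) (uStart D i + k) = vStart D i + k := by
  have hlen := uStart_add_len_le_length hi
  refine lf_add _ (by omega) fun j hj => ?_
  rw [List.getD_eq_getElem?_getD, List.getD_eq_getElem?_getD,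
    getElem?_expand hi (by omega) (by omega), getElem?_expand hi le_rfl (by omega)]

theorem notMem_boundaries_of_lt_lt {q : ℕ} (hi : i < D.length) (hiq : uStart D i < q)
    (hqi : q < uStart D i + len D i) : q ∉ boundaries D :=
  fun hq => (le_uStart_or_le_of_mem_boundaries hi hq).elim hiq.not_ge hqi.not_ge

end Covered

namespace Reduces

variable {D : DBWT} {b : Bool} {A B : List ℕ} {S : Finset ℕ} {α i q s : ℕ}

theorem vRow_unshift (h : Reduces D b A B S) (hq : q < (expand D).length) (hqA : q ≠ A.length) :
    vRow (A ++ B) (unshift A.length q) = lf (expand D) q := by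
  rw [h.length_expand] at hq
  rw [h.expand_eq, unshift]
  rcases hqA.lt_or_gt with hlt | hgt
  · rw [if_pos hlt, lf_insert_dollar_of_lt h.dollar_lt hlt]
  · obtain ⟨u, rfl⟩ := Nat.exists_eq_succ_of_ne_zero (Nat.ne_zero_of_lt hgt)
    rw [if_neg hgt.not_gt, Nat.succ_eq_add_one, Nat.add_sub_cancel,
      lf_insert_dollar_succ h.dollar_lt (Nat.le_of_lt_succ hgt) (Nat.lt_of_succ_lt_succ hq)]

theorem vRow_eq_lf_skip (h : Reduces D b A B S) (hs : s < (A ++ B).length) :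
    vRow (A ++ B) s = lf (expand D) (skip A.length s) := by
  have hlt : skip A.length s < (expand D).length := by grind [skip, h.length_expand]
  rw [← h.vRow_unshift hlt (by grind [skip]), unshift_skip]

theorem exists_vRow_eq_vStart (h : Reduces D b A B S) (hi : i < D.length) (h0 : vStart D i ≠ 0)
    (h1 : vStart D i ≠ lf (expand D) (A.length + 1)) : ∃ t ∈ S, vRow (A ++ B) t = vStart D i := by
  have hA : uStart D i ≠ A.length := fun heq => h0 <| by
    rw [vStart, heq, h.expand_eq, lf_insert_dollar_self h.dollar_lt]
  have hA' : uStart D i ≠ A.length + 1 := fun heq => h1 <| by rw [vStart, heq]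
  refine ⟨unshift A.length (uStart D i), ?_, ?_⟩
  · exact ((h.mem_boundaries_iff _).1 (uStart_mem_boundaries D i)).resolve_left hA
      |>.resolve_left hA'
  · rw [h.vRow_unshift (h.proper.uStart_lt_length hi) hA, vStart]

theorem exists_skip_eq_uStart (h : Reduces D b A B S) (hA : uStart D i ≠ A.length)
    (hA' : uStart D i ≠ A.length + 1) : ∃ t ∈ S.erase A.length, skip A.length t = uStart D i := by
  refine ⟨unshift A.length (uStart D i), Finset.mem_erase.2 ⟨by grind [unshift], ?_⟩,
    skip_unshift hA⟩
  exact ((h.mem_boundaries_iff _).1 (uStart_mem_boundaries D i)).resolve_left hA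
    |>.resolve_left hA'

theorem vRow_le_vStart_or_le (h : Reduces D b A B S) (hi : i < D.length) (hs : s ∈ S) :
    vRow (A ++ B) s ≤ vStart D i ∨ vStart D i + len D i ≤ vRow (A ++ B) s := by
  have hilen := uStart_add_len_le_length hi
  have hipos := h.proper.len_pos hi
  rcases (h.le_length s hs).lt_or_eq with hlt | rfl
  · by_contra! hinside
    rw [h.vRow_eq_lf_skip hlt] at hinside
    obtain ⟨k, hk⟩ := Nat.exists_eq_add_of_lt hinside.1
    have hskip : uStart D i + (k + 1) = skip A.length s :=
      lf_injOn (expand D) (show uStart D i + (k + 1) < (expand D).length by omega)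
        (show skip A.length s < (expand D).length by grind [skip, h.length_expand])
        (by rw [lf_uStart_add hi (by omega), hk, add_assoc])
    exact notMem_boundaries_of_lt_lt hi (by omega) (by omega) (h.skip_mem_boundaries hs)
  · have hlast := lf_uStart_add hi (k := len D i - 1) (by omega)
    have hlt := lf_lt_length (expand D) (i := uStart D i + (len D i - 1)) (by omega)
    rw [h.length_expand] at hlt
    rw [vRow_length]
    omega

/-- The two boundaries at the special character are not in `S`, which costs two of the seven
covered positions on each side of the median. -/
theorem exists_cutU_halves (h : Reduces D b A B S) (h16 : 16 ≤ (coveredByU D i).length) :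
    ∃ P Q : Finset ℕ, P ⊆ S ∧ Q ⊆ S ∧ 4 ≤ P.card ∧ 4 ≤ Q.card ∧
      (∀ t ∈ P, uStart D i < vRow (A ++ B) t ∧ vRow (A ++ B) t < RComp.cutU D i) ∧
      ∀ t ∈ Q, RComp.cutU D i < vRow (A ++ B) t ∧
        vRow (A ++ B) t < uStart D i + len D i := by
  obtain ⟨l, r, hl7, hr7, hl, hr⟩ := exists_halves (h.proper.pairwise_coveredByU i) h16
    fun x hx => (mem_coveredByU.1 hx).2
  have hcov : ∀ z ∈ coveredByU D i, z ≠ 0 → z ≠ lf (expand D) (A.length + 1) →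
      ∃ t ∈ S, vRow (A ++ B) t = z := by
    intro z hz h0 h1
    obtain ⟨⟨j, hj, rfl⟩, -⟩ := mem_coveredByU.1 hz
    exact h.exists_vRow_eq_vStart hj h0 h1
  have hlcard := card_le_card_filter_add_two _ _ fun z hz => hcov z (hl z hz).1
  have hrcard := card_le_card_filter_add_two _ _ fun z hz => hcov z (hr z hz).1
  exact ⟨_, _, Finset.filter_subset _ _, Finset.filter_subset _ _, by omega, by omega,
    fun t ht => (hl _ (Finset.mem_filter.1 ht).2).2,
    fun t ht => (hr _ (Finset.mem_filter.1 ht).2).2⟩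

theorem exists_cutV_halves (h : Reduces D b A B S) (h16 : 16 ≤ (coveredByV D i).length) :
    ∃ k, 0 < k ∧ k < len D i ∧ RComp.cutV D i = uStart D i + k ∧
      ∃ P Q : Finset ℕ, P ⊆ S.erase A.length ∧ Q ⊆ S.erase A.length ∧ 4 ≤ P.card ∧ 4 ≤ Q.card ∧
        (∀ t ∈ P, vStart D i < skip A.length t ∧ skip A.length t < vStart D i + k) ∧
        ∀ t ∈ Q, vStart D i + k < skip A.length t ∧ skip A.length t < vStart D i + len D i := by
  obtain ⟨l, r, hl7, hr7, hl, hr⟩ := exists_halves (h.proper.pairwise_coveredByV i) h16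
    fun x hx => (mem_coveredByV.1 hx).2
  have hcov : ∀ z ∈ coveredByV D i, z ≠ A.length → z ≠ A.length + 1 →
      ∃ t ∈ S.erase A.length, skip A.length t = z := by
    intro z hz h0 h1
    obtain ⟨⟨j, -, rfl⟩, -⟩ := mem_coveredByV.1 hz
    exact h.exists_skip_eq_uStart h0 h1
  have hlcard := card_le_card_filter_add_two _ _ fun z hz => hcov z (hl z hz).1
  have hrcard := card_le_card_filter_add_two _ _ fun z hz => hcov z (hr z hz).1
  obtain ⟨x, hx⟩ : l.Nonempty := Finset.card_pos.1 (by omega)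
  obtain ⟨y, hy⟩ : r.Nonempty := Finset.card_pos.1 (by omega)
  have hxm := hl x hx
  have hym := hr y hy
  rw [RComp.cutV]
  generalize (coveredByV D i).getD (((coveredByV D i).length + 1) / 2) 0 = m at *
  obtain ⟨k, rfl⟩ : ∃ k, m = vStart D i + k := Nat.exists_eq_add_of_le (by omega)
  exact ⟨k, by omega, by omega, by rw [Nat.add_sub_cancel_left],
    (S.erase A.length).filter fun t => skip A.length t ∈ l,
    (S.erase A.length).filter fun t => skip A.length t ∈ r,
    Finset.filter_subset _ _, Finset.filter_subset _ _, by omega, by omega,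
    fun t ht => (hl _ (Finset.mem_filter.1 ht).2).2,
    fun t ht => (hr _ (Finset.mem_filter.1 ht).2).2⟩

theorem totalPotential_cutU (h : Reduces D b A B S) (hi : i < D.length)
    (h16 : 16 ≤ (coveredByU D i).length) :
    RComp.cutU D i < (expand D).length ∧ RComp.cutU D i ∉ boundaries D ∧
      totalPotential (A ++ B) A.length S + 3 ≤
        totalPotential (A ++ B) A.length (insert (unshift A.length (RComp.cutU D i)) S) := by
  obtain ⟨P, Q, hP, hQ, hP4, hQ4, hPcut, hQcut⟩ := h.exists_cutU_halves h16
  obtain ⟨s, hs⟩ : P.Nonempty := Finset.card_pos.1 (by omega)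
  obtain ⟨t, ht⟩ : Q.Nonempty := Finset.card_pos.1 (by omega)
  generalize RComp.cutU D i = q at *
  have hiq : uStart D i < q := (hPcut s hs).1.trans (hPcut s hs).2
  have hqi : q < uStart D i + len D i := (hQcut t ht).1.trans (hQcut t ht).2
  have hq : q < (expand D).length := hqi.trans_le (uStart_add_len_le_length hi)
  have hqD := notMem_boundaries_of_lt_lt hi hiq hqi
  obtain ⟨hqA, hqA', hqS⟩ := h.ne_of_notMem hqD
  refine ⟨hq, hqD, totalPotential_add_le_insert_of_shiftInterval
    (Finset.forall_mem_insert _ _ _ |>.2 ⟨h.unshift_le_length hq, h.le_length⟩) hqS hP hQ hP4 hQ4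
    ?_ ?_⟩ <;> rw [shiftInterval_unshift hqA hqA']
  · refine fun t ht => ⟨(hPcut t ht).2, fun s hs hsq => ?_⟩
    have hsq : skip A.length s < q := (skip_strictMono A.length hsq).trans_eq (skip_unshift hqA)
    have hsi := (le_uStart_or_le_of_mem_boundaries hi (h.skip_mem_boundaries hs)).resolve_right
      (hsq.trans hqi).not_ge
    exact hsi.trans_lt (hPcut t ht).1
  · refine fun t ht => ⟨(hQcut t ht).1, fun s hs hsq => ?_⟩
    have hsq : q < skip (A.length + 1) s := by grind [skip, unshift]
    have his := (le_uStart_or_le_of_mem_boundaries hi (h.skip_succ_mem_boundaries hs)).resolve_left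
      (hiq.trans hsq).not_ge
    exact (hQcut t ht).2.trans_le his

theorem totalPotential_cutV (h : Reduces D b A B S) (hi : i < D.length)
    (h16 : 16 ≤ (coveredByV D i).length) :
    RComp.cutV D i < (expand D).length ∧ RComp.cutV D i ∉ boundaries D ∧
      totalPotential (A ++ B) A.length S + 3 ≤
        totalPotential (A ++ B) A.length (insert (unshift A.length (RComp.cutV D i)) S) := by
  obtain ⟨k, hk, hki, hcut, P, Q, hP, hQ, hP4, hQ4, hPcut, hQcut⟩ := h.exists_cutV_halves h16
  rw [hcut]
  have hq : uStart D i + k < (expand D).length :=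
    (Nat.add_lt_add_left hki _).trans_le (uStart_add_len_le_length hi)
  have hqD := notMem_boundaries_of_lt_lt hi (Nat.lt_add_of_pos_right hk) (Nat.add_lt_add_left hki _)
  obtain ⟨hqA, hqA', hqS⟩ := h.ne_of_notMem hqD
  have hrow : vRow (A ++ B) (unshift A.length (uStart D i + k)) = vStart D i + k := by
    rw [h.vRow_unshift hq hqA, lf_uStart_add hi hki]
  refine ⟨hq, hqD, totalPotential_add_le_insert_of_rowInterval
    (Finset.forall_mem_insert _ _ _ |>.2 ⟨h.unshift_le_length hq, h.le_length⟩) hqS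
    (by grind [unshift]) (hP.trans (Finset.erase_subset _ _))
    (hQ.trans (Finset.erase_subset _ _)) hP4 hQ4 ?_ ?_⟩ <;> rw [rowInterval, hrow]
  · intro t ht
    rw [shiftInterval_of_ne (Finset.mem_erase.1 (hP ht)).1]
    refine ⟨(hPcut t ht).2, fun s hs hsq => ?_⟩
    have hsi := (h.vRow_le_vStart_or_le hi hs).resolve_right
      (hsq.trans (Nat.add_lt_add_left hki _)).not_ge
    exact hsi.trans_lt (hPcut t ht).1
  · intro t ht
    rw [shiftInterval_of_ne (Finset.mem_erase.1 (hQ ht)).1]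
    refine ⟨(hQcut t ht).1, fun s hs hsq => ?_⟩
    have his := (h.vRow_le_vStart_or_le hi hs).resolve_left
      ((Nat.lt_add_of_pos_right hk).trans hsq).not_ge
    exact (hQcut t ht).2.trans_le his

end Reduces

theorem IsPaid.insert {A B : List ℕ} {S : Finset ℕ} {e : ℕ} (h : IsPaid A B S)
    (hpot : totalPotential (A ++ B) A.length S + 3 ≤
      totalPotential (A ++ B) A.length (insert e S)) : IsPaid A B (insert e S) := by
  have hcard := Finset.card_insert_le e S
  rw [IsPaid] at *
  omega

theorem Reduces.balance {α : ℕ} {D D' : DBWT} {b : Bool} {A B : List ℕ} {S : Finset ℕ}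
    (hα : 16 ≤ α) (hD : Relation.ReflTransGen (BalanceStep α) D D') (h : Reduces D b A B S)
    (hpaid : IsPaid A B S) : ∃ S', Reduces D' b A B S' ∧ IsPaid A B S' := by
  induction hD with
  | refl => exact ⟨S, h, hpaid⟩
  | tail _ hstep ih =>
    obtain ⟨S', h', hpaid'⟩ := ih
    cases hstep with
    | caseU i hi =>
      obtain ⟨hq, hqD, hpot⟩ := h'.totalPotential_cutU hi.1 (hα.trans hi.2)
      exact ⟨_, h'.cutAt hq hqD, hpaid'.insert hpot⟩
    | caseV i _ hi =>
      obtain ⟨hq, hqD, hpot⟩ := h'.totalPotential_cutV hi.1 (hα.trans hi.2)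
      exact ⟨_, h'.cutAt hq hqD, hpaid'.insert hpot⟩

/-! ### Merging and the update -/

theorem insPos_le (D : DBWT) (c : ℕ) : insPos D c ≤ (expand D).length :=
  (Nat.add_le_add_left (rank_le_count _ _ _) _).trans (occLt_add_count_le_length _ _)

section Merge

variable {D : DBWT} {A B : List ℕ} {b : Bool} {c q r : ℕ}

theorem charBefore_append_length (A B : List ℕ) :
    charBefore (A ++ B) A.length = A.getLast? := by
  rcases A.eq_nil_or_concat with rfl | ⟨A, a, rfl⟩
  · rfl
  · simp [charBefore]

theorem getElem?_insert_length_succ (A B : List ℕ) (c : ℕ) :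
    (A ++ c :: B)[A.length + 1]? = B.head? := by
  simp [List.getElem?_append_right, List.head?_eq_getElem?]

theorem getElem?_insert_pred (hA : A.getLast? = some c) :
    0 < A.length ∧ (A ++ c :: B)[A.length - 1]? = (A ++ c :: B)[A.length]? := by
  rcases A.eq_nil_or_concat with rfl | ⟨A, a, rfl⟩
  · cases hA
  · simp_all

theorem expand_joinAt_left (h : Proper D) (hD : expand D = A ++ c :: B)
    (hq : A.length ∈ boundaries D) (hA : A.getLast? = some c) :
    expand (joinAt D A.length) = A ++ c :: B := by
  obtain ⟨hpos, heq⟩ := getElem?_insert_pred (B := B) hA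
  rw [expand_joinAt h hq hpos (hD ▸ heq), hD]

theorem boundaries_joinAt_left (h : Proper D) (hD : expand D = A ++ c :: B)
    (hq : A.length ∈ boundaries D) (hA : A.getLast? = some c) :
    boundaries (joinAt D A.length) = (boundaries D).erase A.length := by
  refine boundaries_joinAt h hq (getElem?_insert_pred (B := B) hA).1 ?_
  rw [hD, List.length_append, List.length_cons]
  omega

theorem expand_joinAt_right (h : Proper D) (hD : expand D = A ++ c :: B)
    (hq : A.length + 1 ∈ boundaries D) (hB : B.head? = some c) :
    expand (joinAt D (A.length + 1)) = A ++ c :: B := by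
  rw [expand_joinAt h hq (Nat.succ_pos _), hD]
  rw [hD, getElem?_insert_length_succ, hB, Nat.add_sub_cancel]
  simp

theorem boundaries_joinAt_right (h : Proper D) (hD : expand D = A ++ c :: B)
    (hq : A.length + 1 ∈ boundaries D) (hB : B.head? = some c) :
    boundaries (joinAt D (A.length + 1)) = (boundaries D).erase (A.length + 1) := by
  refine boundaries_joinAt h hq (Nat.succ_pos _) ?_
  rw [← getElem?_insert_length_succ A B c, ← hD] at hB
  exact (List.getElem?_eq_some_iff.1 hB).1

theorem mergeNodes_eq (hE : expand (insertNode D c) = A ++ c :: B) (hq : newPos D c = A.length) :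
    mergeNodes D c b =
      if (A.getLast? = some c ∧ B.head? = some c) ∧ b = true then
        joinAt (joinAt (insertNode D c) (A.length + 1)) A.length
      else if A.getLast? = some c then joinAt (insertNode D c) A.length
      else if B.head? = some c then joinAt (insertNode D c) (A.length + 1)
      else insertNode D c := by
  simp only [mergeNodes, hE, hq, charBefore_append_length, getElem?_insert_length_succ,
    Bool.and_eq_true, beq_iff_eq]

theorem Proper.mergeNodes (h : Proper (insertNode D c)) (b : Bool) :
    Proper (mergeNodes D c b) := by
  unfold RComp.mergeNodes
  dsimp only
  split_ifs
  · exact (h.joinAt _).joinAt _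
  · exact h.joinAt _
  · exact h.joinAt _
  · exact h

theorem expand_mergeNodes (h : Proper (insertNode D c))
    (hE : expand (insertNode D c) = A ++ c :: B) (hq : newPos D c = A.length)
    (hleft : A.length ∈ boundaries (insertNode D c))
    (hright : A.length + 1 ∈ boundaries (insertNode D c)) :
    expand (mergeNodes D c b) = expand (insertNode D c) := by
  rw [mergeNodes_eq hE hq, hE]
  split_ifs with hboth hA hB
  · refine expand_joinAt_left (h.joinAt _) (expand_joinAt_right h hE hright hboth.1.2) ?_ hboth.1.1
    rw [boundaries_joinAt_right h hE hright hboth.1.2]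
    exact Finset.mem_erase.2 ⟨(Nat.lt_succ_self _).ne, hleft⟩
  · exact expand_joinAt_left h hE hleft hA
  · exact expand_joinAt_right h hE hright hB
  · exact hE

theorem mem_boundaries_mergeNodes (h : Proper (insertNode D c))
    (hE : expand (insertNode D c) = A ++ c :: B) (hq : newPos D c = A.length)
    (hleft : A.length ∈ boundaries (insertNode D c))
    (hright : A.length + 1 ∈ boundaries (insertNode D c)) :
    r ∈ boundaries (mergeNodes D c b) ↔ r ∈ boundaries (insertNode D c) ∧
      ¬ (r = A.length ∧ A.getLast? = some c) ∧
      ¬ (r = A.length + 1 ∧ B.head? = some c ∧ (A.getLast? ≠ some c ∨ b = true)) := by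
  rw [mergeNodes_eq hE hq]
  split_ifs with hboth hA hB
  · have hD := expand_joinAt_right h hE hright hboth.1.2
    have hbound := boundaries_joinAt_right h hE hright hboth.1.2
    have hleft' : A.length ∈ boundaries (joinAt (insertNode D c) (A.length + 1)) :=
      hbound ▸ Finset.mem_erase.2 ⟨(Nat.lt_succ_self _).ne, hleft⟩
    rw [boundaries_joinAt_left (h.joinAt _) hD hleft' hboth.1.1, hbound]
    grind
  · rw [boundaries_joinAt_left h hE hleft hA]
    grind
  · rw [boundaries_joinAt_right h hE hright hB]
    grind
  · grind

end Merge

namespace Reduces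

variable {D : DBWT} {b : Bool} {A B T : List ℕ} {S : Finset ℕ} {c q r : ℕ}

theorem repPos_eq (h : Reduces D b A B S) : repPos D = A.length := by
  have hA : dollar ∉ A := fun hm => lt_irrefl _ (h.dollar_lt _ (List.mem_append_left _ hm))
  rw [repPos, h.expand_eq, List.idxOf_append_of_notMem hA, List.idxOf_cons_self, add_zero]

theorem insPos_eq (h : Reduces D b A B S) (hc : dollar < c) :
    insPos D c = occLt (A ++ B) c + rank (A ++ B) c A.length + 1 := by
  rw [insPos, h.repPos_eq, h.expand_eq, occLt_insert, rank_insert_of_le _ _ _ _ le_rfl, if_pos hc,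
    add_right_comm]

theorem expand_replaceNode (h : Reduces D b A B S) (c : ℕ) :
    expand (replaceNode D c) = A ++ c :: B := by
  have hAB : (A ++ B).count dollar = 0 :=
    List.count_eq_zero.2 fun hm => lt_irrefl _ (h.dollar_lt _ hm)
  have hcount : (expand D).count dollar ≤ 1 := by
    rw [h.expand_eq, List.count_append, List.count_cons_self, ← add_assoc, ← List.count_append, hAB]
  rw [RComp.expand_replaceNode h.proper hcount, h.expand_eq, map_ite_eq_dollar h.dollar_lt]

theorem expand_splitNode (h : Reduces D b A B S) (c : ℕ) :
    expand (splitNode D c) = A ++ c :: B := by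
  rw [splitNode, expand_cutAt, h.expand_replaceNode]

theorem boundaries_splitNode (h : Reduces D b A B S) (c : ℕ) :
    boundaries (splitNode D c) = insert (insPos D c) (boundaries D) := by
  have hle : insPos D c ≤ (expand (replaceNode D c)).length := by
    rw [h.expand_replaceNode]
    simpa only [h.expand_eq, List.length_append, List.length_cons] using insPos_le D c
  rw [splitNode, boundaries_cutAt hle, boundaries_replaceNode]

theorem proper_splitNode (h : Reduces D b A B S) (c : ℕ) : Proper (splitNode D c) :=
  (h.proper.replaceNode c).cutAt _

theorem proper_insertNode (h : Reduces D b A B S) (c : ℕ) : Proper (insertNode D c) :=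
  (h.proper_splitNode c).insertAt Nat.one_pos _

theorem expand_insertNode (h : Reduces D b A B S) (c : ℕ) : expand (insertNode D c) =
    (A ++ c :: B).take (insPos D c) ++ dollar :: (A ++ c :: B).drop (insPos D c) := by
  have hmem : insPos D c ∈ boundaries (splitNode D c) :=
    h.boundaries_splitNode c ▸ Finset.mem_insert_self _ _
  rw [insertNode, expand_insertAt hmem, h.expand_splitNode]
  rfl

theorem mem_boundaries_insertNode (h : Reduces D b A B S) (c : ℕ) :
    r ∈ boundaries (insertNode D c) ↔
      (r ≤ insPos D c ∧ (r = insPos D c ∨ r ∈ boundaries D)) ∨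
      (insPos D c + 1 ≤ r ∧ (r - 1 = insPos D c ∨ r - 1 ∈ boundaries D)) := by
  have hmem : insPos D c ∈ boundaries (splitNode D c) :=
    h.boundaries_splitNode c ▸ Finset.mem_insert_self _ _
  rw [insertNode, mem_boundaries_insertAt (h.proper_splitNode c) hmem, h.boundaries_splitNode,
    Finset.mem_insert, Finset.mem_insert]

theorem insPos_ne_left (h : Reduces D b A B S) (hT : IsText T) (hD : bwt T = expand D)
    (hc : dollar < c) (hA : A.getLast? = some c) : insPos D c ≠ A.length := by
  obtain ⟨A, rfl⟩ := List.getLast?_eq_some_iff.1 hA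
  have hlen : A.length < (expand D).length := by
    simp only [h.expand_eq, List.length_append, List.length_cons]
    omega
  have hchar : (expand D).getD A.length 0 = c := by
    rw [h.expand_eq, List.append_assoc, List.singleton_append, getD_insert_self]
  have hins : insPos D c = lf (expand D) A.length + 1 := by
    rw [insPos, h.repPos_eq, List.length_append, List.length_singleton, rank_succ _ _ hlen,
      if_pos hchar, lf, hchar, add_assoc]
  rw [hins, List.length_append, List.length_singleton, Ne, Nat.add_right_cancel_iff, ← hD]
  exact hT.lf_bwt_ne (hD ▸ hlen) (hD ▸ hchar.symm ▸ hc)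

theorem insPos_ne_right (h : Reduces D b A B S) (hT : IsText T) (hD : bwt T = expand D)
    (hc : dollar < c) (hB : B.head? = some c) : insPos D c ≠ A.length + 1 := by
  obtain ⟨B, rfl⟩ := List.head?_eq_some_iff.1 hB
  have hlen : A.length + 1 < (expand D).length := by
    simp only [h.expand_eq, List.length_append, List.length_cons]
    omega
  have hchar : (expand D).getD (A.length + 1) 0 = c := by
    simp [h.expand_eq]
  have hchar' : (expand D).getD A.length 0 = dollar := by rw [h.expand_eq, getD_insert_self]
  have hins : insPos D c = lf (expand D) (A.length + 1) := by
    rw [insPos, h.repPos_eq, lf, hchar, rank_succ _ _ (Nat.lt_of_succ_lt hlen), hchar',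
      if_neg hc.ne, add_zero]
  rw [hins, ← hD]
  exact hT.lf_bwt_ne (hD ▸ hlen) (hD ▸ hchar.symm ▸ hc)

/-- Since LF has no fixed points, the inserted special character does not separate the new
repetition from a neighbour of the same character. -/
theorem exists_expand_insertNode (h : Reduces D b A B S) (hT : IsText T) (hD : bwt T = expand D)
    (hc : dollar < c) : ∃ A' B', expand (insertNode D c) = A' ++ c :: B' ∧
      newPos D c = A'.length ∧ (A'.getLast? = some c ↔ A.getLast? = some c) ∧
      (B'.head? = some c ↔ B.head? = some c) := by
  rw [h.expand_insertNode, newPos, h.repPos_eq]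
  by_cases hle : insPos D c ≤ A.length
  · refine ⟨A.take (insPos D c) ++ dollar :: A.drop (insPos D c), B, ?_, ?_, ?_, Iff.rfl⟩
    · rw [List.take_append_of_le_length hle, List.drop_append_of_le_length hle, List.append_assoc,
        List.cons_append]
    · rw [if_pos hle, List.length_append, List.length_cons, ← add_assoc, ← List.length_append,
        List.take_append_drop]
    · rcases hle.eq_or_lt with heq | hlt
      · refine iff_of_false ?_ fun hA => h.insPos_ne_left hT hD hc hA heq
        simpa [heq] using hc.ne
      · have hne : A.drop (insPos D c) ≠ [] := by simpa using hlt
        rw [List.getLast?_append_of_ne_nil _ (List.cons_ne_nil _ _),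
          ← List.singleton_append, List.getLast?_append_of_ne_nil _ hne, List.getLast?_drop,
          if_neg hlt.not_ge]
  · obtain ⟨k, hk⟩ := Nat.exists_eq_add_of_lt (not_le.1 hle)
    refine ⟨A, B.take k ++ dollar :: B.drop k, ?_, if_neg hle, Iff.rfl, ?_⟩
    · rw [hk, add_assoc, List.take_length_add_append, List.drop_length_add_append,
        List.take_succ_cons, List.drop_succ_cons, List.append_assoc, List.cons_append]
    · rcases k with - | k
      · refine iff_of_false ?_ fun hB => h.insPos_ne_right hT hD hc hB hk
        simpa using hc.ne
      · rcases B with - | ⟨a, B⟩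
        · simpa using hc.ne
        · rfl

theorem length_mem_boundaries (h : Reduces D b A B S) : A.length ∈ boundaries D :=
  (h.mem_boundaries_iff _).2 (Or.inl rfl)

theorem length_succ_mem_boundaries (h : Reduces D b A B S) : A.length + 1 ∈ boundaries D :=
  (h.mem_boundaries_iff _).2 (Or.inr (Or.inl rfl))

theorem newPos_mem_boundaries (h : Reduces D b A B S) (c : ℕ) :
    newPos D c ∈ boundaries (insertNode D c) := by
  have hA := h.length_mem_boundaries
  rw [h.mem_boundaries_insertNode, newPos, h.repPos_eq]
  grind

theorem newPos_succ_mem_boundaries (h : Reduces D b A B S) (c : ℕ) :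
    newPos D c + 1 ∈ boundaries (insertNode D c) := by
  have hA := h.length_succ_mem_boundaries
  rw [h.mem_boundaries_insertNode, newPos, h.repPos_eq]
  grind

theorem isFast_iff (h : Reduces D b A B S) (c : ℕ) :
    isFast D c = true ↔ A.getLast? = some c ∨ B.head? = some c := by
  rw [isFast, h.repPos_eq, h.expand_eq, charBefore_append_length, getElem?_insert_length_succ,
    Bool.or_eq_true, beq_iff_eq, beq_iff_eq]

theorem update_eq_mergeNodes (h : Reduces D b A B S) (hT : IsText T) (hD : bwt T = expand D)
    (hc : dollar < c) : RComp.update D c b = mergeNodes D c b := by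
  obtain ⟨A', B', hE, hq, hA', hB'⟩ := h.exists_expand_insertNode hT hD hc
  have hfast := h.isFast_iff c
  rw [← hA', ← hB'] at hfast
  rw [RComp.update]
  split_ifs with hupd
  · rfl
  · rw [hfast, not_or] at hupd
    rw [mergeNodes_eq hE hq, if_neg fun hboth => hupd.1 hboth.1.1, if_neg hupd.1, if_neg hupd.2]

theorem expand_update (h : Reduces D b A B S) (hT : IsText T) (hD : bwt T = expand D)
    (hc : dollar < c) : expand (RComp.update D c b) =
      (A ++ c :: B).take (insPos D c) ++ dollar :: (A ++ c :: B).drop (insPos D c) := by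
  obtain ⟨A', B', hE, hq, -⟩ := h.exists_expand_insertNode hT hD hc
  rw [h.update_eq_mergeNodes hT hD hc, expand_mergeNodes (h.proper_insertNode c) hE hq
    (hq ▸ h.newPos_mem_boundaries c) (hq ▸ h.newPos_succ_mem_boundaries c), h.expand_insertNode]

theorem mem_boundaries_update (h : Reduces D b A B S) (hT : IsText T) (hD : bwt T = expand D)
    (hc : dollar < c) : r ∈ boundaries (RComp.update D c b) ↔ r ∈ boundaries (insertNode D c) ∧
      ¬ (r = newPos D c ∧ A.getLast? = some c) ∧
      ¬ (r = newPos D c + 1 ∧ B.head? = some c ∧ (A.getLast? ≠ some c ∨ b = true)) := by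
  obtain ⟨A', B', hE, hq, hA', hB'⟩ := h.exists_expand_insertNode hT hD hc
  rw [h.update_eq_mergeNodes hT hD hc, mem_boundaries_mergeNodes (h.proper_insertNode c) hE hq
    (hq ▸ h.newPos_mem_boundaries c) (hq ▸ h.newPos_succ_mem_boundaries c), Ne, hA', hB', ← hq]

end Reduces

/-- The boundaries of `D` in `A ++ c :: B` that remain when the repetition `c` in place of the
special character is merged with its neighbours. -/
def keptBoundaries (D : DBWT) (b : Bool) (A B : List ℕ) (c : ℕ) : Finset ℕ :=
  (boundaries D).filter fun q => ¬ (q = A.length ∧ A.getLast? = some c) ∧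
    ¬ (q = A.length + 1 ∧ B.head? = some c ∧ (A.getLast? ≠ some c ∨ b = true))

theorem mem_keptBoundaries {D : DBWT} {b : Bool} {A B : List ℕ} {c q : ℕ} :
    q ∈ keptBoundaries D b A B c ↔ q ∈ boundaries D ∧ ¬ (q = A.length ∧ A.getLast? = some c) ∧
      ¬ (q = A.length + 1 ∧ B.head? = some c ∧ (A.getLast? ≠ some c ∨ b = true)) :=
  Finset.mem_filter

theorem dollar_lt_of_mem_insert {A B : List ℕ} {c : ℕ} (hAB : ∀ a ∈ A ++ B, dollar < a)
    (hc : dollar < c) : ∀ a ∈ A ++ c :: B, dollar < a := by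
  rw [List.forall_mem_append] at hAB ⊢
  exact ⟨hAB.1, List.forall_mem_cons.2 ⟨hc, hAB.2⟩⟩

theorem mem_image_skip {S : Finset ℕ} {p q : ℕ} :
    q ∈ S.image (skip p) ↔ q ≠ p ∧ unshift p q ∈ S := by
  rw [Finset.mem_image]
  constructor
  · rintro ⟨s, hs, rfl⟩
    exact ⟨by grind [skip], (unshift_skip p s).symm ▸ hs⟩
  · exact fun h => ⟨_, h.2, skip_unshift h.1⟩

namespace Reduces

variable {D : DBWT} {b : Bool} {A B T : List ℕ} {S : Finset ℕ} {c q s : ℕ}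

theorem getLast?_eq_head? (h : Reduces D b A B S) (hb : b = true) : A.getLast? = B.head? := by
  obtain ⟨hpos, heq⟩ := h.run_of_notMem A.length
    (by rw [List.length_append]; exact Nat.le_add_right _ _) (h.flag_iff.1 hb)
  rw [List.getElem?_append_left (Nat.sub_one_lt_of_lt hpos),
    List.getElem?_append_right le_rfl, Nat.sub_self] at heq
  rw [List.getLast?_eq_getElem?, heq, List.head?_eq_getElem?]

theorem keptBoundaries_eq_image (h : Reduces D b A B S)
    (hc : A.getLast? = some c ∨ B.head? = some c) :
    keptBoundaries D b A B c = S.image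
      (skip (if B.head? = some c ∧ A.getLast? ≠ some c then A.length + 1 else A.length)) := by
  have hlast := h.getLast?_eq_head?
  have hflag := h.flag_iff
  ext q
  rw [mem_keptBoundaries, h.mem_boundaries_iff, mem_image_skip]
  split_ifs with hB
  · grind [unshift]
  · grind [unshift]

theorem keptBoundaries_eq_insert (h : Reduces D b A B S) (hA : A.getLast? ≠ some c)
    (hB : B.head? ≠ some c) : keptBoundaries D b A B c =
      insert A.length (insert (A.length + 1) (S.image (skip A.length))) := by
  ext q
  rw [mem_keptBoundaries, h.mem_boundaries_iff, Finset.mem_insert, Finset.mem_insert,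
    mem_image_skip]
  tauto

theorem length_insert (h : Reduces D b A B S) (c : ℕ) :
    (A ++ c :: B).length = (expand D).length := by
  rw [h.expand_eq, List.length_append, List.length_append, List.length_cons, List.length_cons]

theorem le_of_mem_keptBoundaries (h : Reduces D b A B S) (hq : q ∈ keptBoundaries D b A B c) :
    q ≤ (A ++ c :: B).length :=
  (le_length_of_mem_boundaries (mem_keptBoundaries.1 hq).1).trans_eq (h.length_insert c).symm

theorem insPos_mem_keptBoundaries (h : Reduces D b A B S) (hT : IsText T) (hD : bwt T = expand D)
    (hc : dollar < c) : insPos D c ∈ keptBoundaries D b A B c ↔ insPos D c ∈ boundaries D := by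
  have hleft := h.insPos_ne_left hT hD hc
  have hright := h.insPos_ne_right hT hD hc
  rw [mem_keptBoundaries]
  tauto

theorem run_of_notMem_keptBoundaries (h : Reduces D b A B S) (hs : s ≤ (A ++ c :: B).length)
    (hsS : s ∉ keptBoundaries D b A B c) :
    0 < s ∧ (A ++ c :: B)[s - 1]? = (A ++ c :: B)[s]? := by
  by_cases hsD : s ∈ boundaries D
  · rw [mem_keptBoundaries, not_and, not_and_or, not_not, not_not] at hsS
    rcases hsS hsD with ⟨rfl, hA⟩ | ⟨rfl, hB, -⟩
    · exact getElem?_insert_pred hA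
    · refine ⟨Nat.succ_pos _, ?_⟩
      rw [getElem?_insert_length_succ, hB, Nat.add_sub_cancel]
      simp
  · have hlt : s < (expand (replaceNode D c)).length := by
      rw [h.expand_replaceNode]
      refine lt_of_le_of_ne hs fun heq => hsD ?_
      rw [heq, h.length_insert]
      exact length_expand_mem_boundaries D
    refine ⟨pos_of_notMem_boundaries hsD, ?_⟩
    rw [← h.expand_replaceNode]
    exact getElem?_expand_pred hlt (boundaries_replaceNode D c ▸ hsD)

theorem mem_boundaries_update_iff (h : Reduces D b A B S) (hT : IsText T) (hD : bwt T = expand D)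
    (hc : dollar < c) : q ∈ boundaries (RComp.update D c b) ↔
      q = insPos D c ∨ q = insPos D c + 1 ∨ unshift (insPos D c) q ∈ keptBoundaries D b A B c := by
  have hleft := h.insPos_ne_left hT hD hc
  have hright := h.insPos_ne_right hT hD hc
  rw [h.mem_boundaries_update hT hD hc, h.mem_boundaries_insertNode, newPos, h.repPos_eq,
    mem_keptBoundaries, unshift]
  by_cases hle : insPos D c ≤ A.length
  · simp only [if_pos hle]
    grind
  · simp only [if_neg hle]
    grind

theorem length_take_insPos (h : Reduces D b A B S) (c : ℕ) :
    ((A ++ c :: B).take (insPos D c)).length = insPos D c :=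
  List.length_take_of_le ((insPos_le D c).trans_eq (h.length_insert c).symm)

protected theorem update (h : Reduces D b A B S) (hT : IsText T) (hD : bwt T = expand D)
    (hc : dollar < c) : Reduces (update D c b) (splits D c) ((A ++ c :: B).take (insPos D c))
      ((A ++ c :: B).drop (insPos D c)) (keptBoundaries D b A B c) where
  proper := h.update_eq_mergeNodes hT hD hc ▸ (h.proper_insertNode c).mergeNodes b
  expand_eq := h.expand_update hT hD hc
  dollar_lt := by
    rw [List.take_append_drop]
    exact dollar_lt_of_mem_insert h.dollar_lt hc
  le_length := by
    rw [List.take_append_drop]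
    exact fun s => h.le_of_mem_keptBoundaries
  flag_iff := by
    rw [h.length_take_insPos, splits_iff (insPos_le D c), h.insPos_mem_keptBoundaries hT hD hc]
  run_of_notMem := by
    rw [List.take_append_drop]
    exact fun s => h.run_of_notMem_keptBoundaries
  mem_boundaries_iff := by
    rw [h.length_take_insPos]
    exact fun q => h.mem_boundaries_update_iff hT hD hc

theorem isPaid_update (h : Reduces D b A B S) (hpaid : IsPaid A B S) (hc : dollar < c) :
    IsPaid ((A ++ c :: B).take (insPos D c)) ((A ++ c :: B).drop (insPos D c))
      (keptBoundaries D b A B c) := by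
  rw [IsPaid] at hpaid ⊢
  rw [List.take_append_drop, h.length_take_insPos, h.insPos_eq hc]
  by_cases hfast : A.getLast? = some c ∨ B.head? = some c
  · rw [h.keptBoundaries_eq_image hfast]
    have hpot := totalPotential_le_image_skip (c := c)
      (q := if B.head? = some c ∧ A.getLast? ≠ some c then A.length + 1 else A.length)
      h.le_length (by grind)
    have hcard := Finset.card_image_le (s := S)
      (f := skip (if B.head? = some c ∧ A.getLast? ≠ some c then A.length + 1 else A.length))
    have hruns := runs_append_le_insert A B c
    omega
  · rw [not_or] at hfast
    have hle := fun q => h.le_of_mem_keptBoundaries (c := c) (q := q)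
    rw [h.keptBoundaries_eq_insert hfast.1 hfast.2] at hle ⊢
    rw [Finset.forall_mem_insert, Finset.forall_mem_insert] at hle
    have hpot := totalPotential_le_image_skip (c := c) h.le_length (Or.inl rfl)
    have hcard := Finset.card_image_le (s := S) (f := skip A.length)
    have hruns := runs_append_add_one_le_insert hfast.1 hfast.2
    have hcard₁ := Finset.card_insert_le (A.length + 1) (S.image (skip A.length))
    have hcard₂ := Finset.card_insert_le A.length (insert (A.length + 1) (S.image (skip A.length)))
    have hpot₁ := totalPotential_le_insert (p := occLt (A ++ B) c + rank (A ++ B) c A.length + 1)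
      hle.2.2 hle.2.1
    have hpot₂ := totalPotential_le_insert (p := occLt (A ++ B) c + rank (A ++ B) c A.length + 1)
      (Finset.forall_mem_insert _ _ _ |>.2 hle.2) hle.1
    omega

end Reduces

/-! ### Runs of the algorithm -/

section Text

variable {T : List ℕ} {A B : List ℕ} {c i δ : ℕ}

theorem IsText.drop (hT : IsText T) (hi : i < T.length) : IsText (T.drop i) := by
  obtain ⟨S, rfl, h⟩ := hT
  rw [List.length_append, List.length_singleton, Nat.lt_succ_iff] at hi
  exact ⟨S.drop i, List.drop_append_of_le_length hi, fun c hc => h c (List.mem_of_mem_drop hc)⟩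

theorem IsText.dollar_mem (hT : IsText T) : dollar ∈ T := by
  obtain ⟨S, rfl, -⟩ := hT
  exact List.mem_append_right _ (List.mem_singleton_self _)

theorem IsText.length_pos (hT : IsText T) : 0 < T.length :=
  List.length_pos_of_mem hT.dollar_mem

theorem IsText.dollar_lt_getD (hT : IsText T) (hi : i + 1 < T.length) : dollar < T.getD i 0 :=
  prevChar_succ T i ▸ hT.dollar_lt_prevChar hi

theorem IsText.dollar_lt_nextChar (hT : IsText T) (hδ : 0 < δ) (hδT : δ < T.length) :
    dollar < nextChar T δ :=
  hT.dollar_lt_getD (by omega)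

theorem drop_eq_nextChar_cons (hδ : δ < T.length) :
    T.drop (T.length - (δ + 1)) = nextChar T δ :: T.drop (T.length - δ) := by
  have hlt : T.length - (δ + 1) < T.length := by omega
  have hsucc : T.length - (δ + 1) + 1 = T.length - δ := by omega
  rw [List.drop_eq_getElem_cons hlt, hsucc, nextChar, Nat.sub_sub, List.getD_eq_getElem _ _ hlt]

theorem nextChar_mem (hδ : δ < T.length) : nextChar T δ ∈ T :=
  getD_mem (by omega)

theorem prevChar_mem (hi : i < T.length) : prevChar T i ∈ T := by
  rw [prevChar]
  split_ifs <;> exact getD_mem (by omega)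

theorem mem_of_mem_bwt {a : ℕ} (ha : a ∈ bwt T) : a ∈ T := by
  rw [bwt_eq_map, List.mem_map] at ha
  obtain ⟨i, hi, rfl⟩ := ha
  exact prevChar_mem (mem_suffixArray.1 hi)

theorem IsText.exists_bwt_eq (hT : IsText T) :
    ∃ A B, bwt T = A ++ dollar :: B ∧ ∀ a ∈ A ++ B, dollar < a := by
  obtain ⟨A, B, hAB⟩ := List.append_of_mem (mem_suffixArray.2 hT.length_pos)
  have hnodup : (A ++ 0 :: B).Nodup := hAB ▸ (suffixArray_perm T).nodup_iff.2 List.nodup_range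
  refine ⟨A.map (prevChar T), B.map (prevChar T), ?_, ?_⟩
  · rw [bwt_eq_map, hAB, List.map_append, List.map_cons, hT.prevChar_zero]
  · rw [← List.map_append, List.forall_mem_map]
    intro i hi
    have hmem : i ∈ suffixArray T := hAB ▸ List.perm_middle.mem_iff.2 (List.mem_cons_of_mem _ hi)
    have hne : i ≠ 0 := fun h0 => (List.nodup_cons.1 (List.nodup_middle.1 hnodup)).1 (h0 ▸ hi)
    obtain ⟨i, rfl⟩ := Nat.exists_eq_succ_of_ne_zero hne
    exact hT.dollar_lt_prevChar (mem_suffixArray.1 hmem)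

/-- The number of runs of the BWT of `T` without its special character. In contrast to the number of
runs of the BWT it does not decrease when the text is extended. -/
def coreRuns (T : List ℕ) : ℕ := runs ((bwt T).filter fun a => decide (dollar < a))

theorem coreRuns_eq (hL : bwt T = A ++ dollar :: B) (hAB : ∀ a ∈ A ++ B, dollar < a) :
    coreRuns T = runs (A ++ B) := by
  rw [coreRuns, hL, List.filter_append, List.filter_cons_of_neg (by simp), ← List.filter_append,
    List.filter_eq_self.2 fun a ha => decide_eq_true (hAB a ha)]

theorem IsText.coreRuns_le_cons (hT : IsText T) (hc : dollar < c) :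
    coreRuns T ≤ coreRuns (c :: T) := by
  obtain ⟨A, B, hL, hAB⟩ := hT.exists_bwt_eq
  rw [coreRuns_eq hL hAB, coreRuns_eq (hT.bwt_cons hc hL hAB), List.take_append_drop]
  · exact runs_append_le_insert A B c
  · rw [List.take_append_drop]
    exact dollar_lt_of_mem_insert hAB hc

theorem IsText.coreRuns_drop_le (hT : IsText T) (hi : i < T.length) :
    coreRuns (T.drop i) ≤ coreRuns T := by
  induction i with
  | zero => exact le_rfl
  | succ i ih =>
    have hi' := Nat.lt_of_succ_lt hi
    refine le_trans ?_ (ih hi')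
    rw [List.drop_eq_getElem_cons hi', ← List.getD_eq_getElem T 0 hi']
    exact (hT.drop hi).coreRuns_le_cons (hT.dollar_lt_getD hi)

theorem IsText.coreRuns_le_numRuns (hT : IsText T) : coreRuns T ≤ numRuns T := by
  obtain ⟨A, B, hL, hAB⟩ := hT.exists_bwt_eq
  rw [coreRuns_eq hL hAB, numRuns_eq_runs, hL]
  exact runs_append_le_insert A B dollar

theorem IsText.numRuns_pos (hT : IsText T) : 0 < numRuns T := by
  rw [numRuns_eq_runs]
  refine runs_pos fun hnil => hT.length_pos.ne ?_
  rw [← length_bwt T, hnil, List.length_nil]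

end Text

/-- The invariant of r-comp: `D` represents the BWT of the suffix `S` that has been read and
satisfies the amortized bound. -/
def Invariant (S : List ℕ) (D : DBWT) (b : Bool) : Prop :=
  bwt S = expand D ∧ ∃ A B Y, Reduces D b A B Y ∧ IsPaid A B Y

section Invariant

variable {α δ c i : ℕ} {S T : List ℕ} {D D' : DBWT} {b : Bool}

theorem Reduces.initial : Reduces [(dollar, 1)] false [] [] {0} where
  proper := proper_cons.2 ⟨Nat.one_pos, proper_nil⟩
  expand_eq := rfl
  dollar_lt := List.forall_mem_nil _
  le_length := by simp
  flag_iff := by simp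
  run_of_notMem := fun s hs hs' => absurd (Finset.mem_singleton.2 (Nat.le_zero.1 hs)) hs'
  mem_boundaries_iff := fun q => by
    rw [mem_boundaries_cons, boundaries, Finset.mem_singleton, Finset.mem_singleton]
    grind [unshift]

theorem invariant_initial : Invariant [dollar] [(dollar, 1)] false :=
  ⟨bwt_dollar, _, _, _, Reduces.initial, by simp [IsPaid]⟩

theorem Invariant.update (h : Invariant S D b) (hS : IsText S) (hα : 16 ≤ α) (hc : dollar < c)
    (hD' : Relation.ReflTransGen (BalanceStep α) (update D c b) D') :
    Invariant (c :: S) D' (splits D c) := by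
  obtain ⟨hD, A, B, Y, hR, hpaid⟩ := h
  obtain ⟨Y', hR', hpaid'⟩ := (hR.update hS hD hc).balance hα hD' (hR.isPaid_update hpaid hc)
  refine ⟨?_, _, _, Y', hR', hpaid'⟩
  rw [hS.bwt_cons hc (hD.trans hR.expand_eq) hR.dollar_lt, hR'.expand_eq, insPos, hR.repPos_eq, hD]

theorem Invariant.length_le (h : Invariant (T.drop i) D b) (hT : IsText T) (hi : i < T.length) :
    D.length ≤ 26 * numRuns T := by
  obtain ⟨hD, A, B, Y, hR, hpaid⟩ := h
  have hlen := hR.length_le hpaid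
  have hruns := (hT.coreRuns_drop_le hi).trans hT.coreRuns_le_numRuns
  have hpos := hT.numRuns_pos
  rw [coreRuns_eq (hD.trans hR.expand_eq) hR.dollar_lt] at hruns
  omega

theorem Run.invariant (h : Run α T δ D b) (hα : 16 ≤ α) (hT : IsText T) :
    0 < δ ∧ δ ≤ T.length ∧ Invariant (T.drop (T.length - δ)) D b := by
  induction h with
  | init =>
    obtain ⟨S, rfl, -⟩ := hT
    refine ⟨Nat.one_pos, by simp, ?_⟩
    rw [List.length_append, List.length_singleton, Nat.add_sub_cancel, List.drop_left]
    exact invariant_initial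
  | step δ D D' b _ hδ hD' _ ih =>
    obtain ⟨hpos, -, hinv⟩ := ih
    refine ⟨Nat.succ_pos δ, hδ, ?_⟩
    rw [drop_eq_nextChar_cons hδ]
    exact hinv.update (hT.drop (by omega)) hα (hT.dollar_lt_nextChar hpos hδ) hD'

theorem Run.length_le (h : Run α T δ D b) (hα : 16 ≤ α) (hT : IsText T) :
    D.length ≤ 26 * numRuns T := by
  obtain ⟨hpos, -, hinv⟩ := h.invariant hα hT
  exact hinv.length_le hT (Nat.sub_lt hT.length_pos hpos)

end Invariant

/-! ### The states visited during the execution -/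

section Compress

theorem compress_cons (a l : ℕ) (D : DBWT) : compress ((a, l) :: D) = (a, l) :: compress D ∨
    ∃ k E, compress D = (a, k) :: E ∧ compress ((a, l) :: D) = (a, l + k) :: E := by
  rw [compress]
  rcases compress D with - | ⟨⟨b, k⟩, E⟩
  · exact Or.inl rfl
  · dsimp only
    split_ifs with hab
    · exact Or.inr ⟨k, E, by rw [hab], rfl⟩
    · exact Or.inl rfl

theorem expand_compress (D : DBWT) : expand (compress D) = expand D := by
  induction D with
  | nil => rfl
  | cons x D ih =>
    obtain ⟨a, l⟩ := x
    rw [expand_cons, ← ih]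
    rcases compress_cons a l D with heq | ⟨k, E, hE, heq⟩
    · rw [heq, expand_cons]
    · rw [heq, hE, expand_cons, expand_cons, List.replicate_add, List.append_assoc]

theorem length_compress_le (D : DBWT) : (compress D).length ≤ D.length := by
  induction D with
  | nil => exact le_rfl
  | cons x D ih =>
    obtain ⟨a, l⟩ := x
    rcases compress_cons a l D with heq | ⟨k, E, hE, heq⟩
    · rw [heq, List.length_cons, List.length_cons]
      omega
    · rw [hE, List.length_cons] at ih
      rw [heq, List.length_cons, List.length_cons]
      omega

theorem Proper.compress {D : DBWT} (h : Proper D) : Proper (compress D) := by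
  induction D with
  | nil => exact h
  | cons x D ih =>
    obtain ⟨a, l⟩ := x
    obtain ⟨hl, hD⟩ := proper_cons.1 h
    rcases compress_cons a l D with heq | ⟨k, E, hE, heq⟩
    · exact heq ▸ proper_cons.2 ⟨hl, ih hD⟩
    · exact heq ▸ proper_cons.2 ⟨Nat.add_pos_left hl k, (proper_cons.1 (hE ▸ ih hD)).2⟩

end Compress

/-- The properties of a DBWT held in memory on which the working space depends. -/
structure Bounded (T : List ℕ) (D : DBWT) : Prop where
  proper : Proper D
  length_expand_le : (expand D).length ≤ T.length
  mem_text : ∀ a ∈ expand D, a ∈ T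
  length_le : D.length ≤ 28 * numRuns T

section Bounded

variable {α δ i : ℕ} {T : List ℕ} {D D' out : DBWT} {b : Bool}

theorem Bounded.compress (h : Bounded T D) : Bounded T (compress D) where
  proper := h.proper.compress
  length_expand_le := (expand_compress D).symm ▸ h.length_expand_le
  mem_text := (expand_compress D).symm ▸ h.mem_text
  length_le := (length_compress_le D).trans h.length_le

theorem Invariant.bounded (h : Invariant (T.drop i) D b) (hT : IsText T) (hi : i < T.length) :
    Bounded T D := by
  have hlen := h.length_le hT hi
  obtain ⟨hD, A, B, Y, hR, -⟩ := h
  refine ⟨hR.proper, ?_, fun a ha => ?_, by omega⟩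
  · rw [← hD, length_bwt, List.length_drop]
    exact Nat.sub_le _ _
  · exact List.mem_of_mem_drop (mem_of_mem_bwt (hD ▸ ha))

theorem Run.bounded (h : Run α T δ D b) (hα : 16 ≤ α) (hT : IsText T) : Bounded T D := by
  obtain ⟨hpos, -, hinv⟩ := h.invariant hα hT
  exact hinv.bounded hT (Nat.sub_lt hT.length_pos hpos)

theorem Run.length_expand (h : Run α T δ D b) (hα : 16 ≤ α) (hT : IsText T) :
    (expand D).length = δ := by
  obtain ⟨-, hle, hD, -⟩ := h.invariant hα hT
  rw [← hD, length_bwt, List.length_drop, Nat.sub_sub_self hle]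

theorem Run.mem_of_mem_insert (h : Run α T δ D b) (hα : 16 ≤ α) (hT : IsText T)
    (hδ : δ < T.length) {A B : List ℕ} (hD : expand D = A ++ dollar :: B) :
    ∀ a ∈ A ++ nextChar T δ :: B, a ∈ T := by
  have hmem := (h.bounded hα hT).mem_text
  rw [hD, List.forall_mem_append, List.forall_mem_cons] at hmem
  rw [List.forall_mem_append, List.forall_mem_cons]
  exact ⟨hmem.1, nextChar_mem hδ, hmem.2.2⟩

theorem Run.bounded_replaceNode (h : Run α T δ D b) (hα : 16 ≤ α) (hT : IsText T)
    (hδ : δ < T.length) : Bounded T (replaceNode D (nextChar T δ)) := by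
  obtain ⟨-, -, -, A, B, Y, hR, -⟩ := h.invariant hα hT
  refine ⟨hR.proper.replaceNode _, ?_, ?_, ?_⟩
  · rw [hR.expand_replaceNode, hR.length_insert, h.length_expand hα hT]
    exact hδ.le
  · rw [hR.expand_replaceNode]
    exact h.mem_of_mem_insert hα hT hδ hR.expand_eq
  · exact (length_replaceNode D _).trans_le (h.bounded hα hT).length_le

theorem length_splitNode_le (D : DBWT) (c : ℕ) : (splitNode D c).length ≤ D.length + 1 :=
  length_replaceNode D c ▸ length_cutAt_le _ _

theorem Run.bounded_splitNode (h : Run α T δ D b) (hα : 16 ≤ α) (hT : IsText T)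
    (hδ : δ < T.length) : Bounded T (splitNode D (nextChar T δ)) := by
  have hlen := h.length_le hα hT
  have hsplit := length_splitNode_le D (nextChar T δ)
  have hruns := hT.numRuns_pos
  obtain ⟨-, -, -, A, B, Y, hR, -⟩ := h.invariant hα hT
  refine ⟨hR.proper_splitNode _, ?_, ?_, by omega⟩
  · rw [hR.expand_splitNode, hR.length_insert, h.length_expand hα hT]
    exact hδ.le
  · rw [hR.expand_splitNode]
    exact h.mem_of_mem_insert hα hT hδ hR.expand_eq

theorem Run.bounded_insertNode (h : Run α T δ D b) (hα : 16 ≤ α) (hT : IsText T)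
    (hδ : δ < T.length) : Bounded T (insertNode D (nextChar T δ)) := by
  have hlen := h.length_le hα hT
  have hsplit := length_splitNode_le D (nextChar T δ)
  have hruns := hT.numRuns_pos
  obtain ⟨-, -, -, A, B, Y, hR, -⟩ := h.invariant hα hT
  have hperm : (expand (insertNode D (nextChar T δ))).Perm
      (dollar :: (A ++ nextChar T δ :: B)) := by
    rw [hR.expand_insertNode]
    exact List.perm_middle.trans (by rw [List.take_append_drop])
  refine ⟨hR.proper_insertNode _, ?_, fun a ha => ?_, ?_⟩
  · rw [hperm.length_eq, List.length_cons, hR.length_insert, h.length_expand hα hT]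
    exact hδ
  · exact List.forall_mem_cons.2 ⟨hT.dollar_mem, h.mem_of_mem_insert hα hT hδ hR.expand_eq⟩ a
      (hperm.mem_iff.1 ha)
  · rw [insertNode, length_insertAt]
    omega

theorem Run.bounded_balance (h : Run α T δ D b) (hα : 16 ≤ α) (hT : IsText T) (hδ : δ < T.length)
    (hD' : Relation.ReflTransGen (BalanceStep α) (update D (nextChar T δ) b) D') :
    Bounded T D' := by
  obtain ⟨hpos, -, hinv⟩ := h.invariant hα hT
  have hinv' := hinv.update (hT.drop (by omega)) hα (hT.dollar_lt_nextChar hpos hδ) hD'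
  rw [← drop_eq_nextChar_cons hδ] at hinv'
  exact hinv'.bounded hT (by omega)

theorem Visits.bounded (h : Visits α T D out) (hα : 16 ≤ α) (hT : IsText T) : Bounded T D := by
  cases h with
  | start δ _ b h => exact h.bounded hα hT
  | replaced δ _ b h hδ => exact h.bounded_replaceNode hα hT hδ
  | split δ _ b h hδ => exact h.bounded_splitNode hα hT hδ
  | inserted δ _ b h hδ => exact h.bounded_insertNode hα hT hδ
  | balancing δ _ _ b h hδ hD' => exact h.bounded_balance hα hT hδ hD'
  | recovered _ b h => exact h.bounded hα hT
  | converted _ b h => exact h.bounded hα hT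

theorem Visits.out_eq (h : Visits α T D out) : out = [] ∨ out = D ∨ out = D ++ compress D := by
  cases h <;> simp

theorem Visits.length_out_le (h : Visits α T D out) : out.length ≤ 2 * D.length := by
  have hcompress := length_compress_le D
  rcases h.out_eq with rfl | rfl | rfl
  · exact Nat.zero_le _
  · omega
  · rw [List.length_append]
    omega

end Bounded

/-! ### The machine words of the memory -/

section Graph

variable {D : DBWT} {V : ℕ}

theorem mem_vOrder {i : ℕ} : i ∈ vOrder D ↔ i < D.length := by
  rw [vOrder, (List.mergeSort_perm _ _).mem_iff, List.mem_range]

theorem length_vOrder (D : DBWT) : (vOrder D).length = D.length := by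
  rw [vOrder, List.length_mergeSort, List.length_range]

theorem getD_vOrder_le (D : DBWT) (j : ℕ) : (vOrder D).getD j D.length ≤ D.length := by
  rw [List.getD_eq_getElem?_getD]
  cases h : (vOrder D)[j]? with
  | none => exact le_rfl
  | some a => exact (mem_vOrder.1 (List.mem_of_getElem? h)).le

theorem length_graphWords (D : DBWT) : (graphWords D).length = 14 * D.length := by
  simp only [graphWords, List.length_append, List.length_flatMap, uRecord, vRecord,
    List.length_cons, List.length_nil, List.map_const', List.length_range, List.sum_replicate,
    smul_eq_mul]
  omega

theorem char_lt (hV : 0 < V) (hc : ∀ x ∈ D, x.1 < V) (i : ℕ) : char D i < V := by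
  rw [char, List.getD_eq_getElem?_getD]
  cases h : D[i]? with
  | none => exact hV
  | some x => exact hc x (List.mem_of_getElem? h)

theorem len_le_length_expand (D : DBWT) (i : ℕ) : len D i ≤ (expand D).length := by
  rw [len, List.getD_eq_getElem?_getD]
  cases h : D[i]? with
  | none => exact Nat.zero_le _
  | some x => exact snd_le_length_expand (List.mem_of_getElem? h)

theorem findIdx_range_le (k : ℕ) (P : ℕ → Bool) : (List.range k).findIdx P ≤ k :=
  List.findIdx_le_length.trans_eq List.length_range

theorem lt_of_mem_uRecord (hD : Proper D) (hV : (expand D).length < V) (hc : ∀ x ∈ D, x.1 < V)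
    {i x : ℕ} (hi : i < D.length) (hx : x ∈ uRecord D i) : x < V := by
  have hlen := hD.length_le
  have hedge : edgeL D i ≤ D.length := findIdx_range_le _ _
  have hstart := uStart_le_length D i
  have hchar := char_lt (by omega) hc i
  have hsnd := len_le_length_expand D i
  simp only [uRecord, List.mem_cons, List.not_mem_nil, or_false] at hx
  rcases hx with rfl | rfl | rfl | rfl | rfl | rfl | rfl
  · split_ifs <;> omega
  all_goals omega

theorem lt_of_mem_vRecord (hD : Proper D) (hV : (expand D).length < V) (hc : ∀ x ∈ D, x.1 < V)
    {i x : ℕ} (hi : i < D.length) (hx : x ∈ vRecord D i) : x < V := by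
  have hlen := hD.length_le
  have hedge : edgeF D i ≤ D.length := findIdx_range_le _ _
  have hstart : vStart D i ≤ (expand D).length := lf_le_length _ _
  have hchar := char_lt (by omega) hc i
  have hsnd := len_le_length_expand D i
  have hprev := getD_vOrder_le D ((vOrder D).idxOf i - 1)
  have hnext := getD_vOrder_le D ((vOrder D).idxOf i + 1)
  simp only [vRecord, List.mem_cons, List.not_mem_nil, or_false] at hx
  rcases hx with rfl | rfl | rfl | rfl | rfl | rfl | rfl
  · split_ifs <;> omega
  all_goals omega

theorem lt_of_mem_graphWords (hD : Proper D) (hV : (expand D).length < V)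
    (hc : ∀ x ∈ D, x.1 < V) : ∀ x ∈ graphWords D, x < V := by
  intro x hx
  simp only [graphWords, List.mem_append, List.mem_flatMap, List.mem_range] at hx
  rcases hx with ⟨i, hi, hx⟩ | ⟨i, hi, hx⟩
  · exact lt_of_mem_uRecord hD hV hc hi hx
  · exact lt_of_mem_vRecord hD hV hc hi hx

end Graph

namespace OrderList

variable {w k : ℕ} {o : OrderList}

theorem Valid.sum_length (h : o.Valid w k) : (o.map fun g => g.2.length).sum = k := by
  have hlength := congrArg List.length h.1
  simpa only [List.length_flatMap, List.length_map, List.length_range] using hlength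

theorem Valid.length_le (h : o.Valid w k) : o.length ≤ k := by
  rw [← h.sum_length, ← List.length_map]
  refine List.length_le_sum_of_one_le _ fun n hn => ?_
  obtain ⟨g, hg, rfl⟩ := List.mem_map.1 hn
  exact List.length_pos_iff.2 (h.2.2.2 g hg).1

theorem length_words (k : ℕ) (o : OrderList) :
    (o.words k).length = 3 * o.length + 5 * (o.map fun g => g.2.length).sum := by
  have hgroups : (o.words k).length =
      (o.zipIdx.map fun x => 3 + 5 * x.1.2.length).sum := by
    simp only [words, List.length_flatMap, List.length_append, List.length_cons, List.length_nil,
      List.map_const', List.sum_replicate, smul_eq_mul, zero_add, Nat.reduceAdd, mul_comm]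
  have hfst : (o.zipIdx.map fun x => 3 + 5 * x.1.2.length) = o.map fun g => 3 + 5 * g.2.length := by
    conv_rhs => rw [← List.zipIdx_map_fst 0 o, List.map_map]
    rfl
  rw [hgroups, hfst, List.sum_map_add, List.map_const', List.sum_replicate, List.sum_map_mul_left,
    smul_eq_mul, mul_comm]

theorem Valid.lt_of_mem_words (h : o.Valid w k) (hk : k < 2 ^ w) : ∀ x ∈ o.words k, x < 2 ^ w := by
  have hlen := h.length_le
  obtain ⟨hnodes, -, hgroupTag, htag⟩ := h
  intro x hx
  rw [words, List.mem_flatMap] at hx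
  obtain ⟨⟨g, j⟩, hgj, hx⟩ := hx
  obtain ⟨hj, hget⟩ := List.mem_zipIdx' hgj
  have hg : g ∈ o := hget ▸ List.getElem_mem _
  simp only [List.mem_append, List.mem_cons, List.not_mem_nil, or_false, List.mem_flatMap] at hx
  rcases hx with (rfl | rfl | rfl) | ⟨e, he, hx⟩
  · exact hgroupTag g hg
  · split_ifs <;> omega
  · omega
  · have hnode : e.1 < k := by
      rw [← List.mem_range, ← hnodes, List.mem_flatMap]
      exact ⟨g, hg, List.mem_map_of_mem he⟩
    rcases hx with rfl | rfl | rfl | rfl | rfl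
    · omega
    · exact (htag g hg).2.2 e he
    · omega
    · split_ifs <;> omega
    · omega

end OrderList

theorem mem_interleave {cs : List (List ℕ)} {ks : List ℕ} {x : ℕ} :
    x ∈ interleave cs ks ↔ (∃ c ∈ cs, x ∈ c) ∨ x ∈ ks := by
  fun_induction interleave cs ks <;> grind

theorem length_interleave (cs : List (List ℕ)) (ks : List ℕ) :
    (interleave cs ks).length = (cs.map List.length).sum + ks.length := by
  fun_induction interleave cs ks <;> grind

section Blocks

variable {m V : ℕ} {D : DBWT} {ks addrs : List ℕ}

theorem length_btreeBlock (hks : ks.length + 1 ≤ m) (haddrs : addrs.length ≤ m) :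
    (btreeBlock m D ks addrs).length = 4 * m := by
  have hkeys : (ks.flatMap fun i => [i, i, char D i]).length = ks.length * 3 := by
    simp only [List.length_flatMap, List.length_cons, List.length_nil, List.map_const',
      List.sum_replicate, smul_eq_mul, zero_add, Nat.reduceAdd]
  rw [btreeBlock, List.length_rightpad, List.length_append, List.length_cons, hkeys]
  omega

theorem lt_of_mem_btreeBlock (hV : ks.length < V) (hks : ∀ i ∈ ks, i < V)
    (hchar : ∀ i, char D i < V) (haddrs : ∀ a ∈ addrs, a < V) :
    ∀ x ∈ btreeBlock m D ks addrs, x < V := by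
  intro x hx
  simp only [btreeBlock, List.rightpad, List.mem_append, List.mem_cons, List.mem_flatMap,
    List.mem_replicate, List.not_mem_nil, or_false] at hx
  rcases hx with ((rfl | ⟨i, hi, rfl | rfl | rfl⟩) | hx) | ⟨-, rfl⟩
  · exact hV
  · exact hks _ hi
  · exact hks _ hi
  · exact hchar _
  · exact haddrs x hx
  · exact Nat.zero_lt_of_lt hV

end Blocks

namespace BTree

theorem numNodes_pos (h : ℕ) (t : BTree h) : 0 < numNodes h t := by
  cases h with
  | zero => exact Nat.one_pos
  | succ h => exact Nat.add_pos_left Nat.one_pos _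

theorem Valid.numNodes_le {m h : ℕ} {root : Bool} {t : BTree h} (ht : Valid m root h t)
    (hm : 3 ≤ m) : numNodes h t ≤ (inorder h t).length + root.toNat := by
  induction h generalizing root with
  | zero =>
    rw [Valid] at ht
    rw [numNodes, inorder]
    cases root
    -- `m ≤ 2 * (ks.length + 1)` and `3 ≤ m` leave no room for an empty leaf below the root.
    · have hhalf := ht.2 rfl
      omega
    · exact Nat.le_add_left _ _
  | succ h ih =>
    obtain ⟨ks, cs⟩ := t
    rw [Valid] at ht
    obtain ⟨-, -, hkey, -, hcs⟩ := ht
    have hchildren : (cs.map (numNodes h)).sum ≤ (cs.map (List.length ∘ inorder h)).sum :=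
      List.sum_le_sum fun t ht => ih (hcs t ht)
    rw [numNodes, inorder, length_interleave, List.map_map]
    omega

section Addresses

variable {h : ℕ} {cs : List (BTree h)} {a : ℕ}

theorem length_childAddrs (h a : ℕ) (cs : List (BTree h)) :
    (childAddrs h a cs).length = cs.length := by
  induction cs generalizing a with
  | nil => rfl
  | cons t cs ih => rw [childAddrs, List.length_cons, List.length_cons, ih]

theorem add_numNodes_le_of_mem_zip_childAddrs {t : BTree h} {a' : ℕ}
    (ht : (t, a') ∈ cs.zip (childAddrs h a cs)) :
    a' + numNodes h t ≤ a + (cs.map (numNodes h)).sum := by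
  induction cs generalizing a with
  | nil => cases ht
  | cons s cs ih =>
    rw [childAddrs, List.zip_cons_cons, List.mem_cons, Prod.mk.injEq] at ht
    rw [List.map_cons, List.sum_cons]
    rcases ht with ⟨rfl, rfl⟩ | ht
    · omega
    · have htail := ih ht
      omega

theorem lt_of_mem_childAddrs {x : ℕ} (hx : x ∈ childAddrs h a cs) :
    x < a + (cs.map (numNodes h)).sum := by
  obtain ⟨i, hi, rfl⟩ := List.mem_iff_getElem.1 hx
  have hics : i < cs.length := length_childAddrs h a cs ▸ hi
  have hmem : (cs[i], (childAddrs h a cs)[i]) ∈ cs.zip (childAddrs h a cs) :=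
    List.mem_iff_getElem.2 ⟨i, by grind, List.getElem_zip⟩
  exact (Nat.lt_add_of_pos_right (numNodes_pos h _)).trans_le
    (add_numNodes_le_of_mem_zip_childAddrs hmem)

end Addresses

theorem length_flatMap_zip_childAddrs {h : ℕ} {cs : List (BTree h)} (a N : ℕ)
    {words : BTree h → ℕ → List ℕ}
    (hwords : ∀ t ∈ cs, ∀ a', (words t a').length = N * numNodes h t) :
    ((cs.zip (childAddrs h a cs)).flatMap fun (t, a') => words t a').length =
      N * (cs.map (numNodes h)).sum := by
  induction cs generalizing a with
  | nil => rfl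
  | cons t cs ih =>
    obtain ⟨ht, hcs⟩ := List.forall_mem_cons.1 hwords
    rw [childAddrs, List.zip_cons_cons, List.flatMap_cons, List.length_append, ht, ih _ hcs,
      List.map_cons, List.sum_cons, mul_add]

theorem Valid.length_words {m h : ℕ} {D : DBWT} {root : Bool} {t : BTree h}
    (ht : Valid m root h t) (a : ℕ) : (words m D h a t).length = 4 * m * numNodes h t := by
  induction h generalizing root a with
  | zero =>
    rw [Valid] at ht
    rw [words, length_btreeBlock (addrs := []) ht.1 (Nat.zero_le m), numNodes, mul_one]
  | succ h ih =>
    obtain ⟨ks, cs⟩ := t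
    rw [Valid] at ht
    obtain ⟨hm, -, -, hlen, hcs⟩ := ht
    have haddrs : (childAddrs h (a + 1) cs).length ≤ m := by
      rw [length_childAddrs, hlen]
      exact hm
    rw [words, List.length_append, length_btreeBlock hm haddrs,
      length_flatMap_zip_childAddrs (a + 1) (4 * m) fun t ht a' => ih (hcs t ht) a', numNodes,
      mul_add, mul_one]

theorem lt_of_mem_words {m V h a : ℕ} {D : DBWT} {t : BTree h} (hchar : ∀ i, char D i < V)
    (hkeys : ∀ i ∈ inorder h t, i < V) (hlen : (inorder h t).length < V)
    (ha : a + numNodes h t ≤ V) : ∀ x ∈ words m D h a t, x < V := by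
  induction h generalizing a with
  | zero => exact lt_of_mem_btreeBlock hlen hkeys hchar (List.forall_mem_nil _)
  | succ h ih =>
    obtain ⟨ks, cs⟩ := t
    rw [inorder, length_interleave, List.map_map] at hlen
    rw [numNodes] at ha
    simp only [inorder, mem_interleave] at hkeys
    intro x hx
    rw [words, List.mem_append, List.mem_flatMap] at hx
    rcases hx with hx | ⟨⟨t, a'⟩, ht, hx⟩
    · refine lt_of_mem_btreeBlock (by omega) (fun i hi => hkeys i (Or.inr hi)) hchar ?_ x hx
      intro b hb
      have hlt := lt_of_mem_childAddrs hb
      omega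
    · have htcs : t ∈ cs := (List.of_mem_zip ht).1
      have haddr := add_numNodes_le_of_mem_zip_childAddrs ht
      have hinorder : (inorder h t).length ≤ (cs.map (List.length ∘ inorder h)).sum :=
        List.le_sum_of_mem (List.mem_map.2 ⟨t, htcs, rfl⟩)
      exact ih (fun i hi => hkeys i (Or.inl ⟨_, List.mem_map_of_mem htcs, hi⟩)) (by omega)
        (by omega) x hx

end BTree

namespace Memory.Represents

variable {M : Memory} {w m ρ α : ℕ} {D out : DBWT}

theorem length_heavyU_le (h : M.Represents w m ρ α D) : M.heavyU.length ≤ D.length :=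
  h.heavyU.length_eq.trans_le ((List.length_filter_le _ _).trans_eq List.length_range)

theorem length_heavyV_le (h : M.Represents w m ρ α D) : M.heavyV.length ≤ D.length :=
  h.heavyV.length_eq.trans_le ((List.length_filter_le _ _).trans_eq List.length_range)

theorem lt_of_mem_heavyU (h : M.Represents w m ρ α D) {i : ℕ} (hi : i ∈ M.heavyU) :
    i < D.length :=
  List.mem_range.1 (List.mem_filter.1 (h.heavyU.mem_iff.1 hi)).1

theorem lt_of_mem_heavyV (h : M.Represents w m ρ α D) {i : ℕ} (hi : i ∈ M.heavyV) :
    i < D.length :=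
  List.mem_range.1 (List.mem_filter.1 (h.heavyV.mem_iff.1 hi)).1

theorem length_inorder_le (h : M.Represents w m ρ α D) :
    (BTree.inorder M.height M.btree).length ≤ D.length :=
  h.keys.length_le.trans_eq (length_vOrder D)

theorem numNodes_le (h : M.Represents w m ρ α D) (hm : 3 ≤ m) :
    BTree.numNodes M.height M.btree ≤ D.length + 1 :=
  (h.btree.numNodes_le hm).trans (Nat.add_le_add_right h.length_inorder_le 1)

theorem length_words_le (h : M.Represents w m ρ α D) (hm : 3 ≤ m)
    (hout : out.length ≤ 2 * D.length) :
    (M.words m D out).length ≤ (28 + 4 * m) * D.length + (2 + 4 * m + ρ) := by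
  have hheavyU := h.length_heavyU_le
  have hheavyV := h.length_heavyV_le
  have horder : (M.order.words D.length).length ≤ 8 * D.length := by
    rw [OrderList.length_words, h.order.sum_length]
    have hgroups := h.order.length_le
    omega
  have hbtree : (BTree.words m D M.height 0 M.btree).length ≤ 4 * m * (D.length + 1) := by
    rw [h.btree.length_words]
    exact Nat.mul_le_mul_left _ (h.numNodes_le hm)
  have hbuffer : (out.flatMap fun x => [x.1, x.2]).length = out.length * 2 := by
    simp only [List.length_flatMap, List.length_cons, List.length_nil, List.map_const',
      List.sum_replicate, smul_eq_mul, zero_add, Nat.reduceAdd]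
  have hregs := h.regs.1
  simp only [Memory.words, List.length_append, List.length_cons, length_graphWords, hbuffer]
  linarith

theorem lt_of_mem_words (h : M.Represents w m ρ α D) (hm : 3 ≤ m) (hD : Proper D)
    (hlen : (expand D).length + 1 < 2 ^ w) (hc : ∀ x ∈ D, x.1 < 2 ^ w)
    (hout : ∀ x ∈ out, x.1 < 2 ^ w ∧ x.2 < 2 ^ w) : ∀ x ∈ M.words m D out, x < 2 ^ w := by
  have hproper := hD.length_le
  have hheavyU := h.length_heavyU_le
  have hheavyV := h.length_heavyV_le
  have hkeys := h.length_inorder_le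
  have hnodes := h.numNodes_le hm
  intro x hx
  simp only [Memory.words, List.mem_append, List.mem_cons, List.mem_flatMap, List.not_mem_nil,
    or_false] at hx
  rcases hx with (((((hx | hx | hx) | hx | hx) | hx) | hx) | hx) | ⟨y, hy, rfl | rfl⟩
  · exact lt_of_mem_graphWords hD (by omega) hc x hx
  · omega
  · have hlt := h.lt_of_mem_heavyU hx
    omega
  · omega
  · have hlt := h.lt_of_mem_heavyV hx
    omega
  · exact h.order.lt_of_mem_words (by omega) x hx
  · refine BTree.lt_of_mem_words (char_lt (by positivity) hc) (fun i hi => ?_) (by omega)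
      (by omega) x hx
    have hlt := mem_vOrder.1 (h.keys.subset hi)
    omega
  · exact h.regs.2 x hx
  · exact (hout y hy).1
  · exact (hout y hy).2

end Memory.Represents

/-! ### Working space -/

theorem pow_le_two_pow {n K w : ℕ} (hn : 0 < n) (h : (K : ℝ) * Real.logb 2 n ≤ w) :
    n ^ K ≤ 2 ^ w := by
  rw [← Real.logb_pow, Real.logb_le_iff_le_rpow one_lt_two (by positivity),
    Real.rpow_natCast] at h
  exact_mod_cast h

theorem pow_lt_two_pow {n d K w : ℕ} (hn : 2 ≤ n) (hd : d < K)
    (h : (K : ℝ) * Real.logb 2 n ≤ w) : n ^ d < 2 ^ w :=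
  (Nat.pow_lt_pow_right hn hd).trans_le (pow_le_two_pow (by omega) h)

theorem add_one_lt_two_pow {n K w : ℕ} (hn : 2 ≤ n) (hK : 2 ≤ K)
    (h : (K : ℝ) * Real.logb 2 n ≤ w) : n + 1 < 2 ^ w :=
  calc n + 1 < n * 2 := by omega
    _ ≤ n * n := Nat.mul_le_mul_left n hn
    _ = n ^ 2 := (sq n).symm
    _ ≤ n ^ K := Nat.pow_le_pow_right (by omega) hK
    _ ≤ 2 ^ w := pow_le_two_pow (by omega) h

section WorkingSpace

variable {α w m ρ κ d : ℕ} {T : List ℕ} {D out : DBWT} {M : Memory}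

theorem Bounded.lt_of_mem (hD : Bounded T D) (hT : ∀ c ∈ T, c < 2 ^ w) (hn : T.length < 2 ^ w) :
    ∀ x ∈ D, x.1 < 2 ^ w ∧ x.2 < 2 ^ w := fun _ hx =>
  ⟨hT _ (hD.mem_text _ (hD.proper.fst_mem_expand hx)),
    (snd_le_length_expand hx).trans_lt (hD.length_expand_le.trans_lt hn)⟩

theorem Visits.out_lt (hv : Visits α T D out) (hD : Bounded T D) (hT : ∀ c ∈ T, c < 2 ^ w)
    (hn : T.length < 2 ^ w) : ∀ x ∈ out, x.1 < 2 ^ w ∧ x.2 < 2 ^ w := by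
  rcases hv.out_eq with rfl | rfl | rfl
  · exact List.forall_mem_nil _
  · exact hD.lt_of_mem hT hn
  · exact List.forall_mem_append.2 ⟨hD.lt_of_mem hT hn, hD.compress.lt_of_mem hT hn⟩

theorem Visits.words_lt (hv : Visits α T D out) (hM : M.Represents w m ρ α D) (hα : 16 ≤ α)
    (hT : IsText T) (hn : 2 ≤ T.length) (hd : ∀ c ∈ T, c ≤ T.length ^ d) (hm : 3 ≤ m)
    (hw : ((d + 2 : ℕ) : ℝ) * Real.logb 2 T.length ≤ w) : ∀ x ∈ M.words m D out, x < 2 ^ w := by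
  have hD := hv.bounded hα hT
  have hchar : ∀ c ∈ T, c < 2 ^ w := fun c hc =>
    (hd c hc).trans_lt (pow_lt_two_pow hn (by omega) hw)
  have hlength : T.length + 1 < 2 ^ w := add_one_lt_two_pow hn (by omega) hw
  have hexpand := hD.length_expand_le
  exact hM.lt_of_mem_words hm hD.proper (by omega)
    (fun x hx => (hD.lt_of_mem hchar (by omega) x hx).1) (hv.out_lt hD hchar (by omega))

theorem Visits.length_words_le (hv : Visits α T D out) (hM : M.Represents w m ρ α D)
    (hα : 16 ≤ α) (hT : IsText T) (hm : 3 ≤ m) :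
    (M.words m D out).length ≤ ((28 + 4 * m) * 28 + (2 + 4 * m + ρ)) * numRuns T :=
  calc (M.words m D out).length
      ≤ (28 + 4 * m) * D.length + (2 + 4 * m + ρ) := hM.length_words_le hm hv.length_out_le
    _ ≤ (28 + 4 * m) * (28 * numRuns T) + (2 + 4 * m + ρ) * numRuns T :=
        Nat.add_le_add (Nat.mul_le_mul_left _ (hv.bounded hα hT).length_le)
          (Nat.le_mul_of_pos_right _ hT.numRuns_pos)
    _ = ((28 + 4 * m) * 28 + (2 + 4 * m + ρ)) * numRuns T := by ring

theorem Visits.bits_le (hv : Visits α T D out) (hM : M.Represents w m ρ α D) (hα : 16 ≤ α)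
    (hT : IsText T) (hm : 3 ≤ m) (hw : (w : ℝ) ≤ κ * Real.logb 2 T.length) :
    (M.bits w m D out : ℝ) ≤ ((((28 + 4 * m) * 28 + (2 + 4 * m + ρ)) * κ : ℕ) : ℝ) *
      numRuns T * Real.logb 2 T.length := by
  have hwords : ((M.words m D out).length : ℝ) ≤
      (((28 + 4 * m) * 28 + (2 + 4 * m + ρ) : ℕ) : ℝ) * numRuns T := by
    exact_mod_cast hv.length_words_le hM hα hT hm
  rw [Memory.bits, Nat.cast_mul, Nat.cast_mul _ κ]
  calc ((M.words m D out).length : ℝ) * w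
      ≤ ((((28 + 4 * m) * 28 + (2 + 4 * m + ρ) : ℕ) : ℝ) * numRuns T) *
          (κ * Real.logb 2 T.length) := mul_le_mul hwords hw (by positivity) (by positivity)
    _ = _ := by ring

end WorkingSpace

end RComp

theorem mainTheorem2 :
    (∃ C₀ : ℕ, ∀ (α : ℕ) (T : List ℕ), 16 ≤ α → RComp.IsText T →
      ∀ (D : RComp.DBWT) (b : Bool), RComp.Run α T T.length D b →
        D.length ≤ C₀ * RComp.numRuns T) ∧
    (∀ d : ℕ, ∃ K : ℕ, ∀ m ρ κ : ℕ, 3 ≤ m → ∃ C : ℕ,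
      ∀ (α w : ℕ) (T : List ℕ), 16 ≤ α → RComp.IsText T → 2 ≤ T.length →
        (∀ c ∈ T, c ≤ T.length ^ d) →
        (K : ℝ) * Real.logb 2 T.length ≤ w → (w : ℝ) ≤ κ * Real.logb 2 T.length →
        ∀ (D out : RComp.DBWT) (M : RComp.Memory), RComp.Visits α T D out →
          M.Represents w m ρ α D →
          (∀ x ∈ M.words m D out, x < 2 ^ w) ∧
          (M.bits w m D out : ℝ) ≤ C * RComp.numRuns T * Real.logb 2 T.length) := by
  refine ⟨⟨26, fun α T hα hT D b h => h.length_le hα hT⟩, fun d => ⟨d + 2, fun m ρ κ hm =>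
    ⟨((28 + 4 * m) * 28 + (2 + 4 * m + ρ)) * κ, ?_⟩⟩⟩
  intro α w T hα hT hn hd hw hw' D out M hv hM
  exact ⟨hv.words_lt hM hα hT hn hd hm hw, hv.bits_le hM hα hT hm hw'⟩
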